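/- Let $1\le t<n$. A (finite, abstract) complex is a family of nonempty subsets (simplices) of a finite vertex set that contains all singletons and is closed under passing to nonempty subsets. A colorless task is a triple $T=(\mathcal I,\mathcal O,\Delta)$ where $\mathcal I,\mathcal O$ are finite complexes and $\Delta$ assigns to each simplex $s\in\mathcal I$ a (possibly empty) subcomplex $\Delta(s)\subseteq\mathcal O$ such that $s'\subseteq s$ implies $\Delta(s')\subseteq\Delta(s)$. Consider $n$ asynchronous deterministic processes that communicate through atomic shared objects (each operation takes effect and responds in one indivisible step). An execution is an infinite interleaving of steps of the processes; a process is faulty in it if it takes only finitely many steps (a process that has decided is regarded as taking idle steps). A protocol solves $T$ $t$-resiliently if for every simplex $s\in\mathcal I$, every assignment of inputs $v_i\in s$ to the $n$ processes, and every execution with at most $t$ faulty processes, every non-faulty process eventually decides a value, and the set of all decided values is a simplex of $\Delta(s)$. The processes are anonymous if they all run the same code, which depends on the input value but on no process identity; they are non-anonymous if the code of a process may depend on its identity $p\in\{0,\dots,n-1\}$. A weak set object holds a set, initially $\emptyset$, and supports $\mathrm{add}(x)$ and $\mathrm{get}()$, the latter returning the set of all values added so far. A snapshot object is an array of $n$ components,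 all initially holding a default value, on which process $p$ can update component $p$ and every process can scan (read atomically) the whole array. A multi-writer/multi-reader (MWMR) register can be read and written by every process, and initially holds a default value. Objects may hold values from an arbitrary set, and a protocol may use an arbitrary family of weak set (respectively snapshot) objects. Theorem. Let $T$ be a colorless task. (1) $T$ is $t$-resilient solvable by $n$ anonymous processes with atomic weak set objects if and only if $T$ is $t$-resilient solvable by $n$ non-anonymous processes with atomic snapshot objects. (2) If $T$ is $t$-resilient solvable by $n$ anonymous processes, either with atomic weak set objects or with some finite number $m$ of atomic MWMR registers, then $T$ is $t$-resilient solvable by $n$ anonymous processes with only $n$ atomic MWMR registers. -/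

import Mathlib

namespace AnonTask

/-- A colorless task `(I, O, Δ)`. The vertex set of `I` is all of `V` and that of `O` is all of `W`
(`AbstractSimplicialComplex` contains every singleton). A carrier map sends each simplex of `I` to a
(possibly empty) subcomplex of `O`, monotonically. -/
structure ColorlessTask (V W : Type) where
  input : AbstractSimplicialComplex V
  output : AbstractSimplicialComplex W
  carrier : {s : Finset V // s ∈ input.faces} → PreAbstractSimplicialComplex W
  carrier_le : ∀ s, carrier s ≤ output.toPreAbstractSimplicialComplex
  carrier_mono : ∀ s s', s.1 ⊆ s'.1 → carrier s ≤ carrier s'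

/-- A shared memory accessed by `n` processes, given by its sequential specification: every
operation is atomic, i.e. it takes effect and responds in a single step. The caller `p : Fin n` is
an argument of `apply` only so that single-writer components can be expressed. -/
structure Memory (n : ℕ) where
  State : Type
  Op : Type
  Resp : Type
  init : State
  apply : Fin n → Op → State → State × Resp

/-! ### Atomic weak set objects -/

/-- Operations on a family, indexed by `K`, of weak set objects with values in `X`. -/
inductive WeakSetOp (K X : Type) : Type
  | add (k : K) (x : X)
  | get (k : K)

inductive WeakSetResp (X : Type) : Type
  | ack
  | values (s : Set X)

open Classical in
/-- A family of atomic weak sets, all initially empty. -/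
noncomputable def weakSetMemory (n : ℕ) (K X : Type) : Memory n where
  State := K → Set X
  Op := WeakSetOp K X
  Resp := WeakSetResp X
  init := fun _ => ∅
  apply := fun _ op m =>
    match op with
    | .add k x => (Function.update m k (insert x (m k)), .ack)
    | .get k => (m, .values (m k))

/-! ### Atomic snapshot objects -/

/-- Operations on a family, indexed by `K`, of `n`-component snapshot objects. A process can only
update its own component, so `update` does not name the component. -/
inductive SnapshotOp (K X : Type) : Type
  | update (k : K) (x : X)
  | scan (k : K)

inductive SnapshotResp (n : ℕ) (X : Type) : Type
  | ack
  | view (a : Fin n → X)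

open Classical in
/-- A family of atomic snapshot objects; the `p`-th component of each object is written by process
`p` only, and all components initially hold the default value `x₀`. -/
noncomputable def snapshotMemory (n : ℕ) (K X : Type) (x₀ : X) : Memory n where
  State := K → Fin n → X
  Op := SnapshotOp K X
  Resp := SnapshotResp n X
  init := fun _ _ => x₀
  apply := fun p op m =>
    match op with
    | .update k x => (Function.update m k (Function.update (m k) p x), .ack)
    | .scan k => (m, .view (m k))

/-! ### Atomic multi-writer/multi-reader registers -/

inductive RegisterOp (m : ℕ) (X : Type) : Type
  | read (i : Fin m)
  | write (i : Fin m) (x : X)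

inductive RegisterResp (X : Type) : Type
  | ack
  | value (x : X)

/-- An array of `m` atomic MWMR registers, all initially holding the default value `x₀`. -/
def registerMemory (n m : ℕ) (X : Type) (x₀ : X) : Memory n where
  State := Fin m → X
  Op := RegisterOp m X
  Resp := RegisterResp X
  init := fun _ => x₀
  apply := fun _ op r =>
    match op with
    | .read i => (r, .value (r i))
    | .write i x => (Function.update r i x, .ack)

/-! ### Protocols and executions -/

/-- A deterministic (non-anonymous) protocol: each process knows its identity `p`, and its code may
depend on it. In a given local state a process either invokes an operation or has decided an
output value. -/
structure Protocol {n : ℕ} (M : Memory n) (V W : Type) where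
  Local : Type
  start : Fin n → V → Local
  action : Fin n → Local → M.Op ⊕ W
  next : Fin n → Local → M.Resp → Local

/-- The code of an anonymous process: it does not depend on any identity. -/
structure AnonymousCode {n : ℕ} (M : Memory n) (V W : Type) where
  Local : Type
  start : V → Local
  action : Local → M.Op ⊕ W
  next : Local → M.Resp → Local

/-- All processes execute the same anonymous code. -/
def AnonymousCode.toProtocol {n : ℕ} {M : Memory n} {V W : Type} (C : AnonymousCode M V W) :
    Protocol M V W where
  Local := C.Local
  start := fun _ => C.start
  action := fun _ => C.action
  next := fun _ => C.next

namespace Protocol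

variable {n : ℕ} {M : Memory n} {V W : Type}

/-- The local states of all processes together with the state of the shared memory. -/
structure Config (P : Protocol M V W) where
  locals : Fin n → P.Local
  mem : M.State

def initial (P : Protocol M V W) (v : Fin n → V) : P.Config where
  locals := fun p => P.start p (v p)
  mem := M.init

/-- One step of process `p`: it executes its pending operation, or idles if it has decided. -/
def step (P : Protocol M V W) (p : Fin n) (c : P.Config) : P.Config :=
  match P.action p (c.locals p) with
  | .inl op =>
      { locals := Function.update c.locals p
          (P.next p (c.locals p) (M.apply p op c.mem).2)
        mem := (M.apply p op c.mem).1 }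
  | .inr _ => c

/-- The configuration after the first `k` steps of the schedule `σ`, from inputs `v`. -/
def run (P : Protocol M V W) (v : Fin n → V) (σ : ℕ → Fin n) : ℕ → P.Config
  | 0 => P.initial v
  | k + 1 => P.step (σ k) (P.run v σ k)

/-- Process `p` decides `w` at some point of the execution. -/
def Decides (P : Protocol M V W) (v : Fin n → V) (σ : ℕ → Fin n) (p : Fin n) (w : W) : Prop :=
  ∃ k, P.action p ((P.run v σ k).locals p) = .inr w

end Protocol

/-- The processes that crash under the schedule `σ`: those scheduled only finitely often.
(A process that has decided keeps being scheduled, without effect.) -/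
def faulty {n : ℕ} (σ : ℕ → Fin n) : Set (Fin n) :=
  {p | {k | σ k = p}.Finite}

/-- `P` solves `T` in the presence of at most `t` crashes: whatever the inputs taken from an input
simplex `s`, in every asynchronous execution with at most `t` faulty processes each non-faulty
process decides, and the set of all decided values is a simplex of `Δ(s)`. -/
def Protocol.SolvesResilient {n : ℕ} {M : Memory n} {V W : Type} (P : Protocol M V W)
    (t : ℕ) (T : ColorlessTask V W) : Prop :=
  ∀ (s : {s : Finset V // s ∈ T.input.faces}) (v : Fin n → V), (∀ p, v p ∈ s.1) →
    ∀ σ : ℕ → Fin n, (faulty σ).ncard ≤ t →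
      (∀ p, p ∉ faulty σ → ∃ w, P.Decides v σ p w) ∧
      ∃ τ ∈ (T.carrier s).faces, (τ : Set W) = {w | ∃ p, P.Decides v σ p w}

/-- `t`-resilient solvability by `n` anonymous processes with atomic weak set objects. -/
def AnonymousWeakSetSolvable (n t : ℕ) {V W : Type} (T : ColorlessTask V W) : Prop :=
  ∃ (K X : Type) (C : AnonymousCode (weakSetMemory n K X) V W), C.toProtocol.SolvesResilient t T

/-- `t`-resilient solvability by `n` non-anonymous processes with atomic snapshot objects. -/
def SnapshotSolvable (n t : ℕ) {V W : Type} (T : ColorlessTask V W) : Prop :=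
  ∃ (K X : Type) (x₀ : X) (P : Protocol (snapshotMemory n K X x₀) V W), P.SolvesResilient t T

/-- `t`-resilient solvability by `n` anonymous processes with `m` atomic MWMR registers. -/
def AnonymousRegisterSolvable (n t m : ℕ) {V W : Type} (T : ColorlessTask V W) : Prop :=
  ∃ (X : Type) (x₀ : X) (C : AnonymousCode (registerMemory n m X x₀) V W),
    C.toProtocol.SolvesResilient t T

end AnonTask

/-! The implications all pass through an intermediate notion, the `SetCode`: an anonymous process
publishes its current item in a growing set and, on obtaining a view of this set, waits, replaces
its item or decides. Two direct simulations lead to snapshots: a weak set is the union of the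
components of a snapshot object (`snapshotOfWeakSet`), and registers are obtained from weak sets of
timestamped values (`weakSetOfRegister`). The way back turns a snapshot protocol into a `SetCode`
(`History.simulation`), which can be run on one weak set (`SetCode.onWeakSet`) as well as on `n`
registers (`SetCode.onRegisters`).

The heart is `History.simulation_solves`, a simulation in the style of Borowsky and Gafni without
identities. The anonymous processes jointly run the `n` identified processes and agree on their
local states one by one. Since the task is colorless, a simulated process may start with any
published input, and any of its decisions may be adopted. Items are whole histories, so processes
with equal histories are clones, and a view is a set of histories. Safety of the agreement
(`History.enter_succ_of_commit`) rests on the views being a chain: a post with the fewest entries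
picked its value from what a committed process had already seen. The agreed states are those of a
genuine execution (`Protocol.Replay`), in which an operation takes effect at the view from which the
next state was computed.

For liveness, an unposted entry blocks one simulated process and is charged to a crashed process, so
at most `t` are blocked at once (`History.not_stuck`). An agreement that passes through infinitely
many levels would need infinitely many levels at which two processes leave the same entry
differently; but two given processes part only once (`History.finite_diverges`). Hence at most `t`
simulated processes stagnate, the others decide by resilience of the original protocol, and the
decision becomes visible.

On `n` registers, a process writes all it knows and takes a view when the registers have long been
stable and uniform. Such uniform contents form a chain (`RegisterTrace.subset_of_uniform`): between
two writes a process reads everything, so it can destroy a uniform set at most once, and a process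
that knows the set never does; hence fewer than `n` registers are spoiled. -/

namespace AnonTask

/-! ### Finite executions, their limits, and transfer of solvability along simulations -/

namespace Protocol

variable {n : ℕ} {M : Memory n} {V W : Type} (P : Protocol M V W)

/-- The configuration reached from `c` by the steps listed in `l`. -/
def exec (c : P.Config) (l : List (Fin n)) : P.Config :=
  l.foldl (fun c p => P.step p c) c

@[simp] lemma exec_nil (c : P.Config) : P.exec c [] = c := rfl

@[simp] lemma exec_cons (c : P.Config) (p : Fin n) (l : List (Fin n)) :
    P.exec c (p :: l) = P.exec (P.step p c) l := rfl

lemma exec_append (c : P.Config) (l l' : List (Fin n)) :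
    P.exec c (l ++ l') = P.exec (P.exec c l) l' := by
  simp [exec]

lemma run_eq_exec (v : Fin n → V) (σ : ℕ → Fin n) (k : ℕ) :
    P.run v σ k = P.exec (P.initial v) ((List.range k).map σ) := by
  induction k with
  | zero => rfl
  | succ k ih => simp [List.range_succ, exec_append, run, ih]

lemma step_of_op {p : Fin n} {c : P.Config} {op : M.Op} (h : P.action p (c.locals p) = .inl op) :
    P.step p c = { locals := Function.update c.locals p
                     (P.next p (c.locals p) (M.apply p op c.mem).2)
                   mem := (M.apply p op c.mem).1 } := by
  simp [step, h]

lemma step_of_decided {p : Fin n} {c : P.Config} {w : W}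
    (h : P.action p (c.locals p) = .inr w) : P.step p c = c := by
  simp [step, h]

lemma step_locals_of_ne {p q : Fin n} (h : p ≠ q) (c : P.Config) :
    (P.step q c).locals p = c.locals p := by
  unfold step
  split <;> simp [Function.update_of_ne h]

lemma action_step {p q : Fin n} {c : P.Config} {w : W} (h : P.action p (c.locals p) = .inr w) :
    P.action p ((P.step q c).locals p) = .inr w := by
  by_cases hpq : p = q
  · subst hpq
    rw [P.step_of_decided h, h]
  · rw [P.step_locals_of_ne hpq, h]

lemma action_exec {p : Fin n} {c : P.Config} {w : W} (l : List (Fin n))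
    (h : P.action p (c.locals p) = .inr w) : P.action p ((P.exec c l).locals p) = .inr w := by
  induction l generalizing c with
  | nil => exact h
  | cons q l ih => exact ih (P.action_step h)

lemma action_exec_prefix {p : Fin n} {c : P.Config} {w : W} {l l' : List (Fin n)}
    (hl : l <+: l') (h : P.action p ((P.exec c l).locals p) = .inr w) :
    P.action p ((P.exec c l').locals p) = .inr w := by
  obtain ⟨m, rfl⟩ := hl
  rw [exec_append]
  exact P.action_exec m h

lemma action_run_mono {v : Fin n → V} {σ : ℕ → Fin n} {p : Fin n} {w : W} {k k' : ℕ} (hk : k ≤ k')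
    (h : P.action p ((P.run v σ k).locals p) = .inr w) :
    P.action p ((P.run v σ k').locals p) = .inr w := by
  induction hk with
  | refl => exact h
  | step _ ih => exact P.action_step ih

end Protocol

lemma prefix_of_le {α : Type*} {l : ℕ → List α} (hl : ∀ k, l k <+: l (k + 1)) {j k : ℕ}
    (h : j ≤ k) : l j <+: l k := by
  induction h with
  | refl => exact List.prefix_rfl
  | step _ ih => exact ih.trans (hl _)

/-- An increasing sequence of lists of unbounded length has a limit. -/
lemma exists_limit_of_prefix {α : Type*} (l : ℕ → List α) (hl : ∀ k, l k <+: l (k + 1))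
    (hlen : ∀ N, ∃ k, N < (l k).length) :
    ∃ σ : ℕ → α, ∀ k, l k = (List.range (l k).length).map σ := by
  choose K hK using hlen
  refine ⟨fun j => (l (K j))[j]'(hK j), fun k => ?_⟩
  refine List.ext_getElem (by simp) fun j h₁ h₂ => ?_
  simp only [List.getElem_map, List.getElem_range]
  rcases le_total k (K j) with h | h
  · exact (prefix_of_le hl h).getElem h₁
  · exact ((prefix_of_le hl h).getElem (hK j)).symm

lemma not_mem_faulty_of_count {n : ℕ} {σ : ℕ → Fin n} {p : Fin n}
    (h : ∀ N, ∃ k, N < ((List.range k).map σ).count p) : p ∉ faulty σ := by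
  intro hp
  obtain ⟨k, hk⟩ := h hp.toFinset.card
  refine absurd hk (not_lt.2 ?_)
  have h1 : ((List.range k).map σ).count p = ((Finset.range k).filter (fun j => σ j = p)).card := by
    clear hk
    induction k with
    | zero => simp
    | succ k ih =>
      rw [List.range_succ, List.map_append, List.count_append, ih, Finset.range_add_one,
        Finset.filter_insert]
      by_cases hσ : σ k = p
      · simp [hσ]
      · simp [hσ]
  rw [h1]
  refine Finset.card_le_card fun j hj => ?_
  simp only [Finset.mem_filter] at hj
  exact hp.mem_toFinset.2 hj.2

lemma exists_count_of_not_mem_faulty {n : ℕ} {σ : ℕ → Fin n} {p : Fin n} (h : p ∉ faulty σ)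
    (N : ℕ) : ∃ k, N < ((List.range k).map σ).count p := by
  induction N with
  | zero =>
    obtain ⟨k, hk⟩ := Set.Infinite.nonempty (s := {k | σ k = p}) h
    exact ⟨k + 1, by simp only [Set.mem_ofPred_eq] at hk; simp [List.range_succ, hk]⟩
  | succ N ih =>
    obtain ⟨k, hk⟩ := ih
    obtain ⟨j, hj, hkj⟩ := Set.Infinite.exists_gt (s := {k | σ k = p}) h k
    refine ⟨j + 1, ?_⟩
    have hle : ((List.range k).map σ).count p ≤ ((List.range j).map σ).count p := by
      refine List.Sublist.count_le p (List.Sublist.map σ ?_)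
      exact List.range_sublist.2 hkj.le
    simp only [Set.mem_ofPred_eq] at hj
    rw [List.range_succ, List.map_append, List.count_append]
    simp [hj]
    omega

lemma exists_step_ge {n : ℕ} {σ : ℕ → Fin n} {p : Fin n} (h : p ∉ faulty σ) (k : ℕ) :
    ∃ j, k ≤ j ∧ σ j = p := by
  obtain ⟨j, hj, hkj⟩ := Set.Infinite.exists_gt (s := {k | σ k = p}) h k
  exact ⟨j, hkj.le, hj⟩

namespace Protocol

variable {n : ℕ} {M : Memory n} {V W : Type} {P : Protocol M V W} {t : ℕ} {T : ColorlessTask V W}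

/-- Values decided in a finite execution lie in a common simplex. -/
lemma SolvesResilient.exists_face (hP : P.SolvesResilient t T) (hn : 0 < n)
    (s : {s : Finset V // s ∈ T.input.faces}) (v : Fin n → V) (hv : ∀ p, v p ∈ s.1)
    (l : List (Fin n)) :
    ∃ τ ∈ (T.carrier s).faces, ∀ p w,
      P.action p ((P.exec (P.initial v) l).locals p) = .inr w → w ∈ τ := by
  -- After `l` the processes are scheduled in round-robin order, so that nobody is faulty and
  -- resilience applies.
  let σ : ℕ → Fin n := fun k => if h : k < l.length then l[k] else ⟨k % n, Nat.mod_lt _ hn⟩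
  have hσ : faulty σ = ∅ := by
    ext p
    simp only [faulty, Set.mem_ofPred_eq, Set.mem_empty_iff_false, iff_false]
    refine Set.infinite_of_forall_exists_gt fun a => ?_
    refine ⟨p + n * (l.length + a + 1), ?_, ?_⟩
    · have h1 : l.length + a + 1 ≤ n * (l.length + a + 1) := Nat.le_mul_of_pos_left _ hn
      have h2 : ¬ (p + n * (l.length + a + 1) < l.length) := by omega
      simp only [Set.mem_ofPred_eq, σ, h2, dite_false]
      ext
      simp [Nat.mod_eq_of_lt p.2]
    · have h1 : l.length + a + 1 ≤ n * (l.length + a + 1) := Nat.le_mul_of_pos_left _ hn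
      omega
  obtain ⟨-, τ, hτ, h⟩ := hP s v hv σ (by simp [hσ])
  refine ⟨τ, hτ, fun p w hw => ?_⟩
  rw [← Finset.mem_coe, h]
  refine ⟨p, l.length, ?_⟩
  rw [run_eq_exec]
  have : (List.range l.length).map σ = l := by
    refine List.ext_getElem (by simp) fun j h₁ h₂ => ?_
    simp [σ, h₂]
  rwa [this]

/-- Values decided in an increasing sequence of finite executions lie in a common simplex. -/
lemma SolvesResilient.exists_face_of_prefix (hP : P.SolvesResilient t T) (hn : 0 < n)
    (s : {s : Finset V // s ∈ T.input.faces}) (v : Fin n → V) (hv : ∀ p, v p ∈ s.1)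
    (l : ℕ → List (Fin n)) (hl : ∀ k, l k <+: l (k + 1)) :
    ∃ τ ∈ (T.carrier s).faces, ∀ k p w,
      P.action p ((P.exec (P.initial v) (l k)).locals p) = .inr w → w ∈ τ := by
  classical
  -- Decisions are permanent and there are finitely many processes, so one index lies beyond all
  -- decisions that ever occur.
  have hK : ∀ p, ∃ K, ∀ k w, P.action p ((P.exec (P.initial v) (l k)).locals p) = .inr w →
      P.action p ((P.exec (P.initial v) (l K)).locals p) = .inr w := by
    intro p
    by_cases h : ∃ k w, P.action p ((P.exec (P.initial v) (l k)).locals p) = .inr w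
    · obtain ⟨K, w, hw⟩ := h
      refine ⟨K, fun k w' hw' => ?_⟩
      have h1 := P.action_exec_prefix (prefix_of_le hl (le_max_left K k)) hw
      have h2 := P.action_exec_prefix (prefix_of_le hl (le_max_right K k)) hw'
      rw [hw, ← h1, h2]
    · exact ⟨0, fun k w hw => absurd ⟨k, w, hw⟩ h⟩
  choose K hK using hK
  obtain ⟨τ, hτ, h⟩ := hP.exists_face hn s v hv (l (Finset.univ.sup K))
  refine ⟨τ, hτ, fun k p w hw => h p w ?_⟩
  exact P.action_exec_prefix (prefix_of_le hl (Finset.le_sup (Finset.mem_univ p))) (hK p k w hw)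

/-- In an increasing sequence of finite executions in which all but `t` processes take unboundedly
many steps, each of the latter decides. -/
lemma SolvesResilient.eventually_decides (hP : P.SolvesResilient t T)
    (s : {s : Finset V // s ∈ T.input.faces}) (v : Fin n → V) (hv : ∀ p, v p ∈ s.1)
    (l : ℕ → List (Fin n)) (hl : ∀ k, l k <+: l (k + 1)) (F : Set (Fin n)) (hF : F.ncard ≤ t)
    (hc : ∀ p ∉ F, ∀ N, ∃ k, N < (l k).count p) {p : Fin n} (hp : p ∉ F) :
    ∃ k w, P.action p ((P.exec (P.initial v) (l k)).locals p) = .inr w := by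
  have hlen : ∀ N, ∃ k, N < (l k).length := fun N => by
    obtain ⟨k, hk⟩ := hc p hp N
    exact ⟨k, hk.trans_le List.count_le_length⟩
  obtain ⟨σ, hσ⟩ := exists_limit_of_prefix l hl hlen
  have hsub : faulty σ ⊆ F := by
    intro q hq
    by_contra hqF
    refine not_mem_faulty_of_count (fun N => ?_) hq
    obtain ⟨k, hk⟩ := hc q hqF N
    exact ⟨(l k).length, by rwa [← hσ k]⟩
  obtain ⟨h, -⟩ := hP s v hv σ ((Set.ncard_le_ncard hsub (Set.toFinite _)).trans hF)
  obtain ⟨w, j, hj⟩ := h p fun h => hp (hsub h)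
  obtain ⟨k, hk⟩ := hlen j
  refine ⟨k, w, ?_⟩
  rw [hσ k, ← run_eq_exec]
  exact P.action_run_mono hk.le hj

/-- To solve `T` it suffices to decide values of a common simplex. -/
lemma solvesResilient_of_subset (htn : t < n)
    (h : ∀ (s : {s : Finset V // s ∈ T.input.faces}) (v : Fin n → V), (∀ p, v p ∈ s.1) →
      ∀ σ : ℕ → Fin n, (faulty σ).ncard ≤ t →
        (∀ p, p ∉ faulty σ → ∃ w, P.Decides v σ p w) ∧
        ∃ τ ∈ (T.carrier s).faces, ∀ p w, P.Decides v σ p w → w ∈ τ) :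
    P.SolvesResilient t T := by
  classical
  intro s v hv σ hσ
  obtain ⟨h₁, τ, hτ, h₂⟩ := h s v hv σ hσ
  refine ⟨h₁, τ.filter fun w => ∃ p, P.Decides v σ p w, ?_, ?_⟩
  -- A simplex is nonempty: since `t < n`, some process is not faulty, and its decision witnesses
  -- this.
  · have hne : ∃ p, p ∉ faulty σ := by
      by_contra! hall
      have : faulty σ = Set.univ := Set.eq_univ_of_forall hall
      rw [this, Set.ncard_univ, Nat.card_fin] at hσ
      omega
    obtain ⟨p, hp⟩ := hne
    obtain ⟨w, hw⟩ := h₁ p hp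
    have hmem : w ∈ τ.filter fun w => ∃ p, P.Decides v σ p w :=
      Finset.mem_filter.2 ⟨h₂ p w hw, p, hw⟩
    exact ((T.carrier s).isRelLowerSet_faces hτ).2 (Finset.filter_subset _ _) ⟨w, hmem⟩
  · ext w
    simp only [Finset.coe_filter, Set.mem_ofPred_eq, and_iff_right_iff_imp]
    rintro ⟨p, hp⟩
    exact h₂ p w hp

/-- `P'` solves every task solved by a protocol `P` that it simulates. -/
lemma SolvesResilient.of_simulation {M' : Memory n} {P' : Protocol M' V W}
    (hP : P.SolvesResilient t T) (htn : t < n)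
    (H : ∀ (v : Fin n → V) (σ : ℕ → Fin n), ∃ l : ℕ → List (Fin n),
      (∀ k, l k <+: l (k + 1)) ∧ (∀ p ∉ faulty σ, ∀ N, ∃ k, N < (l k).count p) ∧
      (∀ k p w, P'.action p ((P'.run v σ k).locals p) = .inr w →
        ∃ k', P.action p ((P.exec (P.initial v) (l k')).locals p) = .inr w) ∧
      ∀ p ∉ faulty σ, ∀ k w, P.action p ((P.exec (P.initial v) (l k)).locals p) = .inr w →
        ∃ w', P'.Decides v σ p w') :
    P'.SolvesResilient t T := by
  refine solvesResilient_of_subset htn fun s v hv σ hσ => ?_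
  obtain ⟨l, hl, hc, h₁, h₂⟩ := H v σ
  constructor
  · intro p hp
    obtain ⟨k, w, hw⟩ := hP.eventually_decides s v hv l hl _ hσ hc hp
    exact h₂ p hp k w hw
  · obtain ⟨τ, hτ, h⟩ := hP.exists_face_of_prefix (by omega) s v hv l hl
    refine ⟨τ, hτ, ?_⟩
    rintro p w ⟨k, hk⟩
    obtain ⟨k', hk'⟩ := h₁ k p w hk
    exact h k' p w hk'

end Protocol

end AnonTask

namespace AnonTask

/-! ### Weak sets from snapshots -/

section WeakSetFromSnapshot

variable {n t : ℕ} {V W K X : Type}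

open Classical in
/-- Each process keeps the values it has added in its own snapshot component. -/
noncomputable def snapshotOfWeakSet (C : AnonymousCode (weakSetMemory n K X) V W) :
    Protocol (snapshotMemory n K (Set X) ∅) V W where
  Local := C.Local × (K → Set X)
  start := fun _ v => (C.start v, fun _ => ∅)
  action := fun _ s =>
    match C.action s.1 with
    | .inl (.add k x) => .inl (.update k (insert x (s.2 k)))
    | .inl (.get k) => .inl (.scan k)
    | .inr w => .inr w
  next := fun _ s r =>
    match C.action s.1, r with
    | .inl (.add k x), _ => (C.next s.1 .ack, Function.update s.2 k (insert x (s.2 k)))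
    | .inl (.get _), .view a => (C.next s.1 (.values (⋃ p, a p)), s.2)
    | _, _ => s

/-- The two executions run in lockstep under the same schedule. The local copy of a process's own
component is needed because an update overwrites the component and must repeat the earlier values.
-/
lemma snapshotOfWeakSet_run (C : AnonymousCode (weakSetMemory n K X) V W) (v : Fin n → V)
    (σ : ℕ → Fin n) (k : ℕ) :
    (∀ p, (((snapshotOfWeakSet C).run v σ k).locals p).1 = (C.toProtocol.run v σ k).locals p) ∧
    (∀ p j, (((snapshotOfWeakSet C).run v σ k).locals p).2 j =
      ((snapshotOfWeakSet C).run v σ k).mem j p) ∧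
    ∀ j, (C.toProtocol.run v σ k).mem j = ⋃ p, ((snapshotOfWeakSet C).run v σ k).mem j p := by
  classical
  induction k with
  | zero =>
    refine ⟨fun p => rfl, fun p j => rfl, fun j => ?_⟩
    exact Set.iUnion_empty.symm
  | succ k ih =>
    obtain ⟨h₁, h₂, h₃⟩ := ih
    simp only [Protocol.run]
    generalize (snapshotOfWeakSet C).run v σ k = c at *
    generalize C.toProtocol.run v σ k = a at *
    generalize σ k = p
    rcases hact : C.action (a.locals p) with (⟨j, x⟩ | j) | w
    · have ha : (snapshotOfWeakSet C).action p (c.locals p) =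
          .inl (.update j (insert x ((c.locals p).2 j))) := by
        simp [snapshotOfWeakSet, h₁, hact]
      rw [Protocol.step_of_op _ ha, C.toProtocol.step_of_op (p := p) (c := a) hact]
      refine ⟨fun q => ?_, fun q i => ?_, fun i => ?_⟩
      · by_cases hq : q = p
        · subst hq
          simp [snapshotOfWeakSet, h₁, hact, weakSetMemory, AnonymousCode.toProtocol]
        · simp only [Function.update_of_ne hq]
          exact h₁ q
      · by_cases hq : q = p
        · subst hq
          by_cases hi : i = j
          · subst hi
            simp [snapshotOfWeakSet, h₁, hact, snapshotMemory]
          · simp [snapshotOfWeakSet, h₁, hact, snapshotMemory, Function.update_of_ne hi, h₂]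
        · by_cases hi : i = j
          · subst hi
            simp [snapshotMemory, Function.update_of_ne hq, h₂]
          · simp [snapshotMemory, Function.update_of_ne hq, Function.update_of_ne hi, h₂]
      · by_cases hi : i = j
        · subst hi
          ext y
          simp only [weakSetMemory, snapshotMemory, Function.update_self, Set.mem_insert_iff, h₃,
            Set.mem_iUnion]
          constructor
          · rintro (rfl | ⟨q, hq⟩)
            · exact ⟨p, by simp⟩
            · refine ⟨q, ?_⟩
              by_cases hqp : q = p
              · subst hqp
                simp [h₂, hq]
              · simpa [Function.update_of_ne hqp] using hq
          · rintro ⟨q, hq⟩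
            by_cases hqp : q = p
            · subst hqp
              simp only [Function.update_self, Set.mem_insert_iff, h₂] at hq
              exact hq.imp_right fun h => ⟨q, h⟩
            · rw [Function.update_of_ne hqp] at hq
              exact .inr ⟨q, hq⟩
        · simp [weakSetMemory, snapshotMemory, Function.update_of_ne hi, h₃]
    · have ha : (snapshotOfWeakSet C).action p (c.locals p) = .inl (.scan j) := by
        simp [snapshotOfWeakSet, h₁, hact]
      rw [Protocol.step_of_op _ ha, C.toProtocol.step_of_op (p := p) (c := a) hact]
      refine ⟨fun q => ?_, fun q i => ?_, fun i => ?_⟩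
      · by_cases hq : q = p
        · subst hq
          simp [snapshotOfWeakSet, h₁, hact, weakSetMemory, AnonymousCode.toProtocol,
            snapshotMemory, h₃]
        · simp only [Function.update_of_ne hq]
          exact h₁ q
      · by_cases hq : q = p
        · subst hq
          simp [snapshotOfWeakSet, h₁, hact, snapshotMemory, h₂]
        · simp [snapshotMemory, Function.update_of_ne hq, h₂]
      · simp [weakSetMemory, snapshotMemory, h₃]
    · have ha : (snapshotOfWeakSet C).action p (c.locals p) = .inr w := by
        simp [snapshotOfWeakSet, h₁, hact]
      rw [Protocol.step_of_decided _ ha, C.toProtocol.step_of_decided (p := p) (c := a) hact]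
      exact ⟨h₁, h₂, h₃⟩

lemma snapshotOfWeakSet_action (C : AnonymousCode (weakSetMemory n K X) V W) (v : Fin n → V)
    (σ : ℕ → Fin n) (k : ℕ) (p : Fin n) (w : W) :
    (snapshotOfWeakSet C).action p (((snapshotOfWeakSet C).run v σ k).locals p) = .inr w ↔
      C.toProtocol.action p ((C.toProtocol.run v σ k).locals p) = .inr w := by
  rw [← (snapshotOfWeakSet_run C v σ k).1 p]
  generalize ((snapshotOfWeakSet C).run v σ k).locals p = s
  change _ ↔ C.action s.1 = _
  rcases hact : C.action s.1 with (⟨j, x⟩ | j) | w' <;> simp [snapshotOfWeakSet, hact]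

theorem AnonymousWeakSetSolvable.snapshotSolvable {T : ColorlessTask V W} (htn : t < n)
    (h : AnonymousWeakSetSolvable n t T) : SnapshotSolvable n t T := by
  obtain ⟨K, X, C, hC⟩ := h
  refine ⟨K, Set X, ∅, snapshotOfWeakSet C, hC.of_simulation htn fun v σ => ?_⟩
  refine ⟨fun k => (List.range k).map σ, fun k => ?_, fun p hp N => ?_, fun k p w hw => ?_,
    fun p _ k w hw => ?_⟩
  · simp only [List.range_succ, List.map_append]
    exact List.prefix_append _ _
  · exact exists_count_of_not_mem_faulty hp N
  · refine ⟨k, ?_⟩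
    rw [← Protocol.run_eq_exec]
    exact (snapshotOfWeakSet_action C v σ k p w).1 hw
  · rw [← Protocol.run_eq_exec] at hw
    exact ⟨w, k, (snapshotOfWeakSet_action C v σ k p w).2 hw⟩

end WeakSetFromSnapshot

/-! ### Registers from weak sets -/

section RegisterFromWeakSet

variable {n m t : ℕ} {V W X : Type}

/-- An arbitrary linear order, used to break ties between equal timestamps. -/
@[reducible] noncomputable def arbitraryLinearOrder (X : Type) : LinearOrder X :=
  haveI := Classical.decRel (WellOrderingRel (α := X))
  linearOrderOfSTO (WellOrderingRel (α := X))

/-- Timestamped values. -/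
abbrev Stamp (X : Type) := ℕ ×ₗ X

noncomputable instance (X : Type) : LinearOrder (Stamp X) :=
  letI := arbitraryLinearOrder X
  inferInstanceAs (LinearOrder (ℕ ×ₗ X))

lemma Stamp.lt_of_fst_lt {a b : Stamp X} (h : (ofLex a).1 < (ofLex b).1) : a < b :=
  letI := arbitraryLinearOrder X
  Prod.Lex.lt_iff.2 (.inl h)

lemma Stamp.fst_le_of_le {a b : Stamp X} (h : a ≤ b) : (ofLex a).1 ≤ (ofLex b).1 := by
  by_contra hlt
  exact absurd h (not_le.2 (Stamp.lt_of_fst_lt (not_le.1 hlt)))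

open Classical in
/-- The value with the greatest timestamp. -/
noncomputable def latest (x₀ : X) (S : Set (Stamp X)) : X :=
  if h : ∃ y, IsGreatest S y then (ofLex h.choose).2 else x₀

lemma latest_eq {x₀ : X} {S : Set (Stamp X)} {y : Stamp X} (h : IsGreatest S y) :
    latest x₀ S = (ofLex y).2 := by
  have hex : ∃ y, IsGreatest S y := ⟨y, h⟩
  rw [latest, dif_pos hex, hex.choose_spec.unique h]

/-- An empty weak set represents a register that still holds its default. -/
lemma latest_empty {x₀ : X} : latest x₀ (∅ : Set (Stamp X)) = x₀ := by
  rw [latest, dif_neg]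
  rintro ⟨y, hy, -⟩
  exact hy

open Classical in
/-- A timestamp greater than all timestamps in `S`. -/
noncomputable def freshStamp (S : Set (Stamp X)) : ℕ :=
  if h : ∃ ts, ∀ y ∈ S, (ofLex y).1 < ts then h.choose else 0

/-- The hypothesis excludes unbounded sets, for which `freshStamp` takes the junk value `0`; it is
an invariant of the simulation. -/
lemma lt_freshStamp {S : Set (Stamp X)} (h : S = ∅ ∨ ∃ y, IsGreatest S y) {y : Stamp X}
    (hy : y ∈ S) : (ofLex y).1 < freshStamp S := by
  have hex : ∃ ts, ∀ y ∈ S, (ofLex y).1 < ts := by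
    rcases h with rfl | ⟨z, hz⟩
    · exact ⟨0, by simp⟩
    · exact ⟨(ofLex z).1 + 1, fun y hy => Nat.lt_succ_of_le (Stamp.fst_le_of_le (hz.2 hy))⟩
  rw [freshStamp, dif_pos hex]
  exact hex.choose_spec y hy

/-- A write takes a timestamp by a `get` and then adds the stamped value; a read returns the value
with the greatest stamp. -/
noncomputable def weakSetOfRegister {x₀ : X} (C : AnonymousCode (registerMemory n m X x₀) V W) :
    AnonymousCode (weakSetMemory n (Fin m) (Stamp X)) V W where
  Local := C.Local × Option ℕ
  start := fun v => (C.start v, none)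
  action := fun s =>
    match C.action s.1, s.2 with
    | .inl (.read i), _ => .inl (.get i)
    | .inl (.write i _), none => .inl (.get i)
    | .inl (.write i x), some ts => .inl (.add i (toLex (ts, x)))
    | .inr w, _ => .inr w
  next := fun s r =>
    match C.action s.1, s.2, r with
    | .inl (.read _), _, .values S => (C.next s.1 (.value (latest x₀ S)), none)
    | .inl (.write _ _), none, .values S => (s.1, some (freshStamp S))
    | .inl (.write _ _), some _, _ => (C.next s.1 .ack, none)
    | _, _, _ => s

variable {x₀ : X} (C : AnonymousCode (registerMemory n m X x₀) V W)

/-- A configuration of the simulated protocol. -/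
def registerConfig (loc : Fin n → C.Local) (mem : Fin m → X) : C.toProtocol.Config := ⟨loc, mem⟩

/-- A configuration of the simulating protocol. -/
def stampConfig (loc : Fin n → C.Local × Option ℕ) (mem : Fin m → Set (Stamp X)) :
    (weakSetOfRegister C).toProtocol.Config := ⟨loc, mem⟩

variable {C}

lemma step_registerConfig_read {loc : Fin n → C.Local} {mem : Fin m → X} {p : Fin n} {i : Fin m}
    (h : C.action (loc p) = .inl (.read i)) :
    C.toProtocol.step p (registerConfig C loc mem) =
      registerConfig C (Function.update loc p (C.next (loc p) (.value (mem i)))) mem :=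
  C.toProtocol.step_of_op (c := registerConfig C loc mem) h

lemma step_registerConfig_write {loc : Fin n → C.Local} {mem : Fin m → X} {p : Fin n} {i : Fin m}
    {x : X} (h : C.action (loc p) = .inl (.write i x)) :
    C.toProtocol.step p (registerConfig C loc mem) =
      registerConfig C (Function.update loc p (C.next (loc p) .ack)) (Function.update mem i x) :=
  C.toProtocol.step_of_op (c := registerConfig C loc mem) h

lemma step_registerConfig_decided {loc : Fin n → C.Local} {mem : Fin m → X} {p : Fin n} {w : W}
    (h : C.action (loc p) = .inr w) :
    C.toProtocol.step p (registerConfig C loc mem) = registerConfig C loc mem :=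
  C.toProtocol.step_of_decided (c := registerConfig C loc mem) h

variable {loc : Fin n → C.Local × Option ℕ} {mem : Fin m → Set (Stamp X)} {p : Fin n} {i : Fin m}
  {s : C.Local}

lemma step_stampConfig_read {o : Option ℕ} (hs : loc p = (s, o))
    (h : C.action s = .inl (.read i)) :
    (weakSetOfRegister C).toProtocol.step p (stampConfig C loc mem) =
      stampConfig C (Function.update loc p (C.next s (.value (latest x₀ (mem i))), none)) mem := by
  have hc : (weakSetOfRegister C).action (loc p) = .inl (.get i) := by
    simp only [weakSetOfRegister, hs, h]
  have hn : (weakSetOfRegister C).next (loc p) (.values (mem i)) =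
      (C.next s (.value (latest x₀ (mem i))), none) := by
    simp only [weakSetOfRegister, hs, h]
  rw [← hn]
  exact Protocol.step_of_op _ (c := stampConfig C loc mem) hc

lemma step_stampConfig_stamp {x : X} (hs : loc p = (s, none))
    (h : C.action s = .inl (.write i x)) :
    (weakSetOfRegister C).toProtocol.step p (stampConfig C loc mem) =
      stampConfig C (Function.update loc p (s, some (freshStamp (mem i)))) mem := by
  have hc : (weakSetOfRegister C).action (loc p) = .inl (.get i) := by
    simp only [weakSetOfRegister, hs, h]
  have hn : (weakSetOfRegister C).next (loc p) (.values (mem i)) =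
      (s, some (freshStamp (mem i))) := by
    simp only [weakSetOfRegister, hs, h]
  rw [← hn]
  exact Protocol.step_of_op _ (c := stampConfig C loc mem) hc

open Classical in
lemma step_stampConfig_add {x : X} {ts : ℕ} (hs : loc p = (s, some ts))
    (h : C.action s = .inl (.write i x)) :
    (weakSetOfRegister C).toProtocol.step p (stampConfig C loc mem) =
      stampConfig C (Function.update loc p (C.next s .ack, none))
        (Function.update mem i (insert (toLex (ts, x)) (mem i))) := by
  have hc : (weakSetOfRegister C).action (loc p) = .inl (.add i (toLex (ts, x))) := by
    simp only [weakSetOfRegister, hs, h]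
  have hn : (weakSetOfRegister C).next (loc p) .ack = (C.next s .ack, none) := by
    simp only [weakSetOfRegister, hs, h]
  rw [← hn]
  refine (Protocol.step_of_op _ (c := stampConfig C loc mem) hc).trans ?_
  simp only [stampConfig, weakSetMemory]
  congr!

lemma step_stampConfig_decided {o : Option ℕ} {w : W} (hs : loc p = (s, o))
    (h : C.action s = .inr w) :
    (weakSetOfRegister C).toProtocol.step p (stampConfig C loc mem) = stampConfig C loc mem := by
  have hc : (weakSetOfRegister C).action (loc p) = .inr w := by
    simp only [weakSetOfRegister, hs, h]
  exact Protocol.step_of_decided _ (c := stampConfig C loc mem) hc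

variable (C)

/-- The relation between a process of the simulation and the simulated process, where `N` and `cnt`
are the numbers of their steps. A pending write has taken effect as soon as a stamp that is at
least as great is present. -/
def LocalRel (S : Fin m → Set (Stamp X)) (s : C.Local × Option ℕ) (a : C.Local) (N cnt : ℕ) :
    Prop :=
  match s with
  | (s, none) => a = s ∧ N ≤ 2 * cnt
  | (s, some ts) => ∃ i x, C.action s = .inl (.write i x) ∧
      ((a = s ∧ (∀ y ∈ S i, y < toLex (ts, x)) ∧ N ≤ 2 * cnt + 1) ∨
        (a = C.next s .ack ∧ (∃ y ∈ S i, toLex (ts, x) ≤ y) ∧ N + 1 ≤ 2 * cnt))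

/-- The simulation relation. -/
structure RegisterRel (loc : Fin n → C.Local × Option ℕ) (mem : Fin m → Set (Stamp X))
    (loc' : Fin n → C.Local) (mem' : Fin m → X) (N cnt : Fin n → ℕ) : Prop where
  greatest : ∀ i, mem i = ∅ ∨ ∃ y, IsGreatest (mem i) y
  mem_eq : ∀ i, mem' i = latest x₀ (mem i)
  local_rel : ∀ p, LocalRel C mem (loc p) (loc' p) (N p) (cnt p)

variable {C}

/-- Pending writes that remain pending while a stamp is added. -/
lemma LocalRel.insert_stamp [DecidableEq (Fin m)] {S : Fin m → Set (Stamp X)}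
    {s : C.Local × Option ℕ} {a : C.Local} {N cnt : ℕ} {z : Stamp X} {i : Fin m}
    (h : LocalRel C S s a N cnt)
    (hz : ∀ s' ts x, s = (s', some ts) → C.action s' = .inl (.write i x) →
      (∀ y ∈ S i, y < toLex (ts, x)) → z < toLex (ts, x)) :
    LocalRel C (Function.update S i (insert z (S i))) s a N cnt := by
  rcases s with ⟨s, _ | ts⟩
  · exact h
  · obtain ⟨j, x, hact, h⟩ := h
    refine ⟨j, x, hact, ?_⟩
    rcases eq_or_ne j i with rfl | hj
    · rw [Function.update_self]
      rcases h with ⟨h1, h2, h3⟩ | ⟨h1, ⟨y, hy, hy'⟩, h3⟩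
      · refine .inl ⟨h1, ?_, h3⟩
        rintro y (rfl | hy)
        · exact hz s ts x rfl hact h2
        · exact h2 y hy
      · exact .inr ⟨h1, ⟨y, Set.mem_insert_of_mem _ hy, hy'⟩, h3⟩
    · rwa [Function.update_of_ne hj]

-- Consecutive writes to one register affect only that register. Its resulting content is left
-- unspecified because the next write overwrites it.
open Classical in
lemma exec_writes (i : Fin m) (l : List (Fin n)) (hl : l.Nodup) (loc : Fin n → C.Local)
    (mem : Fin m → X) (h : ∀ q ∈ l, ∃ x, C.action (loc q) = .inl (.write i x)) :
    ∃ mem' : Fin m → X, (∀ j, j ≠ i → mem' j = mem j) ∧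
      C.toProtocol.exec (registerConfig C loc mem) l =
        registerConfig C (fun q => if q ∈ l then C.next (loc q) .ack else loc q) mem' := by
  induction l generalizing loc mem with
  | nil => exact ⟨mem, fun _ _ => rfl, by simp⟩
  | cons p l ih =>
    obtain ⟨hp, hl⟩ := List.nodup_cons.1 hl
    obtain ⟨x, hx⟩ := h p (by simp)
    obtain ⟨mem', h1, h2⟩ := ih hl (Function.update loc p (C.next (loc p) .ack))
      (Function.update mem i x) fun q hq => by
        rw [Function.update_of_ne (by rintro rfl; exact hp hq)]
        exact h q (by simp [hq])
    refine ⟨mem', fun j hj => by rw [h1 j hj, Function.update_of_ne hj], ?_⟩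
    rw [Protocol.exec_cons, step_registerConfig_write hx, h2]
    congr 1
    funext q
    by_cases hq : q = p
    · subst hq
      simp [hp]
    · simp [hq]

-- One step of the simulation is matched by a list of simulated steps. Adding a stamp greater than
-- all present ones linearizes, just before the process's own write, all pending writes with smaller
-- or equal stamps; nobody can read their values any more. Adding a stamp that is already dominated
-- is matched by no step, its write having been linearized earlier. Processes may hold equal stamps,
-- so the comparison has to be non-strict.
open Classical in
lemma RegisterRel.exists_step {loc' : Fin n → C.Local} {mem' : Fin m → X} {N cnt : Fin n → ℕ}
    (h : RegisterRel C loc mem loc' mem' N cnt) (p : Fin n) :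
    ∃ (l : List (Fin n)) (loc₁ : Fin n → C.Local × Option ℕ) (mem₁ : Fin m → Set (Stamp X))
      (loc₁' : Fin n → C.Local) (mem₁' : Fin m → X),
      (weakSetOfRegister C).toProtocol.step p (stampConfig C loc mem) = stampConfig C loc₁ mem₁ ∧
      C.toProtocol.exec (registerConfig C loc' mem') l = registerConfig C loc₁' mem₁' ∧
      RegisterRel C loc₁ mem₁ loc₁' mem₁' (fun q => N q + if q = p then 1 else 0)
        (fun q => cnt q + l.count q) := by
  have hp := h.local_rel p
  rcases hs : loc p with ⟨s, o⟩
  rw [hs] at hp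
  rcases hact : C.action s with (i | ⟨i, x⟩) | w
  · cases o with
    | some ts =>
      obtain ⟨i', x, hw, -⟩ := hp
      rw [hact] at hw
      cases hw
    | none =>
      obtain ⟨has, hN⟩ := hp
      have ha : C.action (loc' p) = .inl (.read i) := has ▸ hact
      refine ⟨[p], _, _, _, _, step_stampConfig_read hs hact, step_registerConfig_read ha,
        h.greatest, h.mem_eq, fun q => ?_⟩
      by_cases hq : q = p
      · subst hq
        rw [Function.update_self, Function.update_self, has, h.mem_eq]
        refine ⟨rfl, ?_⟩
        simp
        omega
      · have hpq : ¬ p = q := fun e => hq e.symm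
        simpa [Function.update_of_ne hq, hq, List.count_singleton, hpq] using h.local_rel q
  · cases o with
    | none =>
      obtain ⟨has, hN⟩ := hp
      refine ⟨[], _, _, _, _, step_stampConfig_stamp hs hact, rfl, h.greatest, h.mem_eq,
        fun q => ?_⟩
      by_cases hq : q = p
      · subst hq
        rw [Function.update_self]
        refine ⟨i, x, hact, .inl ⟨has, fun y hy => ?_, ?_⟩⟩
        · exact Stamp.lt_of_fst_lt (lt_freshStamp (h.greatest i) hy)
        · simp
          omega
      · simpa [Function.update_of_ne hq, hq] using h.local_rel q
    | some ts =>
      obtain ⟨i', x', hw, hp⟩ := hp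
      rw [hact] at hw
      obtain ⟨rfl, rfl⟩ : i = i' ∧ x = x' := by
        cases hw
        exact ⟨rfl, rfl⟩
      rcases hp with ⟨has, hlt, hN⟩ | ⟨has, ⟨y₀, hy₀, hle⟩, hN⟩
      -- The pending writes to the same register that are obsolete once this stamp is added.
      · let Q : Finset (Fin n) := Finset.univ.filter fun q => q ≠ p ∧ ∃ s' ts' x',
          loc q = (s', some ts') ∧ C.action s' = .inl (.write i x') ∧
          (∀ y ∈ mem i, y < toLex (ts', x')) ∧ toLex (ts', x') ≤ (toLex (ts, x) : Stamp X)
        have hQ' : ∀ q ∈ Q, ∃ s' ts' x', loc q = (s', some ts') ∧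
            C.action s' = .inl (.write i x') ∧ toLex (ts', x') ≤ (toLex (ts, x) : Stamp X) ∧
            loc' q = s' ∧ N q ≤ 2 * cnt q + 1 := by
          intro q hq
          obtain ⟨-, -, s', ts', x', e, hact', hlt', hle'⟩ := Finset.mem_filter.1 hq
          have := h.local_rel q
          rw [e] at this
          obtain ⟨i'', x'', e'', h''⟩ := this
          rw [hact'] at e''
          cases e''
          rcases h'' with ⟨h1, -, h3⟩ | ⟨-, ⟨y, hy, hy'⟩, -⟩
          · exact ⟨s', ts', x', e, hact', hle', h1, h3⟩
          · exact absurd (hlt' y hy) (not_lt.2 hy')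
        have hQ : ∀ q ∈ Q.toList, ∃ x, C.action (loc' q) = .inl (.write i x) := by
          intro q hq
          obtain ⟨s', ts', x', -, h1, -, h2, -⟩ := hQ' q (Finset.mem_toList.1 hq)
          exact ⟨x', by rw [h2, h1]⟩
        obtain ⟨mem'', hex₂, hex₁⟩ := exec_writes i Q.toList Q.nodup_toList loc' mem' hQ
        have hpQ : p ∉ Q.toList := by simp [Q]
        have hbact : C.action ((fun q => if q ∈ Q.toList then C.next (loc' q) .ack else loc' q) p)
            = .inl (.write i x) := by
          simp only [if_neg hpQ, has, hact]
        have hexec : C.toProtocol.exec (registerConfig C loc' mem') (Q.toList ++ [p]) =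
            registerConfig C (Function.update (fun q => if q ∈ Q.toList then
              C.next (loc' q) .ack else loc' q) p (C.next (if p ∈ Q.toList then
              C.next (loc' p) .ack else loc' p) .ack)) (Function.update mem'' i x) := by
          rw [Protocol.exec_append, hex₁, Protocol.exec_cons, Protocol.exec_nil,
            step_registerConfig_write hbact]
        refine ⟨Q.toList ++ [p], _, _, _, _, step_stampConfig_add hs hact, hexec, ?_⟩
        have hgr : IsGreatest (insert (toLex (ts, x)) (mem i)) (toLex (ts, x) : Stamp X) := by
          refine ⟨Set.mem_insert _ _, ?_⟩
          rintro y (rfl | hy)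
          · exact le_rfl
          · exact (hlt y hy).le
        refine ⟨fun j => ?_, fun j => ?_, fun q => ?_⟩
        · rcases eq_or_ne j i with rfl | hj
          · rw [Function.update_self]
            exact .inr ⟨_, hgr⟩
          · rw [Function.update_of_ne hj]
            exact h.greatest j
        · rcases eq_or_ne j i with rfl | hj
          · rw [Function.update_self, Function.update_self, latest_eq hgr]
            rfl
          · rw [Function.update_of_ne hj, Function.update_of_ne hj, hex₂ j hj]
            exact h.mem_eq j
        · by_cases hq : q = p
          · subst hq
            rw [Function.update_self, Function.update_self, if_neg hpQ, has]
            refine ⟨rfl, ?_⟩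
            simp
            omega
          · rw [Function.update_of_ne hq, Function.update_of_ne hq]
            have hcnt : (Q.toList ++ [p]).count q = if q ∈ Q.toList then 1 else 0 := by
              rw [List.count_append, List.count_eq_zero_of_not_mem (l := [p]) (by simpa using hq),
                add_zero]
              split_ifs with hm
              · exact List.count_eq_one_of_mem Q.nodup_toList hm
              · exact List.count_eq_zero_of_not_mem hm
            simp only [hcnt, hq, if_false, add_zero]
            by_cases hm : q ∈ Q.toList
            · obtain ⟨s', ts', x', e, hact', hle', h1, h3⟩ := hQ' q (Finset.mem_toList.1 hm)
              rw [if_pos hm, if_pos hm, e, h1]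
              refine ⟨i, x', hact', .inr ⟨rfl, ⟨toLex (ts, x), ?_, hle'⟩, by omega⟩⟩
              rw [Function.update_self]
              exact Set.mem_insert _ _
            · rw [if_neg hm, if_neg hm]
              refine (h.local_rel q).insert_stamp fun s' ts' x' e hact' hlt' => ?_
              by_contra hge
              refine hm (Finset.mem_toList.2 (Finset.mem_filter.2 ⟨Finset.mem_univ _, hq, ?_⟩))
              exact ⟨s', ts', x', e, hact', hlt', not_lt.1 hge⟩
      -- The write has already taken effect and been overwritten or tied; the greatest stamp, and
      -- hence the register, does not change.
      · obtain ⟨z, hz⟩ : ∃ z, IsGreatest (mem i) z := by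
          rcases h.greatest i with he | he
          · rw [he] at hy₀
            exact absurd hy₀ (Set.notMem_empty _)
          · exact he
        have hz' : IsGreatest (insert (toLex (ts, x)) (mem i)) z := by
          refine ⟨Set.mem_insert_of_mem _ hz.1, ?_⟩
          rintro y (rfl | hy)
          · exact hle.trans (hz.2 hy₀)
          · exact hz.2 hy
        refine ⟨[], _, _, _, _, step_stampConfig_add hs hact, rfl, fun j => ?_, fun j => ?_,
          fun q => ?_⟩
        · rcases eq_or_ne j i with rfl | hj
          · rw [Function.update_self]
            exact .inr ⟨_, hz'⟩
          · rw [Function.update_of_ne hj]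
            exact h.greatest j
        · rw [h.mem_eq]
          rcases eq_or_ne j i with rfl | hj
          · rw [Function.update_self, latest_eq hz', latest_eq hz]
          · rw [Function.update_of_ne hj]
        · by_cases hq : q = p
          · subst hq
            rw [Function.update_self, has]
            refine ⟨rfl, ?_⟩
            simp
            omega
          · rw [Function.update_of_ne hq]
            simp only [hq, if_false, add_zero, List.count_nil]
            exact (h.local_rel q).insert_stamp fun s' ts' x' e hact' hlt' =>
              hle.trans_lt (hlt' y₀ hy₀)
  · cases o with
    | some ts =>
      obtain ⟨i', x, hw, -⟩ := hp
      rw [hact] at hw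
      cases hw
    | none =>
      obtain ⟨has, hN⟩ := hp
      have ha : C.action (loc' p) = .inr w := has ▸ hact
      refine ⟨[p], _, _, _, _, step_stampConfig_decided hs hact, step_registerConfig_decided ha,
        h.greatest, h.mem_eq, fun q => ?_⟩
      by_cases hq : q = p
      · subst hq
        rw [hs]
        refine ⟨has, ?_⟩
        simp
        omega
      · have hpq : ¬ p = q := fun e => hq e.symm
        simpa [hq, List.count_singleton, hpq] using h.local_rel q

/-- The lists are chosen recursively together with the relation, so that each extends the previous
one and they describe one simulated execution. -/
lemma exists_registerRel (C : AnonymousCode (registerMemory n m X x₀) V W) (v : Fin n → V)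
    (σ : ℕ → Fin n) :
    ∃ l : ℕ → List (Fin n), (∀ k, l k <+: l (k + 1)) ∧
      ∀ k, ∃ loc mem loc' mem',
        (weakSetOfRegister C).toProtocol.run v σ k = stampConfig C loc mem ∧
        C.toProtocol.exec (C.toProtocol.initial v) (l k) = registerConfig C loc' mem' ∧
        RegisterRel C loc mem loc' mem'
          (fun p => ((List.range k).map σ).count p) (fun p => (l k).count p) := by
  let R : ℕ → List (Fin n) → Prop := fun k l => ∃ loc mem loc' mem',
    (weakSetOfRegister C).toProtocol.run v σ k = stampConfig C loc mem ∧
    C.toProtocol.exec (C.toProtocol.initial v) l = registerConfig C loc' mem' ∧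
    RegisterRel C loc mem loc' mem'
      (fun p => ((List.range k).map σ).count p) (fun p => l.count p)
  have hstep : ∀ k (l : {l // R k l}), ∃ l' : {l' // R (k + 1) l'}, l.1 <+: l'.1 := by
    rintro k ⟨l, loc, mem, loc', mem', hc, ha, hl⟩
    obtain ⟨l', loc₁, mem₁, loc₁', mem₁', hc', ha', h'⟩ := hl.exists_step (σ k)
    refine ⟨⟨l ++ l', loc₁, mem₁, loc₁', mem₁', ?_, ?_, ?_⟩, List.prefix_append _ _⟩
    · rw [← hc', ← hc]
      rfl
    · rw [Protocol.exec_append, ha, ha']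
    · convert h' using 2 with p p
      · rw [List.range_succ, List.map_append, List.count_append]
        congr 1
        simp only [List.map_cons, List.map_nil, List.count_singleton, beq_iff_eq,
          eq_comm (a := p)]
      · rw [List.count_append]
  have h0 : R 0 [] := by
    refine ⟨fun p => (C.start (v p), none), fun _ => ∅, fun p => C.start (v p), fun _ => x₀,
      rfl, rfl, fun i => .inl rfl, fun i => latest_empty.symm, fun p => ⟨rfl, by simp⟩⟩
  choose f hf using hstep
  let g : ∀ k, {l // R k l} := fun k => Nat.rec ⟨[], h0⟩ (fun k l => f k l) k
  exact ⟨fun k => (g k).1, fun k => hf k (g k), fun k => (g k).2⟩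

theorem AnonymousRegisterSolvable.anonymousWeakSetSolvable {T : ColorlessTask V W} (htn : t < n)
    (h : AnonymousRegisterSolvable n t m T) : AnonymousWeakSetSolvable n t T := by
  obtain ⟨X, x₀, C, hC⟩ := h
  refine ⟨Fin m, Stamp X, weakSetOfRegister C, hC.of_simulation htn fun v σ => ?_⟩
  obtain ⟨l, hl, hR⟩ := exists_registerRel C v σ
  choose loc mem loc' mem' hc ha hR using hR
  refine ⟨l, hl, fun p hp N => ?_, fun k p w hw => ⟨k, ?_⟩, fun p hp k w hw => ?_⟩
  -- A simulated step costs at most two steps, and one further step may be outstanding.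
  · obtain ⟨k, hk⟩ := exists_count_of_not_mem_faulty hp (2 * N + 1)
    refine ⟨k, ?_⟩
    have h := (hR k).local_rel p
    generalize loc k p = sk at *
    rcases sk with ⟨s, _ | ts⟩
    · have := h.2
      omega
    · obtain ⟨i, x, -, ⟨-, -, h⟩ | ⟨-, -, h⟩⟩ := h <;> omega
  · have h := (hR k).local_rel p
    rw [hc] at hw
    rw [ha]
    change (weakSetOfRegister C).action (loc k p) = _ at hw
    change C.action (loc' k p) = _
    generalize loc k p = sk at *
    rcases sk with ⟨s, _ | ts⟩
    · rw [h.1]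
      rcases hact : C.action s with (i | ⟨i, x⟩) | w'
      · simp only [weakSetOfRegister, hact] at hw
        cases hw
      · simp only [weakSetOfRegister, hact] at hw
        cases hw
      · simp only [weakSetOfRegister, hact] at hw
        cases hw
        rfl
    · obtain ⟨i, x, hact, -⟩ := h
      simp only [weakSetOfRegister, hact] at hw
      cases hw
  -- A pending write may be linearized before its `add`, so the simulated process can have decided
  -- while its simulator is still in the middle of the write. The decision shows as soon as no stamp
  -- is held, at the latest after the next step.
  · have key : ∀ j, k ≤ j → (loc j p).2 = none →
        ∃ w', (weakSetOfRegister C).toProtocol.Decides v σ p w' := by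
      intro j hkj hnone
      have h := (hR j).local_rel p
      have hw := C.toProtocol.action_exec_prefix (prefix_of_le hl hkj) hw
      rw [ha] at hw
      refine ⟨w, j, ?_⟩
      rw [hc]
      change (weakSetOfRegister C).action (loc j p) = _
      change C.action (loc' j p) = _ at hw
      generalize loc j p = sj at *
      rcases sj with ⟨s, _ | ts⟩
      · rw [h.1] at hw
        simp only [weakSetOfRegister, hw]
      · cases hnone
    obtain ⟨j, hkj, hj⟩ := exists_step_ge hp k
    by_cases hnone : (loc j p).2 = none
    · exact key j hkj hnone
    · refine key (j + 1) (by omega) ?_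
      have h := (hR j).local_rel p
      have hrun : (weakSetOfRegister C).toProtocol.step p (stampConfig C (loc j) (mem j)) =
          stampConfig C (loc (j + 1)) (mem (j + 1)) := by
        rw [← hc, ← hc, ← hj]
        rfl
      rcases hs : loc j p with ⟨s, _ | ts⟩
      · rw [hs] at hnone
        exact absurd rfl hnone
      · rw [hs] at h
        obtain ⟨i, x, hact, -⟩ := h
        rw [step_stampConfig_add hs hact] at hrun
        have : loc (j + 1) = Function.update (loc j) p (C.next s .ack, none) :=
          (congrArg Protocol.Config.locals hrun).symm
        rw [this, Function.update_self]

end RegisterFromWeakSet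

end AnonTask

namespace AnonTask

/-! ### Codes driven by views of a growing set -/

/-- What a process does on obtaining a view of the set of all published items. -/
inductive SetAct (X W : Type) : Type
  | wait
  | advance (x : X)
  | decide (w : W)

/-- The code of an anonymous process that publishes its current item in a growing set and obtains
views of this set until it can replace its item by a new one, or decide. -/
structure SetCode (V W X : Type) where
  start : V → X
  act : X → Finset X → SetAct X W

/-- An execution of a `SetCode` in which only the processes outside `F` are known to be live. Views
are totally ordered, contain the item of the process that obtains them, and consist of items that
processes have had before. A process publishes its item at an unspecified time, and processes may
starve while new items keep appearing. -/
structure SetRun {n : ℕ} {V W X : Type} (C : SetCode V W X) (v : Fin n → V) (F : Set (Fin n)) where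
  item : ℕ → Fin n → X
  views : Set (Finset X)
  Decides : Fin n → W → Prop
  item_zero : ∀ p, item 0 p = C.start (v p)
  chain : ∀ S ∈ views, ∀ S' ∈ views, S ⊆ S' ∨ S' ⊆ S
  reached : ∀ S ∈ views, ∀ x ∈ S, ∃ k q, item k q = x
  item_succ : ∀ k p, item (k + 1) p = item k p ∨
    ∃ S ∈ views, item k p ∈ S ∧ (∀ x ∈ S, ∃ k' ≤ k, ∃ q, item k' q = x) ∧
      C.act (item k p) S = .advance (item (k + 1) p)
  decides : ∀ p w, Decides p w → ∃ k, ∃ S ∈ views, C.act (item k p) S = .decide w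
  live : ∀ K, (∀ k, K ≤ k → item k = item K) → (∃ p ∉ F, ∀ w, ¬ Decides p w) →
    ∃ S ∈ views, (∀ S' ∈ views, S' ⊆ S) ∧
      ∀ p ∉ F, (∀ w, ¬ Decides p w) → item K p ∈ S ∧ C.act (item K p) S = .wait

/-- All runs of `C` with at most `t` crashes solve `T`. -/
def SetCode.Solves {V W X : Type} (C : SetCode V W X) (n t : ℕ) (T : ColorlessTask V W) : Prop :=
  ∀ (s : {s : Finset V // s ∈ T.input.faces}) (v : Fin n → V), (∀ p, v p ∈ s.1) →
    ∀ F : Set (Fin n), F.ncard ≤ t → ∀ R : SetRun C v F,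
      (∀ p ∉ F, ∃ w, R.Decides p w) ∧
      ∃ τ ∈ (T.carrier s).faces, ∀ p w, R.Decides p w → w ∈ τ

/-! ### Set codes on a weak set -/

section OnWeakSet

variable {n t : ℕ} {V W X : Type}

inductive WeakSetLocal (X W : Type) : Type
  | adding (x : X)
  | getting (x : X)
  | done (x : X) (w : W)

def WeakSetLocal.item : WeakSetLocal X W → X
  | .adding x => x
  | .getting x => x
  | .done x _ => x

open Classical in
/-- The finset of elements of a set, empty if the set is infinite. -/
noncomputable def finsetOf (S : Set X) : Finset X :=
  if h : S.Finite then h.toFinset else ∅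

lemma mem_finsetOf {S : Set X} (h : S.Finite) {x : X} : x ∈ finsetOf S ↔ x ∈ S := by
  simp [finsetOf, h]

/-- The state of a process with item `x` after a view `S`. -/
def SetCode.afterGet (C : SetCode V W X) (x : X) (S : Finset X) : WeakSetLocal X W :=
  match C.act x S with
  | .wait => .getting x
  | .advance y => .adding y
  | .decide w => .done x w

/-- Execution of a set code on a single weak set. -/
noncomputable def SetCode.onWeakSet (C : SetCode V W X) (n : ℕ) :
    AnonymousCode (weakSetMemory n Unit X) V W where
  Local := WeakSetLocal X W
  start := fun v => .adding (C.start v)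
  action := fun s =>
    match s with
    | .adding x => .inl (.add () x)
    | .getting _ => .inl (.get ())
    | .done _ w => .inr w
  next := fun s r =>
    match s, r with
    | .adding x, _ => .getting x
    | .getting x, .values S => C.afterGet x (finsetOf S)
    | s, _ => s

/-- The steps of an execution of a set code on a weak set. -/
structure WeakSetTrace (C : SetCode V W X) (v : Fin n → V) (σ : ℕ → Fin n)
    (loc : ℕ → Fin n → WeakSetLocal X W) (mem : ℕ → Set X) : Prop where
  loc_zero : ∀ p, loc 0 p = .adding (C.start (v p))
  mem_zero : mem 0 = ∅
  other : ∀ k p, p ≠ σ k → loc (k + 1) p = loc k p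
  add : ∀ k x, loc k (σ k) = .adding x →
    loc (k + 1) (σ k) = .getting x ∧ mem (k + 1) = insert x (mem k)
  get : ∀ k x, loc k (σ k) = .getting x →
    loc (k + 1) (σ k) = C.afterGet x (finsetOf (mem k)) ∧ mem (k + 1) = mem k
  done : ∀ k x w, loc k (σ k) = .done x w → loc (k + 1) (σ k) = .done x w ∧ mem (k + 1) = mem k

/-- Replaces the operational semantics by the recursive description on which all later arguments
rest. -/
lemma exists_weakSetTrace (C : SetCode V W X) (v : Fin n → V) (σ : ℕ → Fin n) :
    ∃ loc mem, WeakSetTrace C v σ loc mem ∧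
      ∀ k p w, (C.onWeakSet n).toProtocol.action p
        (((C.onWeakSet n).toProtocol.run v σ k).locals p) = .inr w ↔ ∃ x, loc k p = .done x w := by
  let P := (C.onWeakSet n).toProtocol
  let loc : ℕ → Fin n → WeakSetLocal X W := fun k p => (P.run v σ k).locals p
  let mem : ℕ → Set X := fun k => (P.run v σ k).mem ()
  have hstep : ∀ k, P.run v σ (k + 1) = P.step (σ k) (P.run v σ k) := fun k => rfl
  refine ⟨loc, mem, ⟨fun p => rfl, rfl, fun k p hp => ?_, fun k x hx => ?_, fun k x hx => ?_,
    fun k x w hx => ?_⟩, fun k p w => ?_⟩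
  · exact P.step_locals_of_ne hp _
  · have ha : P.action (σ k) ((P.run v σ k).locals (σ k)) = .inl (.add () x) := by
      change (C.onWeakSet n).action (loc k (σ k)) = _
      rw [hx]
      rfl
    have h := (hstep k).trans (P.step_of_op ha)
    constructor
    · change (P.run v σ (k + 1)).locals (σ k) = _
      rw [h]
      refine (Function.update_self _ _ _).trans ?_
      change (C.onWeakSet n).next (loc k (σ k)) _ = _
      rw [hx]
      rfl
    · change (P.run v σ (k + 1)).mem () = _
      rw [h]
      simp only [weakSetMemory, Function.update_self]
      rfl
  · have ha : P.action (σ k) ((P.run v σ k).locals (σ k)) = .inl (.get ()) := by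
      change (C.onWeakSet n).action (loc k (σ k)) = _
      rw [hx]
      rfl
    have h := (hstep k).trans (P.step_of_op ha)
    constructor
    · change (P.run v σ (k + 1)).locals (σ k) = _
      rw [h]
      refine (Function.update_self _ _ _).trans ?_
      change (C.onWeakSet n).next (loc k (σ k)) _ = _
      rw [hx]
      rfl
    · change (P.run v σ (k + 1)).mem () = _
      rw [h]
      rfl
  · have ha : P.action (σ k) ((P.run v σ k).locals (σ k)) = .inr w := by
      change (C.onWeakSet n).action (loc k (σ k)) = _
      rw [hx]
      rfl
    have h := (hstep k).trans (P.step_of_decided ha)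
    constructor
    · change (P.run v σ (k + 1)).locals (σ k) = _
      rw [h]
      exact hx
    · change (P.run v σ (k + 1)).mem () = _
      rw [h]
  · change (C.onWeakSet n).action (loc k p) = _ ↔ _
    rcases loc k p with x | x | ⟨x, w'⟩
    · exact ⟨fun h => (by cases h), fun ⟨y, h⟩ => (by cases h)⟩
    · exact ⟨fun h => (by cases h), fun ⟨y, h⟩ => (by cases h)⟩
    · constructor
      · intro h
        cases h
        exact ⟨x, rfl⟩
      · rintro ⟨y, h⟩
        cases h
        rfl

namespace WeakSetTrace

variable {C : SetCode V W X} {v : Fin n → V} {σ : ℕ → Fin n}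
  {loc : ℕ → Fin n → WeakSetLocal X W} {mem : ℕ → Set X}

lemma mem_mono (h : WeakSetTrace C v σ loc mem) {j k : ℕ} (hjk : j ≤ k) : mem j ⊆ mem k := by
  induction hjk with
  | refl => exact subset_rfl
  | @step k _ ih =>
    refine ih.trans ?_
    rcases hl : loc k (σ k) with x | x | ⟨x, w⟩
    · rw [(h.add k x hl).2]
      exact Set.subset_insert _ _
    · exact (h.get k x hl).2.superset
    · exact (h.done k x w hl).2.superset

lemma reached (h : WeakSetTrace C v σ loc mem) (k : ℕ) :
    ∀ x ∈ mem k, ∃ k' ≤ k, ∃ q, (loc k' q).item = x := by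
  induction k with
  | zero => simp [h.mem_zero]
  | succ k ih =>
    have old : ∀ x ∈ mem k, ∃ k' ≤ k + 1, ∃ q, (loc k' q).item = x := fun x hx => by
      obtain ⟨k', hk', q, hq⟩ := ih x hx
      exact ⟨k', by omega, q, hq⟩
    rcases hl : loc k (σ k) with y | y | ⟨y, w⟩
    · rw [(h.add k y hl).2]
      rintro x (rfl | hx)
      · exact ⟨k, by omega, σ k, by rw [hl]; rfl⟩
      · exact old x hx
    · rwa [(h.get k y hl).2]
    · rwa [(h.done k y w hl).2]

lemma finite_mem (h : WeakSetTrace C v σ loc mem) (k : ℕ) : (mem k).Finite := by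
  induction k with
  | zero => simp [h.mem_zero]
  | succ k ih =>
    rcases hl : loc k (σ k) with y | y | ⟨y, w⟩
    · rw [(h.add k y hl).2]
      exact ih.insert y
    · rwa [(h.get k y hl).2]
    · rwa [(h.done k y w hl).2]

/-- A process reaches `getting` only through the `add` of its item or through a wait with the same
item, and the set never shrinks. -/
lemma mem_of_getting (h : WeakSetTrace C v σ loc mem) {k : ℕ} {p : Fin n} {x : X}
    (hx : loc k p = .getting x) : x ∈ mem k := by
  induction k generalizing x with
  | zero => rw [h.loc_zero] at hx; cases hx
  | succ k ih =>
    by_cases hp : p = σ k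
    · subst hp
      rcases hl : loc k (σ k) with y | y | ⟨y, w⟩
      · rw [(h.add k y hl).1] at hx
        cases hx
        rw [(h.add k _ hl).2]
        exact Set.mem_insert _ _
      · rw [(h.get k y hl).1] at hx
        rw [(h.get k y hl).2]
        unfold SetCode.afterGet at hx
        split at hx
        · cases hx
          exact ih hl
        · cases hx
        · cases hx
      · rw [(h.done k y w hl).1] at hx
        cases hx
    · rw [h.other k p hp] at hx
      exact h.mem_mono (Nat.le_succ k) (ih hx)

lemma decide_of_done (h : WeakSetTrace C v σ loc mem) {k : ℕ} {p : Fin n} {x : X} {w : W}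
    (hx : loc k p = .done x w) :
    ∃ j, C.act ((loc j p).item) (finsetOf (mem j)) = .decide w := by
  induction k with
  | zero => rw [h.loc_zero] at hx; cases hx
  | succ k ih =>
    by_cases hp : p = σ k
    · subst hp
      rcases hl : loc k (σ k) with y | y | ⟨y, w'⟩
      · rw [(h.add k y hl).1] at hx
        cases hx
      · rw [(h.get k y hl).1] at hx
        refine ⟨k, ?_⟩
        rw [hl]
        unfold SetCode.afterGet at hx
        split at hx
        · cases hx
        · cases hx
        · rename_i heq
          cases hx
          exact heq
      · rw [(h.done k y w' hl).1] at hx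
        exact ih (hl.trans hx)
    · rw [h.other k p hp] at hx
      exact ih hx

/-- Only finitely many items have ever occurred, so the increasing contents are eventually maximal.
-/
lemma eventually_const (h : WeakSetTrace C v σ loc mem) {K : ℕ}
    (hK : ∀ k, K ≤ k → ∀ p, (loc k p).item = (loc K p).item) :
    ∃ K', ∀ k, K' ≤ k → mem k = mem K' := by
  have hfin : {x | ∃ k q, (loc k q).item = x}.Finite := by
    refine (Set.finite_range fun a : Fin (K + 1) × Fin n => (loc a.1 a.2).item).subset ?_
    rintro x ⟨k, q, rfl⟩
    rcases le_total k K with hk | hk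
    · exact ⟨(⟨k, by omega⟩, q), rfl⟩
    · exact ⟨(⟨K, by omega⟩, q), (hK k hk q).symm⟩
  have hmono : Monotone mem := fun a b hab => h.mem_mono hab
  have hsub : ∀ k, mem k ⊆ {x | ∃ k q, (loc k q).item = x} := fun k x hx => by
    obtain ⟨k', -, q, hq⟩ := h.reached k x hx
    exact ⟨k', q, hq⟩
  have hrange : (Set.range mem).Finite := hfin.finite_subsets.subset (by
    rintro _ ⟨k, rfl⟩
    exact hsub k)
  obtain ⟨_, ⟨K', rfl⟩, hmax⟩ := hrange.exists_maximal (Set.range_nonempty mem)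
  exact ⟨K', fun k hk => (hmax ⟨k, rfl⟩ (hmono hk)).antisymm (hmono hk)⟩

/-- A weak set execution as an abstract run. -/
noncomputable def toSetRun (h : WeakSetTrace C v σ loc mem)
    (hne : ∀ x S, C.act x S ≠ .advance x) :
    SetRun C v (faulty σ) where
  item k p := (loc k p).item
  views := Set.range fun k => finsetOf (mem k)
  Decides p w := ∃ k x, loc k p = .done x w
  item_zero p := by rw [h.loc_zero]; rfl
  chain := by
    rintro _ ⟨j, rfl⟩ _ ⟨k, rfl⟩
    rcases le_total j k with hjk | hjk
    · left
      intro x hx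
      rw [mem_finsetOf (h.finite_mem _)] at hx ⊢
      exact h.mem_mono hjk hx
    · right
      intro x hx
      rw [mem_finsetOf (h.finite_mem _)] at hx ⊢
      exact h.mem_mono hjk hx
  reached := by
    rintro _ ⟨k, rfl⟩ x hx
    rw [mem_finsetOf (h.finite_mem _)] at hx
    obtain ⟨k', -, q, hq⟩ := h.reached k x hx
    exact ⟨k', q, hq⟩
  item_succ k p := by
    by_cases hp : p = σ k
    · subst hp
      rcases hl : loc k (σ k) with y | y | ⟨y, w'⟩
      · left
        rw [(h.add k y hl).1]
        rfl
      · rw [(h.get k y hl).1]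
        rcases hact : C.act y (finsetOf (mem k)) with _ | z | w
        · left
          simp [SetCode.afterGet, hact, WeakSetLocal.item]
        · right
          refine ⟨_, ⟨k, rfl⟩, ?_, fun x hx => ?_, ?_⟩
          · rw [mem_finsetOf (h.finite_mem _)]
            exact h.mem_of_getting hl
          · rw [mem_finsetOf (h.finite_mem _)] at hx
            exact h.reached k x hx
          · simp [SetCode.afterGet, hact, WeakSetLocal.item]
        · left
          simp [SetCode.afterGet, hact, WeakSetLocal.item]
      · left
        rw [(h.done k y w' hl).1]
    · left
      rw [h.other k p hp]
  decides := by
    rintro p w ⟨k, x, hx⟩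
    obtain ⟨j, hj⟩ := h.decide_of_done hx
    exact ⟨j, _, ⟨j, rfl⟩, hj⟩
  live := by
    intro K hK _
    have hK : ∀ k, K ≤ k → ∀ p, (loc k p).item = (loc K p).item := fun k hk p =>
      congrFun (hK k hk) p
    obtain ⟨K', hK'⟩ := h.eventually_const hK
    refine ⟨_, ⟨K', rfl⟩, ?_, fun p hp hd => ?_⟩
    · rintro _ ⟨k, rfl⟩ x hx
      rw [mem_finsetOf (h.finite_mem _)] at hx ⊢
      rw [← hK' _ (le_max_left K' k)]
      exact h.mem_mono (le_max_right _ _) hx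
    -- A live undecided process may first have to add its item; being scheduled again, it does a
    -- `get` with the final contents. There an `advance` would change the item by `hne`,
    -- contradicting stability, so it waits.
    · have hget : ∃ k, max K K' ≤ k ∧ σ k = p ∧ ∃ x, loc k p = .getting x := by
        obtain ⟨k, hk, hkp⟩ := exists_step_ge hp (max K K')
        rcases hl : loc k p with x | x | ⟨x, w⟩
        · obtain ⟨k', hk', hkp'⟩ := exists_step_ge hp (k + 1)
          subst hkp
          have hstay : ∀ j, k + 1 ≤ j → loc j (σ k) = .getting x := by
            intro j hj
            induction hj with
            | refl => exact (h.add k x hl).1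
            | @step j hj ih =>
              by_cases hpj : σ k = σ j
              · rw [hpj] at ih ⊢
                rw [(h.get j x ih).1]
                have hitem := hK (j + 1) (by simp at hj; omega) (σ j)
                rw [← hK j (by simp at hj; omega) (σ j), (h.get j x ih).1, ih] at hitem
                rcases hact : C.act x (finsetOf (mem j)) with _ | z | w
                · simp [SetCode.afterGet, hact]
                · simp only [SetCode.afterGet, hact, WeakSetLocal.item] at hitem
                  subst hitem
                  exact absurd hact (hne _ _)
                · refine absurd ⟨j + 1, x, ?_⟩ (hd w)
                  rw [hpj, (h.get j x ih).1]
                  simp [SetCode.afterGet, hact]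
              · rw [h.other j _ hpj, ih]
          exact ⟨k', by omega, hkp', x, hstay k' hk'⟩
        · exact ⟨k, hk, hkp, x, hl⟩
        · exact absurd ⟨k, x, hl⟩ (hd w)
      obtain ⟨k, hk, rfl, x, hx⟩ := hget
      have hitem : (loc K (σ k)).item = x := by
        rw [← hK k (le_trans (le_max_left _ _) hk), hx]
        rfl
      have hmem : mem k = mem K' := hK' k (le_trans (le_max_right _ _) hk)
      rw [hitem, mem_finsetOf (h.finite_mem _), ← hmem]
      refine ⟨h.mem_of_getting hx, ?_⟩
      have hsucc := hK (k + 1) (by have := le_trans (le_max_left _ _) hk; omega) (σ k)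
      rw [(h.get k x hx).1, hitem] at hsucc
      rcases hact : C.act x (finsetOf (mem k)) with _ | z | w
      · rw [hmem] at hact
        exact hact
      · simp only [SetCode.afterGet, hact, WeakSetLocal.item] at hsucc
        subst hsucc
        exact absurd hact (hne _ _)
      · refine absurd ⟨k + 1, x, ?_⟩ (hd w)
        rw [(h.get k x hx).1]
        simp [SetCode.afterGet, hact]

end WeakSetTrace

theorem SetCode.Solves.anonymousWeakSetSolvable {C : SetCode V W X} {T : ColorlessTask V W}
    (htn : t < n) (hne : ∀ x S, C.act x S ≠ .advance x) (hC : C.Solves n t T) :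
    AnonymousWeakSetSolvable n t T := by
  refine ⟨Unit, X, C.onWeakSet n, ?_⟩
  refine Protocol.solvesResilient_of_subset htn fun s v hv σ hσ => ?_
  obtain ⟨loc, mem, h, hd⟩ := exists_weakSetTrace C v σ
  obtain ⟨h1, τ, hτ, h2⟩ := hC s v hv _ hσ (h.toSetRun hne)
  refine ⟨fun p hp => ?_, τ, hτ, ?_⟩
  · obtain ⟨w, k, hk⟩ := h1 p hp
    exact ⟨w, k, (hd k p w).2 hk⟩
  · rintro p w ⟨k, hk⟩
    exact h2 p w ⟨k, (hd k p w).1 hk⟩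

end OnWeakSet

end AnonTask

namespace AnonTask

/-! ### Set codes on registers -/

section OnRegisters

variable {n t : ℕ} {V W X : Type}

/-- A process repeatedly reads all registers in order. It knows the set `known`, has last read
`buf` in the registers, has found the registers unchanged and equal to `known` in the last `streak`
passes, and, if `ok`, also so far in the present pass. -/
structure RegisterLocal (n : ℕ) (X W : Type) where
  item : X
  known : Finset X
  ctr : ℕ
  pos : Fin n
  buf : Fin n → Finset X × ℕ
  ok : Prop
  streak : ℕ
  pending : Option (Fin n)
  out : Option W

open Classical in
/-- End of a pass: obtain a view if the registers have been stable for long enough, or write to a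
register that does not hold `known`. -/
noncomputable def SetCode.endPass (C : SetCode V W X) (hn : 0 < n) (s : RegisterLocal n X W) :
    RegisterLocal n X W :=
  if s.ok then
    -- Each reappearance of a value after a non-uniform moment uses up a new pair of register and
    -- writer. There are `n * n` such pairs; see `RegisterTrace.exists_uniform`.
    if n * n + 2 ≤ s.streak + 1 then
      match C.act s.item s.known with
      | .wait => { s with pos := ⟨0, hn⟩, ok := True, streak := s.streak + 1 }
      | .advance y =>
        { s with pos := ⟨0, hn⟩, ok := True, streak := 0, item := y, known := insert y s.known }
      | .decide w => { s with pos := ⟨0, hn⟩, ok := True, out := some w }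
    else { s with pos := ⟨0, hn⟩, ok := True, streak := s.streak + 1 }
  else
    if h : ∃ i, (s.buf i).1 ≠ s.known then
      { s with pos := ⟨0, hn⟩, ok := True, streak := 0, pending := some h.choose }
    else { s with pos := ⟨0, hn⟩, ok := True, streak := 0 }

open Classical in
/-- The local state after reading `x`, before a possible end of the pass. -/
noncomputable def RegisterLocal.record (s : RegisterLocal n X W) (x : Finset X × ℕ) :
    RegisterLocal n X W :=
  { s with known := s.known ∪ x.1
           buf := Function.update s.buf s.pos x
           ok := s.ok ∧ x = s.buf s.pos ∧ x.1 = s.known }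

noncomputable def SetCode.afterRead (C : SetCode V W X) (hn : 0 < n) (s : RegisterLocal n X W)
    (x : Finset X × ℕ) : RegisterLocal n X W :=
  if h : s.pos.1 + 1 < n then { s.record x with pos := ⟨s.pos.1 + 1, h⟩ }
  else C.endPass hn (s.record x)

def RegisterLocal.afterWrite (hn : 0 < n) (s : RegisterLocal n X W) : RegisterLocal n X W :=
  { s with pending := none, ctr := s.ctr + 1, pos := ⟨0, hn⟩, ok := True, streak := 0 }

/-- Execution of a set code on `n` registers. Each written value carries the number of the write,
so that no process writes the same value twice. -/
noncomputable def SetCode.onRegisters (C : SetCode V W X) (hn : 0 < n) :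
    AnonymousCode (registerMemory n n (Finset X × ℕ) (∅, 0)) V W where
  Local := RegisterLocal n X W
  start := fun v =>
    { item := C.start v, known := {C.start v}, ctr := 0, pos := ⟨0, hn⟩, buf := fun _ => (∅, 0),
      ok := True, streak := 0, pending := none, out := none }
  action := fun s =>
    match s.out, s.pending with
    | some w, _ => .inr w
    | none, some i => .inl (.write i (s.known, s.ctr))
    | none, none => .inl (.read s.pos)
  next := fun s r =>
    match r with
    | .ack => s.afterWrite hn
    | .value x => C.afterRead hn s x

/-- The steps of an execution of a set code on registers. -/
structure RegisterTrace (C : SetCode V W X) (hn : 0 < n) (v : Fin n → V) (σ : ℕ → Fin n)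
    (loc : ℕ → Fin n → RegisterLocal n X W) (reg : ℕ → Fin n → Finset X × ℕ) : Prop where
  loc_zero : ∀ p, loc 0 p = (C.onRegisters hn).start (v p)
  reg_zero : ∀ i, reg 0 i = (∅, 0)
  other : ∀ k p, p ≠ σ k → loc (k + 1) p = loc k p
  read : ∀ k, (loc k (σ k)).out = none → (loc k (σ k)).pending = none →
    loc (k + 1) (σ k) = C.afterRead hn (loc k (σ k)) (reg k (loc k (σ k)).pos) ∧
      reg (k + 1) = reg k
  write : ∀ k i, (loc k (σ k)).out = none → (loc k (σ k)).pending = some i →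
    loc (k + 1) (σ k) = (loc k (σ k)).afterWrite hn ∧
      reg (k + 1) = Function.update (reg k) i ((loc k (σ k)).known, (loc k (σ k)).ctr)
  done : ∀ k w, (loc k (σ k)).out = some w →
    loc (k + 1) (σ k) = loc k (σ k) ∧ reg (k + 1) = reg k

lemma exists_registerTrace (C : SetCode V W X) (hn : 0 < n) (v : Fin n → V) (σ : ℕ → Fin n) :
    ∃ loc reg, RegisterTrace C hn v σ loc reg ∧
      ∀ k p w, (C.onRegisters hn).toProtocol.action p
        (((C.onRegisters hn).toProtocol.run v σ k).locals p) = .inr w ↔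
          (loc k p).out = some w := by
  let P := (C.onRegisters hn).toProtocol
  let loc : ℕ → Fin n → RegisterLocal n X W := fun k p => (P.run v σ k).locals p
  let reg : ℕ → Fin n → Finset X × ℕ := fun k => (P.run v σ k).mem
  have hstep : ∀ k, P.run v σ (k + 1) = P.step (σ k) (P.run v σ k) := fun k => rfl
  have hact : ∀ k p, P.action p ((P.run v σ k).locals p) =
      (C.onRegisters hn).action (loc k p) := fun k p => rfl
  refine ⟨loc, reg, ⟨fun p => rfl, fun i => rfl, fun k p hp => ?_, fun k h1 h2 => ?_,
    fun k i h1 h2 => ?_, fun k w h1 => ?_⟩, fun k p w => ?_⟩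
  · exact P.step_locals_of_ne hp _
  · have ha : P.action (σ k) ((P.run v σ k).locals (σ k)) = .inl (.read (loc k (σ k)).pos) := by
      simp only [hact, SetCode.onRegisters, h1, h2]
    have h := (hstep k).trans (P.step_of_op ha)
    constructor
    · change (P.run v σ (k + 1)).locals (σ k) = _
      rw [h]
      exact (Function.update_self _ _ _).trans rfl
    · change (P.run v σ (k + 1)).mem = _
      rw [h]
      rfl
  · have ha : P.action (σ k) ((P.run v σ k).locals (σ k)) =
        .inl (.write i ((loc k (σ k)).known, (loc k (σ k)).ctr)) := by
      simp only [hact, SetCode.onRegisters, h1, h2]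
    have h := (hstep k).trans (P.step_of_op ha)
    constructor
    · change (P.run v σ (k + 1)).locals (σ k) = _
      rw [h]
      exact (Function.update_self _ _ _).trans rfl
    · change (P.run v σ (k + 1)).mem = _
      rw [h]
      rfl
  · have ha : P.action (σ k) ((P.run v σ k).locals (σ k)) = .inr w := by
      simp only [hact, SetCode.onRegisters, h1]
    have h := (hstep k).trans (P.step_of_decided ha)
    constructor
    · change (P.run v σ (k + 1)).locals (σ k) = _
      rw [h]
    · change (P.run v σ (k + 1)).mem = _
      rw [h]
  · change P.action p ((P.run v σ k).locals p) = _ ↔ _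
    rw [hact]
    rcases h1 : (loc k p).out with _ | w'
    · rcases h2 : (loc k p).pending with _ | i
      · simp only [SetCode.onRegisters, h1, h2]
        exact ⟨fun h => (by cases h), fun h => (by cases h)⟩
      · simp only [SetCode.onRegisters, h1, h2]
        exact ⟨fun h => (by cases h), fun h => (by cases h)⟩
    · simp only [SetCode.onRegisters, h1]
      exact ⟨fun h => (by cases h; rfl), fun h => (by cases h; rfl)⟩

/-! Effect of a read on the local state. -/

section AfterRead

variable (C : SetCode V W X) (hn : 0 < n) (s : RegisterLocal n X W) (x : Finset X × ℕ)

lemma afterRead_known : s.known ⊆ (C.afterRead hn s x).known ∧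
    x.1 ⊆ (C.afterRead hn s x).known := by
  classical
  have key : s.known ∪ x.1 ⊆ (C.afterRead hn s x).known := by
    unfold SetCode.afterRead
    split_ifs with h
    · exact subset_rfl
    · unfold SetCode.endPass
      split_ifs
      · split
        · exact subset_rfl
        · exact Finset.subset_insert _ _
        · exact subset_rfl
      all_goals exact subset_rfl
  exact ⟨Finset.union_subset_left key, Finset.union_subset_right key⟩

lemma afterRead_ctr : (C.afterRead hn s x).ctr = s.ctr := by
  unfold SetCode.afterRead
  split_ifs with h
  · rfl
  · unfold SetCode.endPass
    split_ifs
    · split <;> rfl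
    all_goals rfl

lemma afterRead_buf : (C.afterRead hn s x).buf = Function.update s.buf s.pos x := by
  unfold SetCode.afterRead
  split_ifs with h
  · rfl
  · unfold SetCode.endPass
    split_ifs
    · split <;> rfl
    all_goals rfl

lemma afterRead_pos : (s.pos.1 + 1 < n ∧ (C.afterRead hn s x).pos.1 = s.pos.1 + 1 ∧
      (C.afterRead hn s x).pending = s.pending) ∨
    (s.pos.1 + 1 = n ∧ (C.afterRead hn s x).pos.1 = 0) := by
  unfold SetCode.afterRead
  split_ifs with h
  · exact .inl ⟨h, rfl, rfl⟩
  · refine .inr ⟨by omega, ?_⟩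
    unfold SetCode.endPass
    split_ifs
    · split <;> rfl
    all_goals rfl

/-- A process only overwrites contents that differed from its knowledge when it read them. This is
what makes writing die out in `RegisterTrace.exists_no_write`. -/
lemma afterRead_pending {i : Fin n} (h0 : s.pending = none)
    (h : (C.afterRead hn s x).pending = some i) :
    s.pos.1 + 1 = n ∧ ((C.afterRead hn s x).buf i).1 ≠ (C.afterRead hn s x).known := by
  unfold SetCode.afterRead at h ⊢
  split_ifs at h ⊢ with h1
  · simp only [RegisterLocal.record, h0] at h
    cases h
  · refine ⟨by omega, ?_⟩
    unfold SetCode.endPass at h ⊢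
    split_ifs at h ⊢ with h2 h3 h4
    · revert h
      split <;> (intro h; simp only [RegisterLocal.record, h0] at h; cases h)
    · simp only [RegisterLocal.record, h0] at h
      cases h
    · simp only [Option.some.injEq] at h
      subst h
      exact h4.choose_spec
    · simp only [RegisterLocal.record, h0] at h
      cases h

/-- A read that does not lead to a view with effect leaves the item and the decision unchanged. -/
lemma afterRead_item : ((C.afterRead hn s x).item = s.item ∧ (C.afterRead hn s x).out = s.out ∧
      ∀ y ∈ (C.afterRead hn s x).known, y ∈ s.known ∨ y ∈ x.1) ∨
    (s.pos.1 + 1 = n ∧ s.ok ∧ x = s.buf s.pos ∧ x.1 = s.known ∧ n * n + 2 ≤ s.streak + 1 ∧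
      ((C.act s.item s.known = .advance (C.afterRead hn s x).item ∧
        (C.afterRead hn s x).out = s.out ∧
        (C.afterRead hn s x).item ∈ (C.afterRead hn s x).known ∧
        ∀ y ∈ (C.afterRead hn s x).known, y ∈ s.known ∨ y = (C.afterRead hn s x).item) ∨
      (∃ w, C.act s.item s.known = .decide w ∧ (C.afterRead hn s x).out = some w ∧
        (C.afterRead hn s x).item = s.item ∧ (C.afterRead hn s x).known = s.known))) := by
  classical
  have hu : ∀ y ∈ (s.record x).known, y ∈ s.known ∨ y ∈ x.1 := fun y hy => by
    simpa [RegisterLocal.record] using hy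
  unfold SetCode.afterRead
  split_ifs with h
  · exact .inl ⟨rfl, rfl, hu⟩
  · unfold SetCode.endPass
    split_ifs with h2 h3 h4
    · obtain ⟨ho, hb, hk⟩ := h2
      have hkk : (s.record x).known = s.known := by simp [RegisterLocal.record, hk]
      have hi : (s.record x).item = s.item := rfl
      rw [hi, hkk]
      rcases hact : C.act s.item s.known with _ | y | w
      · exact .inl ⟨rfl, rfl, fun y hy => .inl (by simpa [hkk] using hy)⟩
      · refine .inr ⟨by omega, ho, hb, hk, h3, .inl ⟨rfl, rfl, Finset.mem_insert_self _ _, ?_⟩⟩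
        intro z hz
        exact (Finset.mem_insert.1 hz).symm
      · exact .inr ⟨by omega, ho, hb, hk, h3, .inr ⟨w, rfl, rfl, rfl, rfl⟩⟩
    · exact .inl ⟨rfl, rfl, hu⟩
    · exact .inl ⟨rfl, rfl, hu⟩
    · exact .inl ⟨rfl, rfl, hu⟩

/-- How the streak evolves. -/
lemma afterRead_ok (h : (C.afterRead hn s x).ok) :
    (s.pos.1 + 1 < n ∧ s.ok ∧ x = s.buf s.pos ∧ x.1 = s.known ∧
      (C.afterRead hn s x).streak = s.streak ∧ (C.afterRead hn s x).known = s.known) ∨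
    (s.pos.1 + 1 = n ∧ s.ok ∧ x = s.buf s.pos ∧ x.1 = s.known ∧
      (C.afterRead hn s x).streak = s.streak + 1 ∧ (C.afterRead hn s x).known = s.known) ∨
    (s.pos.1 + 1 = n ∧ (C.afterRead hn s x).streak = 0) ∨
    (C.afterRead hn s x).out ≠ none := by
  classical
  unfold SetCode.afterRead at h ⊢
  split_ifs at h ⊢ with h1
  · obtain ⟨ho, hb, hk⟩ := h
    exact .inl ⟨h1, ho, hb, hk, rfl, by simp [RegisterLocal.record, hk]⟩
  · right
    unfold SetCode.endPass
    split_ifs with h2 h3 h4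
    · obtain ⟨ho, hb, hk⟩ := h2
      have hkk : (s.record x).known = s.known := by simp [RegisterLocal.record, hk]
      split
      · exact .inl ⟨by omega, ho, hb, hk, rfl, hkk⟩
      · exact .inr (.inl ⟨by omega, rfl⟩)
      · exact .inr (.inr (by simp))
    · obtain ⟨ho, hb, hk⟩ := h2
      have hkk : (s.record x).known = s.known := by simp [RegisterLocal.record, hk]
      exact .inl ⟨by omega, ho, hb, hk, rfl, hkk⟩
    · exact .inr (.inl ⟨by omega, rfl⟩)
    · exact .inr (.inl ⟨by omega, rfl⟩)

end AfterRead

end OnRegisters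

end AnonTask

/-! ### Safety on registers: uniform contents form a chain, and views are uniform contents -/

namespace AnonTask

namespace RegisterTrace

variable {n t : ℕ} {V W X : Type} {C : SetCode V W X} {hn : 0 < n} {v : Fin n → V}
  {σ : ℕ → Fin n} {loc : ℕ → Fin n → RegisterLocal n X W} {reg : ℕ → Fin n → Finset X × ℕ}

/-- The step at time `u` writes to register `i`. -/
def IsWrite (σ : ℕ → Fin n) (loc : ℕ → Fin n → RegisterLocal n X W) (u : ℕ) (i : Fin n) : Prop :=
  (loc u (σ u)).out = none ∧ (loc u (σ u)).pending = some i

/-- The value written by the step at time `u`, if it is a write. -/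
def written (σ : ℕ → Fin n) (loc : ℕ → Fin n → RegisterLocal n X W) (u : ℕ) : Finset X × ℕ :=
  ((loc u (σ u)).known, (loc u (σ u)).ctr)

variable (h : RegisterTrace C hn v σ loc reg)
include h

/-- A step of `p` is idle, a write or a read. -/
lemma step_cases (k : ℕ) (p : Fin n) :
    loc (k + 1) p = loc k p ∨
    (σ k = p ∧ (∃ i, IsWrite σ loc k i) ∧ loc (k + 1) p = (loc k p).afterWrite hn) ∨
    (σ k = p ∧ (loc k p).out = none ∧ (loc k p).pending = none ∧
      loc (k + 1) p = C.afterRead hn (loc k p) (reg k (loc k p).pos)) := by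
  by_cases hp : p = σ k
  · subst hp
    rcases h1 : (loc k (σ k)).out with _ | w
    · rcases h2 : (loc k (σ k)).pending with _ | i
      · exact .inr (.inr ⟨rfl, rfl, rfl, (h.read k h1 h2).1⟩)
      · exact .inr (.inl ⟨rfl, ⟨i, h1, h2⟩, (h.write k i h1 h2).1⟩)
    · exact .inl (h.done k w h1).1
  · exact .inl (h.other k p hp)

lemma reg_succ (u : ℕ) (i : Fin n) :
    (IsWrite σ loc u i ∧ reg (u + 1) i = written σ loc u) ∨ reg (u + 1) i = reg u i := by
  rcases h1 : (loc u (σ u)).out with _ | w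
  · rcases h2 : (loc u (σ u)).pending with _ | j
    · exact .inr (congrFun (h.read u h1 h2).2 i)
    · rw [(h.write u j h1 h2).2]
      by_cases hij : i = j
      · subst hij
        exact .inl ⟨⟨h1, h2⟩, Function.update_self _ _ _⟩
      · exact .inr (Function.update_of_ne hij _ _)
  · exact .inr (congrFun (h.done u w h1).2 i)

lemma reg_of_isWrite {u : ℕ} {i : Fin n} (hw : IsWrite σ loc u i) :
    reg (u + 1) i = written σ loc u := by
  rw [(h.write u i hw.1 hw.2).2]
  exact Function.update_self _ _ _

/-- A property acquired by a register is acquired by a write. -/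
lemma exists_write {Q : Finset X × ℕ → Prop} {T t : ℕ} {i : Fin n} (hTt : T ≤ t)
    (hT : ¬ Q (reg T i)) (ht : Q (reg t i)) :
    ∃ u, T ≤ u ∧ u < t ∧ IsWrite σ loc u i ∧ Q (written σ loc u) := by
  induction hTt with
  | refl => exact absurd ht hT
  | @step t hTt ih =>
    by_cases hq : Q (reg t i)
    · obtain ⟨u, h1, h2, h3⟩ := ih hq
      exact ⟨u, h1, by omega, h3⟩
    · rcases h.reg_succ t i with ⟨hw, he⟩ | he
      · exact ⟨t, hTt, by omega, hw, by rwa [← he]⟩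
      · rw [he] at ht
        exact absurd ht hq

/-- After a write to it, a register holds a value written since. -/
lemma exists_last_write {u t : ℕ} {i : Fin n} (hu : IsWrite σ loc u i) (hut : u < t) :
    ∃ u', u ≤ u' ∧ u' < t ∧ IsWrite σ loc u' i ∧ reg t i = written σ loc u' := by
  induction hut with
  | refl => exact ⟨u, le_rfl, by omega, hu, h.reg_of_isWrite hu⟩
  | @step t _ ih =>
    rcases h.reg_succ t i with ⟨hw, he⟩ | he
    · exact ⟨t, by simp at *; omega, by omega, hw, he⟩
    · obtain ⟨u', h1, h2, h3, h4⟩ := ih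
      exact ⟨u', h1, by omega, h3, he.trans h4⟩

lemma known_mono {j k : ℕ} (hjk : j ≤ k) (p : Fin n) : (loc j p).known ⊆ (loc k p).known := by
  induction hjk with
  | refl => exact subset_rfl
  | @step k _ ih =>
    refine ih.trans ?_
    rcases h.step_cases k p with he | ⟨-, -, he⟩ | ⟨-, -, -, he⟩
    · rw [he]
    · rw [he]
      exact subset_rfl
    · rw [he]
      exact (afterRead_known C hn _ _).1

lemma ctr_mono {j k : ℕ} (hjk : j ≤ k) (p : Fin n) : (loc j p).ctr ≤ (loc k p).ctr := by
  induction hjk with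
  | refl => exact le_rfl
  | @step k _ ih =>
    refine ih.trans ?_
    rcases h.step_cases k p with he | ⟨-, -, he⟩ | ⟨-, -, -, he⟩
    · rw [he]
    · rw [he]
      exact Nat.le_succ _
    · rw [he, afterRead_ctr]

/-- No process writes the same value twice. -/
lemma written_ne {u u' : ℕ} {i i' : Fin n} (hu : IsWrite σ loc u i) (_ : IsWrite σ loc u' i')
    (hlt : u < u') (hσ : σ u = σ u') : written σ loc u ≠ written σ loc u' := by
  intro he
  have h1 : (loc u (σ u)).ctr = (loc u' (σ u')).ctr := congrArg Prod.snd he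
  have h2 := h.ctr_mono (Nat.succ_le_of_lt hlt) (σ u)
  rw [Nat.succ_eq_add_one, (h.write u i hu.1 hu.2).1] at h2
  rw [← hσ] at h1
  simp only [RegisterLocal.afterWrite] at h2
  omega

lemma item_mem_known (k : ℕ) (p : Fin n) : (loc k p).item ∈ (loc k p).known := by
  induction k with
  | zero => simp [h.loc_zero, SetCode.onRegisters]
  | succ k ih =>
    rcases h.step_cases k p with he | ⟨-, -, he⟩ | ⟨-, -, -, he⟩
    · rwa [he]
    · rw [he]
      exact ih
    · rw [he]
      rcases afterRead_item C hn (loc k p) (reg k (loc k p).pos) with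
        ⟨h1, -⟩ | ⟨-, -, -, -, -, ⟨-, -, h1, -⟩ | ⟨w, -, -, h1, h2⟩⟩
      · rw [h1]
        exact (afterRead_known C hn _ _).1 ih
      · exact h1
      · rwa [h1, h2]

lemma reached (k : ℕ) :
    (∀ p, ∀ x ∈ (loc k p).known, ∃ k' ≤ k, ∃ q, (loc k' q).item = x) ∧
    ∀ i, ∀ x ∈ (reg k i).1, ∃ k' ≤ k, ∃ q, (loc k' q).item = x := by
  induction k with
  | zero =>
    refine ⟨fun p x hx => ⟨0, le_rfl, p, ?_⟩, fun i x hx => ?_⟩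
    · rw [h.loc_zero] at hx ⊢
      exact (Finset.mem_singleton.1 hx).symm
    · rw [h.reg_zero] at hx
      simp at hx
  | succ k ih =>
    have lift : ∀ {x}, (∃ k' ≤ k, ∃ q, (loc k' q).item = x) →
        ∃ k' ≤ k + 1, ∃ q, (loc k' q).item = x := by
      rintro x ⟨k', hk', h'⟩
      exact ⟨k', by omega, h'⟩
    refine ⟨fun p x hx => ?_, fun i x hx => ?_⟩
    · rcases h.step_cases k p with he | ⟨-, -, he⟩ | ⟨-, -, -, he⟩
      · rw [he] at hx
        exact lift (ih.1 p x hx)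
      · rw [he] at hx
        exact lift (ih.1 p x hx)
      · rw [he] at hx
        rcases afterRead_item C hn (loc k p) (reg k (loc k p).pos) with
          ⟨-, -, h1⟩ | ⟨-, -, -, -, -, ⟨-, -, -, h1⟩ | ⟨w, -, -, -, h2⟩⟩
        · exact lift ((h1 x hx).elim (ih.1 p x) (ih.2 _ x))
        · rcases h1 x hx with h1 | h1
          · exact lift (ih.1 p x h1)
          · exact ⟨k + 1, le_rfl, p, by rw [he, h1]⟩
        · rw [h2] at hx
          exact lift (ih.1 p x hx)
    · rcases h.reg_succ k i with ⟨-, he⟩ | he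
      · rw [he] at hx
        exact lift (ih.1 _ x hx)
      · rw [he] at hx
        exact lift (ih.2 i x hx)

/-- Between two writes a process reads all registers. -/
lemma reads_between {u t : ℕ} {i j : Fin n} (hu : IsWrite σ loc u i) (ht : IsWrite σ loc t j)
    (hσ : σ u = σ t) (hut : u < t) :
    (∀ i, ∃ s, u < s ∧ s < t ∧ reg s i = (loc t (σ t)).buf i ∧
      (reg s i).1 ⊆ (loc t (σ t)).known) ∧
    ((loc t (σ t)).buf j).1 ≠ (loc t (σ t)).known := by
  -- Either the first pass since the last write is still in progress and has covered the registers
  -- before `pos`, or a complete pass has been made and every register has been read since.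
  have key : ∀ t, u < t →
      ((loc t (σ u)).pending = none ∧ ∀ i, i < (loc t (σ u)).pos → ∃ s, u < s ∧ s < t ∧
        reg s i = (loc t (σ u)).buf i ∧ (reg s i).1 ⊆ (loc t (σ u)).known) ∨
      ((∀ i, ∃ s, u < s ∧ s < t ∧ reg s i = (loc t (σ u)).buf i ∧
        (reg s i).1 ⊆ (loc t (σ u)).known) ∧
        ∀ j, (loc t (σ u)).pending = some j →
          ((loc t (σ u)).buf j).1 ≠ (loc t (σ u)).known) := by
    intro t hut
    induction hut with
    | refl =>
      left
      rw [(h.write u i hu.1 hu.2).1]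
      refine ⟨rfl, fun i hi => ?_⟩
      simp [RegisterLocal.afterWrite, Fin.lt_def] at hi
    | @step t hut ih =>
      have hut' : u < t := hut
      have weaken : ∀ {i : Fin n} {b : Finset X × ℕ} {K : Finset X},
          (∃ s, u < s ∧ s < t ∧ reg s i = b ∧ (reg s i).1 ⊆ K) →
          ∃ s, u < s ∧ s < t + 1 ∧ reg s i = b ∧ (reg s i).1 ⊆ K := by
        rintro i b K ⟨s, h1, h2, h3⟩
        exact ⟨s, h1, by omega, h3⟩
      rcases h.step_cases t (σ u) with he | ⟨-, -, he⟩ | ⟨-, -, hpend, he⟩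
      · rw [he]
        rcases ih with ⟨h1, h2⟩ | ⟨h1, h2⟩
        · exact .inl ⟨h1, fun i hi => weaken (h2 i hi)⟩
        · exact .inr ⟨fun i => weaken (h1 i), h2⟩
      · left
        rw [he]
        refine ⟨rfl, fun i hi => ?_⟩
        simp [RegisterLocal.afterWrite, Fin.lt_def] at hi
      · have hbuf := afterRead_buf C hn (loc t (σ u)) (reg t (loc t (σ u)).pos)
        have hknown := afterRead_known C hn (loc t (σ u)) (reg t (loc t (σ u)).pos)
        have hpd := fun j => afterRead_pending C hn (loc t (σ u)) (reg t (loc t (σ u)).pos)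
          (i := j) hpend
        have hpos := afterRead_pos C hn (loc t (σ u)) (reg t (loc t (σ u)).pos)
        rw [← he] at hbuf hknown hpd hpos
        have new : ∀ i, (i ≠ (loc t (σ u)).pos → ∃ s, u < s ∧ s < t ∧
            reg s i = (loc t (σ u)).buf i ∧ (reg s i).1 ⊆ (loc t (σ u)).known) →
            ∃ s, u < s ∧ s < t + 1 ∧ reg s i = (loc (t + 1) (σ u)).buf i ∧
              (reg s i).1 ⊆ (loc (t + 1) (σ u)).known := by
          intro i hi
          rw [hbuf]
          by_cases hip : i = (loc t (σ u)).pos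
          · subst hip
            exact ⟨t, hut', by omega, by simp, hknown.2⟩
          · rw [Function.update_of_ne hip]
            obtain ⟨s, h1, h2, h3, h4⟩ := hi hip
            exact ⟨s, h1, by omega, h3, h4.trans hknown.1⟩
        rcases ih with ⟨-, h2⟩ | ⟨h1, -⟩
        · rcases hpos with ⟨-, hpos, hp⟩ | ⟨hpos, -⟩
          · refine .inl ⟨hp.trans hpend, fun i hi => new i fun hne => h2 i ?_⟩
            rw [Fin.lt_def, hpos] at hi
            rw [Fin.lt_def]
            have : i.1 ≠ (loc t (σ u)).pos.1 := fun e => hne (Fin.ext e)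
            omega
          · refine .inr ⟨fun i => new i fun hne => h2 i ?_, fun j hj => (hpd j hj).2⟩
            rw [Fin.lt_def]
            have : i.1 ≠ (loc t (σ u)).pos.1 := fun e => hne (Fin.ext e)
            omega
        · exact .inr ⟨fun i => new i fun _ => h1 i, fun j hj => (hpd j hj).2⟩
  have := key t hut
  rw [hσ] at this
  rcases this with ⟨h1, -⟩ | ⟨h1, h2⟩
  · rw [ht.2] at h1
    cases h1
  · exact ⟨h1, h2 j ht.2⟩

/-- Sets held simultaneously by all registers grow. -/
lemma subset_of_uniform {A B : Finset X} {τ₁ τ₂ : ℕ} (hτ : τ₁ ≤ τ₂)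
    (h₁ : ∀ i, (reg τ₁ i).1 = A) (h₂ : ∀ i, (reg τ₂ i).1 = B) : A ⊆ B := by
  classical
  by_contra hAB
  have hAne : A ≠ ∅ := by
    rintro rfl
    exact hAB (Finset.empty_subset _)
  -- A process that knows `A` never destroys it.
  obtain ⟨p, hp⟩ : ∃ p, ∀ u, τ₁ ≤ u → A ⊆ (loc u p).known := by
    obtain ⟨u, -, hu, -, hw⟩ := h.exists_write (Q := fun x => x.1 = A) (Nat.zero_le τ₁)
      (i := ⟨0, hn⟩) (by rw [h.reg_zero]; exact hAne.symm) (h₁ _)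
    refine ⟨σ u, fun u' hu' => ?_⟩
    have hw : (loc u (σ u)).known = A := hw
    rw [← hw]
    exact h.known_mono (by omega) _
  let Bad : ℕ → Fin n → Prop := fun u i =>
    τ₁ ≤ u ∧ IsWrite σ loc u i ∧ ¬ A ⊆ (written σ loc u).1
  have hgood : ∀ u i, Bad u i → σ u ≠ p := by
    rintro u i ⟨hu, -, hb⟩ rfl
    exact hb (hp u hu)
  have hbad : ∀ t i, τ₁ ≤ t → ¬ A ⊆ (reg t i).1 → ∃ u < t, Bad u i := by
    intro t i ht hA
    obtain ⟨u, h1, h2, h3, h4⟩ := h.exists_write (Q := fun x => ¬ A ⊆ x.1) ht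
      (i := i) (by rw [h₁]; simp) hA
    exact ⟨u, h2, h1, h3, h4⟩
  -- If each process makes at most one bad write, not all registers turn bad.
  have hpigeon : ∀ t, (∀ u < t, ∀ u' < t, ∀ i i', Bad u i → Bad u' i' → σ u = σ u' → u = u') →
      ¬ ∀ i, ∃ u < t, Bad u i := by
    intro t hone hall
    choose f hf hfb using hall
    have hinj : Function.Injective fun i => σ (f i) := by
      intro i i' he
      have := hone (f i) (hf i) (f i') (hf i') i i' (hfb i) (hfb i') he
      have h1 := (hfb i).2.1.2
      rw [this, (hfb i').2.1.2] at h1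
      exact (Option.some.inj h1).symm
    obtain ⟨i, hi⟩ := (Finite.injective_iff_surjective.1 hinj) p
    exact hgood _ _ (hfb i) hi
  have hone : ∀ t, ∀ u < t, ∀ u' < t, ∀ i i', Bad u i → Bad u' i' → σ u = σ u' → u = u' := by
    intro t
    induction t with
    | zero => intro u hu; omega
    | succ t ih =>
      -- Were the second write bad too, every register read between the two writes would lack `A`;
      -- so each would have been written badly before `t`, contradicting `hpigeon` at time `t`.
      have key : ∀ u < t, ∀ i i', Bad u i → Bad t i' → σ u = σ t → False := by
        intro u hu i i' hb hb' hσ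
        refine hpigeon t ih fun j => ?_
        obtain ⟨s, hs1, hs2, -, hs4⟩ := (h.reads_between hb.2.1 hb'.2.1 hσ hu).1 j
        obtain ⟨u', hu', hbu'⟩ := hbad s j (by have := hb.1; omega)
          fun hA => hb'.2.2 (hA.trans hs4)
        exact ⟨u', by omega, hbu'⟩
      intro u hu u' hu' i i' hb hb' hσ
      rcases Nat.lt_succ_iff_lt_or_eq.1 hu with hu | rfl
      · rcases Nat.lt_succ_iff_lt_or_eq.1 hu' with hu' | rfl
        · exact ih u hu u' hu' i i' hb hb' hσ
        · exact (key u hu i i' hb hb' hσ).elim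
      · rcases Nat.lt_succ_iff_lt_or_eq.1 hu' with hu' | rfl
        · exact (key u' hu' i' i hb' hb hσ.symm).elim
        · rfl
  exact hpigeon τ₂ (hone τ₂) fun i => hbad τ₂ i hτ (by rwa [h₂])

omit h in
/-- Before time `T`, all registers have been read with values `b` in each of `s` successive
passes. -/
def StablePasses (reg : ℕ → Fin n → Finset X × ℕ) (b : Fin n → Finset X × ℕ) : ℕ → ℕ → Prop
  | 0, _ => True
  | s + 1, T => ∃ T', StablePasses reg b s T' ∧ ∀ i, ∃ t, T' ≤ t ∧ t < T ∧ reg t i = b i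

/-- In sufficiently many successive passes, there is a time at which all registers hold the values
read. -/
lemma exists_uniform {b : Fin n → Finset X × ℕ} {T : ℕ}
    (hs : StablePasses reg b (n * n + 2) T) : ∃ τ < T, reg τ = b := by
  classical
  by_contra! hno
  -- If `reg T' ≠ b` at the end of a pass, some register `i` is wrong there but is read as `b i` in
  -- the next pass, so `b i` is written to it in between. The pair of `i` and the writer is new,
  -- because nobody writes the same value twice.
  have key : ∀ s T, (∀ τ < T, reg τ ≠ b) → StablePasses reg b (s + 1) T →
      ∃ Q : Finset (Fin n × Fin n), s ≤ Q.card ∧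
        ∀ a ∈ Q, ∃ u < T, IsWrite σ loc u a.1 ∧ σ u = a.2 ∧ written σ loc u = b a.1 := by
    intro s
    induction s with
    | zero => exact fun T _ _ => ⟨∅, by simp, by simp⟩
    | succ s ih =>
      rintro T hT ⟨T', hs, hr⟩
      have hTT : T' < T := by
        obtain ⟨t, h1, h2, -⟩ := hr ⟨0, hn⟩
        omega
      obtain ⟨Q, hQ, hQ'⟩ := ih T' (fun τ hτ => hT τ (by omega)) hs
      obtain ⟨i, hi⟩ := Function.ne_iff.1 (hT T' hTT)
      obtain ⟨t, ht1, ht2, ht3⟩ := hr i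
      obtain ⟨u, hu1, hu2, hu3, hu4⟩ := h.exists_write (Q := fun x => x = b i) ht1 hi ht3
      refine ⟨insert (i, σ u) Q, ?_, ?_⟩
      · rw [Finset.card_insert_of_notMem]
        · omega
        · intro hmem
          obtain ⟨u', hu', hw', hσ', hb'⟩ := hQ' _ hmem
          exact h.written_ne hw' hu3 (by omega) hσ' (hb'.trans hu4.symm)
      · intro a ha
        rcases Finset.mem_insert.1 ha with rfl | ha
        · exact ⟨u, by omega, hu3, rfl, hu4⟩
        · obtain ⟨u', hu', h'⟩ := hQ' a ha
          exact ⟨u', by omega, h'⟩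
  obtain ⟨Q, hQ, -⟩ := key (n * n + 1) T hno hs
  have : Q.card ≤ n * n := by
    have := Finset.card_le_univ Q
    simpa using this
  omega

omit h in
lemma StablePasses.of_le {b : Fin n → Finset X × ℕ} {s s' T : ℕ} (hs : s ≤ s')
    (h : StablePasses reg b s' T) : StablePasses reg b s T := by
  induction s generalizing s' T with
  | zero => trivial
  | succ s ih =>
    obtain ⟨s', rfl⟩ : ∃ r, s' = r + 1 := ⟨s' - 1, by omega⟩
    obtain ⟨T', h1, h2⟩ := h
    exact ⟨T', ih (by omega) h1, h2⟩

omit h in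
/-- What a process has verified if `ok`. -/
def Verified (reg : ℕ → Fin n → Finset X × ℕ) (s : RegisterLocal n X W) (k : ℕ) : Prop :=
  ∃ T ≤ k, StablePasses reg s.buf s.streak T ∧
    (∀ i, i < s.pos → ∃ t, T ≤ t ∧ t < k ∧ reg t i = s.buf i) ∧
    ∀ i, (0 < s.streak ∨ i < s.pos) → (s.buf i).1 = s.known

omit h in
lemma Verified.of_fresh {s : RegisterLocal n X W} (h1 : s.streak = 0) (h2 : s.pos.1 = 0) (k : ℕ) :
    Verified reg s k := by
  refine ⟨0, Nat.zero_le _, by rw [h1]; trivial, fun i hi => ?_, fun i hi => ?_⟩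
  · rw [Fin.lt_def] at hi
    omega
  · rw [Fin.lt_def] at hi
    omega

omit h in
lemma Verified.end_pass {s : RegisterLocal n X W} {k : ℕ} (hs : Verified reg s k)
    (hp : s.pos.1 + 1 = n) (hb : reg k s.pos = s.buf s.pos) (hx : (reg k s.pos).1 = s.known) :
    StablePasses reg s.buf (s.streak + 1) (k + 1) ∧ ∀ i, (s.buf i).1 = s.known := by
  obtain ⟨T, hT, h1, h2, h3⟩ := hs
  have hlt : ∀ i, i ≠ s.pos → i < s.pos := fun i hi => by
    have : i.1 ≠ s.pos.1 := fun e => hi (Fin.ext e)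
    rw [Fin.lt_def]
    omega
  refine ⟨⟨T, h1, fun i => ?_⟩, fun i => ?_⟩
  · by_cases hi : i = s.pos
    · exact ⟨k, hT, by omega, by rw [hi, hb]⟩
    · obtain ⟨t, h4, h5, h6⟩ := h2 i (hlt i hi)
      exact ⟨t, h4, by omega, h6⟩
  · by_cases hi : i = s.pos
    · rw [hi, ← hb, hx]
    · exact h3 i (.inr (hlt i hi))

/-- Links the local counter `streak` to the global history: while `ok` holds, the buffer is
unchanged, so all counted passes have returned the same values. -/
lemma verified (k : ℕ) (p : Fin n) (hout : (loc k p).out = none) (hok : (loc k p).ok) :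
    Verified reg (loc k p) k := by
  induction k with
  | zero =>
    rw [h.loc_zero]
    exact .of_fresh rfl rfl 0
  | succ k ih =>
    rcases h.step_cases k p with he | ⟨-, -, he⟩ | ⟨-, ho, hpend, he⟩
    · rw [he] at hout hok ⊢
      obtain ⟨T, hT, h1, h2, h3⟩ := ih hout hok
      refine ⟨T, by omega, h1, fun i hi => ?_, h3⟩
      obtain ⟨t, h4, h5, h6⟩ := h2 i hi
      exact ⟨t, h4, by omega, h6⟩
    · rw [he]
      exact .of_fresh rfl rfl _
    · have hbuf := afterRead_buf C hn (loc k p) (reg k (loc k p).pos)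
      have hpos := afterRead_pos C hn (loc k p) (reg k (loc k p).pos)
      have hk := afterRead_ok C hn (loc k p) (reg k (loc k p).pos)
      rw [← he] at hbuf hpos hk
      rcases hk hok with ⟨hp, hok', hb, hx, hst, hkn⟩ | ⟨hp, hok', hb, hx, hst, hkn⟩ |
        ⟨hp, hst⟩ | hbad
      · obtain ⟨T, hT, h1, h2, h3⟩ := ih ho hok'
        have hbuf' : (loc (k + 1) p).buf = (loc k p).buf := by
          rw [hbuf, hb, Function.update_eq_self]
        have hpos' : (loc (k + 1) p).pos.1 = (loc k p).pos.1 + 1 := by omega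
        unfold Verified
        rw [hbuf', hst, hkn]
        have hlt : ∀ i, i ≠ (loc k p).pos → i < (loc (k + 1) p).pos → i < (loc k p).pos := by
          intro i hi hlt
          have : i.1 ≠ (loc k p).pos.1 := fun e => hi (Fin.ext e)
          rw [Fin.lt_def] at hlt ⊢
          omega
        refine ⟨T, by omega, h1, fun i hi => ?_, fun i hi => ?_⟩
        · by_cases hip : i = (loc k p).pos
          · exact ⟨k, hT, by omega, by rw [hip, hb]⟩
          · obtain ⟨t, h4, h5, h6⟩ := h2 i (hlt i hip hi)
            exact ⟨t, h4, by omega, h6⟩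
        · by_cases hip : i = (loc k p).pos
          · rw [hip, ← hb, hx]
          · exact h3 i (hi.imp_right (hlt i hip))
      · obtain ⟨h1, h2⟩ := (ih ho hok').end_pass hp hb hx
        have hbuf' : (loc (k + 1) p).buf = (loc k p).buf := by
          rw [hbuf, hb, Function.update_eq_self]
        have hpos' : (loc (k + 1) p).pos.1 = 0 := by omega
        unfold Verified
        rw [hbuf', hst, hkn]
        refine ⟨k + 1, le_rfl, h1, fun i hi => ?_, fun i _ => h2 i⟩
        rw [Fin.lt_def] at hi
        omega
      · exact .of_fresh hst (by omega) _
      · exact absurd hout hbad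

/-- When a process obtains a view, all registers have held this view simultaneously. -/
lemma exists_uniform_of_view {k : ℕ} {p : Fin n} (hout : (loc k p).out = none)
    (hok : (loc k p).ok) (hp : (loc k p).pos.1 + 1 = n)
    (hb : reg k (loc k p).pos = (loc k p).buf (loc k p).pos)
    (hx : (reg k (loc k p).pos).1 = (loc k p).known) (hs : n * n + 2 ≤ (loc k p).streak + 1) :
    ∃ τ, τ ≤ k ∧ ∀ i, (reg τ i).1 = (loc k p).known := by
  obtain ⟨h1, h2⟩ := (h.verified k p hout hok).end_pass hp hb hx
  obtain ⟨τ, hτ, he⟩ := h.exists_uniform (h1.of_le hs)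
  exact ⟨τ, by omega, fun i => by rw [he, h2]⟩

end RegisterTrace

end AnonTask

/-! ### Liveness on registers, and register executions as abstract runs -/

namespace AnonTask

section AfterRead

variable {n t : ℕ} {V W X : Type} (C : SetCode V W X) (hn : 0 < n) (s : RegisterLocal n X W)
  (x : Finset X × ℕ)

lemma afterRead_mid (hp : s.pos.1 + 1 < n) :
    (C.afterRead hn s x).streak = s.streak ∧
      ((C.afterRead hn s x).ok ↔ s.ok ∧ x = s.buf s.pos ∧ x.1 = s.known) := by
  unfold SetCode.afterRead
  rw [dif_pos hp]
  exact ⟨rfl, Iff.rfl⟩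

lemma afterRead_end (hp : s.pos.1 + 1 = n) :
    (C.afterRead hn s x).ok ∧
    ((s.ok ∧ x = s.buf s.pos ∧ x.1 = s.known) ∧
      ((n * n + 2 ≤ s.streak + 1 ∧ (C.act s.item s.known = .wait ∨
        C.act s.item s.known = .advance (C.afterRead hn s x).item ∨
        (C.afterRead hn s x).out ≠ none)) ∨
      (s.streak + 1 < n * n + 2 ∧ (C.afterRead hn s x).streak = s.streak + 1)) ∨
    ¬ (s.ok ∧ x = s.buf s.pos ∧ x.1 = s.known) ∧
      ((C.afterRead hn s x).pending ≠ none ∨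
        ∀ i, ((C.afterRead hn s x).buf i).1 = (C.afterRead hn s x).known)) := by
  unfold SetCode.afterRead
  rw [dif_neg (by omega)]
  unfold SetCode.endPass
  split_ifs with h2 h3 h4
  · have hkk : (s.record x).known = s.known := by simp [RegisterLocal.record, h2.2.2]
    have hi : (s.record x).item = s.item := rfl
    rw [hi, hkk]
    rcases hact : C.act s.item s.known with _ | y | w
    · exact ⟨trivial, .inl ⟨h2, .inl ⟨h3, .inl rfl⟩⟩⟩
    · exact ⟨trivial, .inl ⟨h2, .inl ⟨h3, .inr (.inl rfl)⟩⟩⟩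
    · exact ⟨trivial, .inl ⟨h2, .inl ⟨h3, .inr (.inr (by simp))⟩⟩⟩
  · exact ⟨trivial, .inl ⟨h2, .inr ⟨not_le.1 h3, rfl⟩⟩⟩
  · exact ⟨trivial, .inr ⟨h2, .inl (by simp)⟩⟩
  · push Not at h4
    exact ⟨trivial, .inr ⟨h2, .inr h4⟩⟩

end AfterRead

/-- A bounded increasing sequence of finite sets is eventually constant. -/
lemma eventually_const_of_subset {X : Type} {A : Set X} (hA : A.Finite) (f : ℕ → Finset X)
    (hf : Monotone f) (hsub : ∀ k, (f k : Set X) ⊆ A) : ∃ K, ∀ k, K ≤ k → f k = f K := by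
  have hrange : (Set.range f).Finite := by
    refine Set.Finite.subset (s := {S : Finset X | S ⊆ hA.toFinset}) ?_ ?_
    · exact (hA.toFinset.powerset.finite_toSet).subset fun S hS => by simpa using hS
    · rintro _ ⟨k, rfl⟩ x hx
      exact hA.mem_toFinset.2 (hsub k hx)
  obtain ⟨_, ⟨K, rfl⟩, hmax⟩ := hrange.exists_maximal (Set.range_nonempty f)
  exact ⟨K, fun k hk => (hmax ⟨k, rfl⟩ (hf hk)).antisymm (hf hk)⟩

namespace RegisterTrace

variable {n t : ℕ} {V W X : Type} {C : SetCode V W X} {hn : 0 < n} {v : Fin n → V}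
  {σ : ℕ → Fin n} {loc : ℕ → Fin n → RegisterLocal n X W} {reg : ℕ → Fin n → Finset X × ℕ}

variable (h : RegisterTrace C hn v σ loc reg)
include h

/-- Traces a decision back to the end of the pass at which it was taken; the knowledge used there
was then a uniform content. -/
lemma decide_of_out {k : ℕ} {p : Fin n} {w : W} (hw : (loc k p).out = some w) :
    ∃ j, C.act (loc j p).item (loc j p).known = .decide w ∧
      ∃ τ, ∀ i, (reg τ i).1 = (loc j p).known := by
  induction k with
  | zero => rw [h.loc_zero] at hw; cases hw
  | succ k ih =>
    rcases h.step_cases k p with he | ⟨-, -, he⟩ | ⟨-, ho, hpend, he⟩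
    · exact ih (he ▸ hw)
    · rw [he] at hw
      exact ih hw
    · rw [he] at hw
      rcases afterRead_item C hn (loc k p) (reg k (loc k p).pos) with
        ⟨-, h1, -⟩ | ⟨hp, hok, hb, hx, hs, ⟨-, h1, -, -⟩ | ⟨w', hact, h1, -⟩⟩
      · exact ih (h1 ▸ hw)
      · exact ih (h1 ▸ hw)
      · rw [h1] at hw
        cases hw
        obtain ⟨τ, -, hτ⟩ := h.exists_uniform_of_view ho hok hp hb hx hs
        exact ⟨k, hact, τ, hτ⟩

/-- Once the knowledge of all processes is constant, the registers are no longer written. -/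
lemma exists_no_write {K : ℕ} (hK : ∀ k, K ≤ k → ∀ p, (loc k p).known = (loc K p).known) :
    ∃ K', K ≤ K' ∧ ∀ u, K' ≤ u → ∀ i, ¬ IsWrite σ loc u i := by
  classical
  by_contra! hcon
  let IW : Set (Fin n) := {q | ∀ m, ∃ u, m ≤ u ∧ σ u = q ∧ ∃ i, IsWrite σ loc u i}
  have hIW : IW.Nonempty := by
    by_contra hempty
    have : ∀ q, ∃ m, ∀ u, m ≤ u → σ u = q → ∀ i, ¬ IsWrite σ loc u i := by
      intro q
      by_contra! hq
      exact hempty ⟨q, hq⟩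
    choose m hm using this
    obtain ⟨u, hu, i, hi⟩ := hcon (max K (Finset.univ.sup m)) (le_max_left _ _)
    refine hm (σ u) u ?_ rfl i hi
    exact (Finset.le_sup (Finset.mem_univ _)).trans ((le_max_right _ _).trans hu)
  -- Among the processes that write infinitely often, `r` has the least knowledge. Late enough it
  -- reads a register whose content is the knowledge of such a process and is strictly contained in
  -- its own, against minimality.
  obtain ⟨r, hr, hmin⟩ := Set.exists_min_image IW (fun q => (loc K q).known.card)
    (Set.toFinite _) hIW
  have hq : ∀ q, ∃ m, q ∉ IW → ∀ u, m ≤ u → σ u = q → ∀ i, ¬ IsWrite σ loc u i := by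
    intro q
    by_cases hq : q ∈ IW
    · exact ⟨0, fun hq' => absurd hq hq'⟩
    · have : ¬ ∀ m, ∃ u, m ≤ u ∧ σ u = q ∧ ∃ i, IsWrite σ loc u i := hq
      push Not at this
      obtain ⟨m, hm⟩ := this
      exact ⟨m, fun _ => hm⟩
  choose mq hmq using hq
  have hi : ∀ i, ∃ m, (∀ u, m ≤ u → ¬ IsWrite σ loc u i) ∨
      ∀ m', ∃ u, m' ≤ u ∧ IsWrite σ loc u i := by
    intro i
    by_cases hi : ∃ m, ∀ u, m ≤ u → ¬ IsWrite σ loc u i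
    · obtain ⟨m, hm⟩ := hi
      exact ⟨m, .inl hm⟩
    · push Not at hi
      exact ⟨0, .inr hi⟩
  choose mi hmi using hi
  -- After `M₁` only processes and registers involved in infinitely many writes take part in a
  -- write; by `M₂` each of these registers has been overwritten since `M₁`.
  let M₁ := max K (max (Finset.univ.sup mq) (Finset.univ.sup mi))
  have hK₁ : K ≤ M₁ := le_max_left _ _
  have hM₁ : ∀ q, mq q ≤ M₁ := fun q =>
    (Finset.le_sup (Finset.mem_univ q)).trans ((le_max_left _ _).trans (le_max_right _ _))
  have hM₁' : ∀ i, mi i ≤ M₁ := fun i =>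
    (Finset.le_sup (Finset.mem_univ i)).trans ((le_max_right _ _).trans (le_max_right _ _))
  have hu : ∀ i, ∃ u, (∀ m', ∃ u, m' ≤ u ∧ IsWrite σ loc u i) → M₁ ≤ u ∧ IsWrite σ loc u i := by
    intro i
    by_cases hi : ∀ m', ∃ u, m' ≤ u ∧ IsWrite σ loc u i
    · obtain ⟨u, hu⟩ := hi M₁
      exact ⟨u, fun _ => hu⟩
    · exact ⟨0, fun h' => absurd h' hi⟩
  choose ui hui using hu
  let M₂ := max M₁ (Finset.univ.sup ui + 1)
  have hM₂ : ∀ i, ui i < M₂ := fun i =>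
    (Nat.lt_succ_of_le (Finset.le_sup (Finset.mem_univ i))).trans_le (le_max_right _ _)
  have hM₁₂ : M₁ ≤ M₂ := le_max_left _ _
  obtain ⟨u₁, hu₁, hσ₁, i₁, hw₁⟩ := hr M₂
  obtain ⟨u₂, hu₂, hσ₂, j, hw₂⟩ := hr (u₁ + 1)
  obtain ⟨hread, hne⟩ := h.reads_between hw₁ hw₂ (hσ₁.trans hσ₂.symm) (by omega)
  obtain ⟨s, hs₁, hs₂, hs₃, hs₄⟩ := hread j
  rcases hmi j with hfin | hinf
  · exact hfin u₂ (by have := hM₁' j; omega) hw₂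
  · obtain ⟨hu₀, hw₀⟩ := hui j hinf
    obtain ⟨u, hu, hus, hwu, hreg⟩ := h.exists_last_write hw₀ (t := s) (by have := hM₂ j; omega)
    have hIWu : σ u ∈ IW := by
      by_contra hnot
      exact hmq (σ u) hnot u (by have := hM₁ (σ u); omega) rfl j hwu
    have hsub : (loc K (σ u)).known ⊂ (loc K r).known := by
      have e₁ : (reg s j).1 = (loc K (σ u)).known := by
        rw [hreg]
        exact hK u (by omega) _
      have e₂ : (loc u₂ (σ u₂)).known = (loc K r).known := by
        rw [hσ₂]
        exact hK u₂ (by omega) _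
      rw [← hs₃, e₁, e₂] at hne
      rw [e₁, e₂] at hs₄
      exact hs₄.ssubset_of_ne hne
    exact absurd (hmin _ hIWu) (not_le.2 (Finset.card_lt_card hsub))

/-- When nothing changes any more, a live process obtains a view. -/
lemma progress {K : ℕ} {p : Fin n} {x : X} {A : Finset X} {ρ : Fin n → Finset X × ℕ}
    (hne : ∀ x S, C.act x S ≠ .advance x) (hp : p ∉ faulty σ)
    (hout : ∀ k, (loc k p).out = none) (hitem : ∀ k, K ≤ k → (loc k p).item = x)
    (hknown : ∀ k, K ≤ k → (loc k p).known = A) (hreg : ∀ k, K ≤ k → reg k = ρ)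
    (hnw : ∀ u, K ≤ u → ∀ i, ¬ IsWrite σ loc u i) :
    C.act x A = .wait ∧ ∀ i, (ρ i).1 = A := by
  have hstay : ∀ k j, k ≤ j → (∀ u, k ≤ u → u < j → σ u ≠ p) → loc j p = loc k p := by
    intro k j hkj
    induction hkj with
    | refl => exact fun _ => rfl
    | @step j hkj ih =>
      intro hu
      rw [h.other j p (hu j hkj (by omega)).symm]
      exact ih fun u h1 h2 => hu u h1 (by omega)
  have hfirst : ∀ k, ∃ j, k ≤ j ∧ σ j = p ∧ loc j p = loc k p := by
    intro k
    have hex := exists_step_ge hp k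
    classical
    refine ⟨Nat.find hex, (Nat.find_spec hex).1, (Nat.find_spec hex).2, ?_⟩
    refine hstay k _ (Nat.find_spec hex).1 fun u h1 h2 h3 => ?_
    exact Nat.find_min hex h2 ⟨h1, h3⟩
  have hpend : ∀ k, K ≤ k → (loc k p).pending = none := by
    intro k hk
    by_contra hpd
    obtain ⟨i, hi⟩ := Option.ne_none_iff_exists'.1 hpd
    obtain ⟨j, hj, rfl, he⟩ := hfirst k
    refine hnw j (by omega) i ⟨hout j, ?_⟩
    rw [he, hi]
  have hnext : ∀ k, K ≤ k → ∃ k', k < k' ∧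
      loc k' p = C.afterRead hn (loc k p) (ρ (loc k p).pos) := by
    intro k hk
    obtain ⟨j, hj, rfl, he⟩ := hfirst k
    refine ⟨j + 1, by omega, ?_⟩
    rw [(h.read j (hout j) (hpend j (by omega))).1, he, hreg j (by omega)]
  have passStart : ∀ d k, K ≤ k → n - (loc k p).pos.1 = d →
      ∃ k', k ≤ k' ∧ (loc k' p).pos.1 = 0 ∧ (loc k' p).ok := by
    intro d
    induction d with
    | zero =>
      intro k _ hd
      have := (loc k p).pos.2
      omega
    | succ d ih =>
      intro k hk hd
      obtain ⟨k', hk', he⟩ := hnext k hk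
      have hpos := afterRead_pos C hn (loc k p) (ρ (loc k p).pos)
      rw [← he] at hpos
      rcases hpos with ⟨h1, h2, -⟩ | ⟨h1, h2⟩
      · obtain ⟨k'', hk'', h3⟩ := ih k' (by omega) (by omega)
        exact ⟨k'', by omega, h3⟩
      · refine ⟨k', by omega, h2, ?_⟩
        rw [he]
        exact (afterRead_end C hn _ _ h1).1
  -- The first `m` reads of a pass over the frozen contents `ρ`; the last read of the pass needs
  -- separate treatment.
  have pass : ∀ k, K ≤ k → (loc k p).pos.1 = 0 → (loc k p).ok → ∀ m < n, ∃ k', k ≤ k' ∧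
      (loc k' p).pos.1 = m ∧ (loc k' p).streak = (loc k p).streak ∧
      (∀ i : Fin n, i.1 < m → (loc k' p).buf i = ρ i) ∧
      (∀ i : Fin n, m ≤ i.1 → (loc k' p).buf i = (loc k p).buf i) ∧
      ((loc k' p).ok → ∀ i : Fin n, i.1 < m → (ρ i).1 = A) ∧
      ((loc k p).buf = ρ → (∀ i, (ρ i).1 = A) → (loc k' p).ok) := by
    intro k hk hpos hok m
    induction m with
    | zero =>
      intro _
      exact ⟨k, le_rfl, hpos, rfl, fun i hi => by omega, fun i _ => rfl, fun _ i hi => by omega,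
        fun _ _ => hok⟩
    | succ m ih =>
      intro hm
      obtain ⟨k₁, hk₁, h1, h2, h3, h4, h5, h6⟩ := ih (by omega)
      obtain ⟨k', hk', he⟩ := hnext k₁ (by omega)
      have hpos := afterRead_pos C hn (loc k₁ p) (ρ (loc k₁ p).pos)
      have hbuf := afterRead_buf C hn (loc k₁ p) (ρ (loc k₁ p).pos)
      obtain ⟨hst, hokk⟩ := afterRead_mid C hn (loc k₁ p) (ρ (loc k₁ p).pos) (by omega)
      rw [← he] at hpos hbuf hst hokk
      refine ⟨k', by omega, by omega, hst.trans h2, fun i hi => ?_, fun i hi => ?_,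
        fun ho i hi => ?_, fun hb hA => ?_⟩
      · rw [hbuf]
        by_cases hip : i = (loc k₁ p).pos
        · subst hip
          exact Function.update_self _ _ _
        · rw [Function.update_of_ne hip]
          refine h3 i ?_
          have : i.1 ≠ (loc k₁ p).pos.1 := fun e => hip (Fin.ext e)
          omega
      · rw [hbuf, Function.update_of_ne (fun e => by subst e; omega)]
        exact h4 i (by omega)
      · obtain ⟨ho, -, hx⟩ := hokk.1 ho
        by_cases hip : i = (loc k₁ p).pos
        · rw [hip, hx]
          exact hknown k₁ (by omega)
        · refine h5 ho i ?_
          have : i.1 ≠ (loc k₁ p).pos.1 := fun e => hip (Fin.ext e)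
          omega
      · refine hokk.2 ⟨h6 hb hA, ?_, ?_⟩
        · rw [h4 _ (by omega), hb]
        · rw [hA, hknown k₁ (by omega)]
  -- With no write possible, a pass must end with all registers equal to the knowledge of the
  -- process. It leaves `ρ` in the buffer, so from the next pass on the streak grows.
  have endPass : ∀ k, K ≤ k → (loc k p).pos.1 = 0 → (loc k p).ok → ∃ k', k ≤ k' ∧
      (∀ i, (ρ i).1 = A) ∧
      (C.act x A = .wait ∨ (loc k' p).pos.1 = 0 ∧ (loc k' p).ok ∧ (loc k' p).buf = ρ ∧
        ((loc k p).buf = ρ → (loc k p).streak + 1 < n * n + 2 ∧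
          (loc k' p).streak = (loc k p).streak + 1)) := by
    intro k hk hpos hok
    obtain ⟨k₁, hk₁, h1, h2, h3, h4, h5, h6⟩ := pass k hk hpos hok (n - 1) (by omega)
    obtain ⟨k', hk', he⟩ := hnext k₁ (by omega)
    have hpos' := afterRead_pos C hn (loc k₁ p) (ρ (loc k₁ p).pos)
    have hbuf := afterRead_buf C hn (loc k₁ p) (ρ (loc k₁ p).pos)
    obtain ⟨hok', hend⟩ := afterRead_end C hn (loc k₁ p) (ρ (loc k₁ p).pos) (by omega)
    rw [← he] at hpos' hbuf hok' hend
    have hlt : ∀ i : Fin n, i ≠ (loc k₁ p).pos → i.1 < n - 1 := fun i hi => by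
      have : i.1 ≠ (loc k₁ p).pos.1 := fun e => hi (Fin.ext e)
      omega
    have hbufρ : (loc k' p).buf = ρ := by
      rw [hbuf]
      funext i
      by_cases hip : i = (loc k₁ p).pos
      · subst hip
        exact Function.update_self _ _ _
      · rw [Function.update_of_ne hip]
        exact h3 i (hlt i hip)
    refine ⟨k', by omega, ?_, ?_⟩
    · rcases hend with ⟨⟨ho, -, hx⟩, -⟩ | ⟨-, hpd | hall⟩
      · intro i
        by_cases hip : i = (loc k₁ p).pos
        · rw [hip, hx]
          exact hknown k₁ (by omega)
        · exact h5 ho i (hlt i hip)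
      · exact absurd (hpend k' (by omega)) hpd
      · intro i
        rw [← hbufρ, hall, hknown k' (by omega)]
    · rcases hend with ⟨⟨ho, hb, hx⟩, ⟨-, hact | hact | hact⟩ | ⟨hlt, hst⟩⟩ | ⟨hnok, hpd | hall⟩
      · left
        rwa [hitem k₁ (by omega), hknown k₁ (by omega)] at hact
      · rw [hitem k₁ (by omega), hitem k' (by omega)] at hact
        exact absurd hact (hne _ _)
      · exact absurd (hout k') hact
      · right
        refine ⟨by omega, hok', hbufρ, fun _ => ?_⟩
        rw [hst, h2]
        rw [h2] at hlt
        exact ⟨hlt, rfl⟩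
      · exact absurd (hpend k' (by omega)) hpd
      · right
        refine ⟨by omega, hok', hbufρ, fun hb => absurd ?_ hnok⟩
        have hA : ∀ i, (ρ i).1 = A := fun i => by
          rw [← hbufρ, hall, hknown k' (by omega)]
        refine ⟨h6 hb hA, ?_, ?_⟩
        · rw [h4 _ (by omega), hb]
        · rw [hA, hknown k₁ (by omega)]
  have climb : ∀ d k, K ≤ k → (loc k p).pos.1 = 0 → (loc k p).ok → (loc k p).buf = ρ →
      n * n + 2 - (loc k p).streak = d → C.act x A = .wait := by
    intro d
    induction d with
    | zero =>
      intro k hk hpos hok hb hd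
      obtain ⟨k', -, -, hact | ⟨-, -, -, hs⟩⟩ := endPass k hk hpos hok
      · exact hact
      · have := (hs hb).1
        omega
    | succ d ih =>
      intro k hk hpos hok hb hd
      obtain ⟨k', hk', -, hact | ⟨h1, h2, h3, hs⟩⟩ := endPass k hk hpos hok
      · exact hact
      · have := hs hb
        exact ih k' (by omega) h1 h2 h3 (by omega)
  obtain ⟨k₀, hk₀, hpos₀, hok₀⟩ := passStart _ K le_rfl rfl
  obtain ⟨k₁, hk₁, hA, hact | ⟨h1, h2, h3, -⟩⟩ := endPass k₀ hk₀ hpos₀ hok₀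
  · exact ⟨hact, hA⟩
  · exact ⟨climb _ k₁ (by omega) h1 h2 h3 rfl, hA⟩

/-- A register execution as an abstract run. -/
def toSetRun (hne : ∀ x S, C.act x S ≠ .advance x) : SetRun C v (faulty σ) where
  item k p := (loc k p).item
  -- All uniform contents count as views, whether or not a process obtains them, so that the final
  -- content is available for `live`.
  views := {S | ∃ τ, ∀ i, (reg τ i).1 = S}
  Decides p w := ∃ k, (loc k p).out = some w
  item_zero p := by rw [h.loc_zero]; rfl
  chain := by
    rintro S ⟨τ, hS⟩ S' ⟨τ', hS'⟩
    rcases le_total τ τ' with hle | hle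
    · exact .inl (h.subset_of_uniform hle hS hS')
    · exact .inr (h.subset_of_uniform hle hS' hS)
  reached := by
    rintro S ⟨τ, hS⟩ x hx
    rw [← hS ⟨0, hn⟩] at hx
    obtain ⟨k', -, q, hq⟩ := (h.reached τ).2 _ x hx
    exact ⟨k', q, hq⟩
  item_succ k p := by
    rcases h.step_cases k p with he | ⟨-, -, he⟩ | ⟨-, ho, -, he⟩
    · left
      rw [he]
    · left
      rw [he]
      rfl
    · rw [he]
      rcases afterRead_item C hn (loc k p) (reg k (loc k p).pos) with
        ⟨h1, -⟩ | ⟨hp, hok, hb, hx, hs, ⟨hact, -⟩ | ⟨w', -, -, h1, -⟩⟩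
      · exact .inl h1
      · obtain ⟨τ, hτ⟩ := h.exists_uniform_of_view ho hok hp hb hx hs
        exact .inr ⟨(loc k p).known, ⟨τ, hτ.2⟩, h.item_mem_known k p, (h.reached k).1 p, hact⟩
      · exact .inl h1
  decides := by
    rintro p w ⟨k, hk⟩
    obtain ⟨j, hact, hτ⟩ := h.decide_of_out hk
    exact ⟨j, _, hτ, hact⟩
  live := by
    rintro K hK ⟨p₀, hp₀, hd₀⟩
    have hK : ∀ k, K ≤ k → ∀ p, (loc k p).item = (loc K p).item := fun k hk p =>
      congrFun (hK k hk) p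
    have hfin : {x | ∃ k q, (loc k q).item = x}.Finite := by
      refine (Set.finite_range fun a : Fin (K + 1) × Fin n => (loc a.1 a.2).item).subset ?_
      rintro x ⟨k, q, rfl⟩
      rcases le_total k K with hk | hk
      · exact ⟨(⟨k, by omega⟩, q), rfl⟩
      · exact ⟨(⟨K, by omega⟩, q), (hK k hk q).symm⟩
    have hconst : ∀ p, ∃ K', ∀ k, K' ≤ k → (loc k p).known = (loc K' p).known := fun p =>
      eventually_const_of_subset hfin (fun k => (loc k p).known)
        (fun a b hab => h.known_mono hab p) fun k x hx => by
          obtain ⟨k', -, q, hq⟩ := (h.reached k).1 p x hx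
          exact ⟨k', q, hq⟩
    choose K₁ hK₁ using hconst
    let K₂ := max K (Finset.univ.sup K₁)
    have hK₁₂ : ∀ p, K₁ p ≤ K₂ := fun p =>
      (Finset.le_sup (Finset.mem_univ p)).trans (le_max_right _ _)
    have hKK₂ : K ≤ K₂ := le_max_left _ _
    obtain ⟨K₃, hK₂₃, hnw⟩ := h.exists_no_write (K := K₂) fun k hk p => by
      rw [hK₁ p k ((hK₁₂ p).trans hk), hK₁ p K₂ (hK₁₂ p)]
    have hreg : ∀ k, K₃ ≤ k → reg k = reg K₃ := by
      intro k hk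
      induction hk with
      | refl => rfl
      | @step k hk ih =>
        rw [← ih]
        funext i
        rcases h.reg_succ k i with ⟨hw, -⟩ | he
        · exact absurd hw (hnw k hk i)
        · exact he
    have hprog : ∀ p ∉ faulty σ, (∀ w, ¬ ∃ k, (loc k p).out = some w) →
        C.act (loc K p).item (loc K₃ p).known = .wait ∧
          ∀ i, (reg K₃ i).1 = (loc K₃ p).known := by
      intro p hp hd
      refine h.progress hne hp (fun k => ?_) (fun k hk => ?_) (fun k hk => ?_) hreg hnw
      · rcases ho : (loc k p).out with _ | w
        · rfl
        · exact absurd ⟨k, ho⟩ (hd w)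
      · exact hK k (by omega) p
      · rw [hK₁ p k (by have := hK₁₂ p; omega), hK₁ p K₃ (by have := hK₁₂ p; omega)]
    obtain ⟨-, hA⟩ := hprog p₀ hp₀ hd₀
    refine ⟨_, ⟨K₃, hA⟩, ?_, fun p hp hd => ?_⟩
    · rintro S ⟨τ, hS⟩
      refine h.subset_of_uniform (le_max_left τ K₃) hS fun i => ?_
      rw [hreg _ (le_max_right _ _)]
      exact hA i
    · obtain ⟨h1, h2⟩ := hprog p hp hd
      have he : (loc K₃ p₀).known = (loc K₃ p).known := by
        rw [← hA ⟨0, hn⟩, h2]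
      rw [he]
      refine ⟨?_, h1⟩
      rw [← hK K₃ (by omega) p]
      exact h.item_mem_known K₃ p

end RegisterTrace

theorem SetCode.Solves.anonymousRegisterSolvable {n t : ℕ} {V W X : Type} {C : SetCode V W X}
    {T : ColorlessTask V W} (htn : t < n) (hne : ∀ x S, C.act x S ≠ .advance x)
    (hC : C.Solves n t T) : AnonymousRegisterSolvable n t n T := by
  have hn : 0 < n := by omega
  refine ⟨Finset X × ℕ, (∅, 0), C.onRegisters hn, ?_⟩
  refine Protocol.solvesResilient_of_subset htn fun s v hv σ hσ => ?_
  obtain ⟨loc, reg, h, hd⟩ := exists_registerTrace C hn v σ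
  obtain ⟨h1, τ, hτ, h2⟩ := hC s v hv _ hσ (h.toSetRun hne)
  refine ⟨fun p hp => ?_, τ, hτ, ?_⟩
  · obtain ⟨w, k, hk⟩ := h1 p hp
    exact ⟨w, k, (hd k p w).2 hk⟩
  · rintro p w ⟨k, hk⟩
    exact h2 p w ⟨k, (hd k p w).1 hk⟩

end AnonTask

namespace AnonTask

/-! ### Replaying a sequence of agreed local states as an execution on snapshot objects -/

namespace Protocol

variable {n : ℕ} {V W K Y : Type} {y₀ : Y} (P : Protocol (snapshotMemory n K Y y₀) V W)

def snapshotAction (p : Fin n) (s : P.Local) : SnapshotOp K Y ⊕ W := P.action p s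

def snapshotConfig (loc : Fin n → P.Local) (mem : K → Fin n → Y) : P.Config := ⟨loc, mem⟩

/-- The local state after an operation that is executed when the memory is `mem`. -/
def afterOp (p : Fin n) (s : P.Local) (op : SnapshotOp K Y) (mem : K → Fin n → Y) : P.Local :=
  match op with
  | .update _ _ => P.next p s SnapshotResp.ack
  | .scan k => P.next p s (SnapshotResp.view (mem k))

variable {P}

lemma step_scan {p : Fin n} {loc : Fin n → P.Local} {mem : K → Fin n → Y} {k : K}
    (h : P.snapshotAction p (loc p) = .inl (.scan k)) :
    P.step p (P.snapshotConfig loc mem) =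
      P.snapshotConfig (Function.update loc p (P.afterOp p (loc p) (.scan k) mem)) mem :=
  P.step_of_op (c := P.snapshotConfig loc mem) h

open Classical in
lemma step_update {p : Fin n} {loc : Fin n → P.Local} {mem : K → Fin n → Y} {k : K} {y : Y}
    (h : P.snapshotAction p (loc p) = .inl (.update k y)) :
    P.step p (P.snapshotConfig loc mem) =
      P.snapshotConfig (Function.update loc p (P.afterOp p (loc p) (.update k y) mem))
        (Function.update mem k (Function.update (mem k) p y)) := by
  exact P.step_of_op (c := P.snapshotConfig loc mem) h

/-- Scans leave the memory unchanged, so the scans of distinct processes are independent and their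
order does not matter. -/
lemma exec_scans (mem : K → Fin n → Y) (l : List (Fin n)) (hl : l.Nodup)
    (loc loc' : Fin n → P.Local)
    (h : ∀ p ∈ l, ∃ k, P.snapshotAction p (loc p) = .inl (.scan k) ∧
      loc' p = P.afterOp p (loc p) (.scan k) mem)
    (h' : ∀ p ∉ l, loc' p = loc p) :
    P.exec (P.snapshotConfig loc mem) l = P.snapshotConfig loc' mem := by
  induction l generalizing loc with
  | nil =>
    obtain rfl : loc' = loc := funext fun p => h' p (by simp)
    rfl
  | cons a l ih =>
    obtain ⟨ha, hl⟩ := List.nodup_cons.1 hl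
    obtain ⟨k, hk, hk'⟩ := h a (by simp)
    rw [exec_cons, step_scan hk]
    refine ih hl _ (fun p hp => ?_) fun p hp => ?_
    · have hpa : p ≠ a := fun e => ha (e ▸ hp)
      rw [Function.update_of_ne hpa]
      exact h p (by simp [hp])
    · by_cases hpa : p = a
      · subst hpa
        rw [Function.update_self, hk']
      · rw [Function.update_of_ne hpa]
        exact h' p (by simp [hpa, hp])

-- Distinct processes write to distinct components, so their updates commute and the final memory
-- can be described componentwise.
open Classical in
lemma exec_updates (l : List (Fin n)) (hl : l.Nodup) (loc loc' : Fin n → P.Local)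
    (mem mem' : K → Fin n → Y)
    (h : ∀ p ∈ l, ∃ k y, P.snapshotAction p (loc p) = .inl (.update k y) ∧
      loc' p = P.afterOp p (loc p) (.update k y) mem ∧
      ∀ j, mem' j p = if k = j then y else mem j p)
    (h' : ∀ p ∉ l, loc' p = loc p ∧ ∀ j, mem' j p = mem j p) :
    P.exec (P.snapshotConfig loc mem) l = P.snapshotConfig loc' mem' := by
  induction l generalizing loc mem with
  | nil =>
    obtain rfl : loc' = loc := funext fun p => (h' p (by simp)).1
    obtain rfl : mem' = mem := funext fun j => funext fun p => (h' p (by simp)).2 j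
    rfl
  | cons a l ih =>
    obtain ⟨ha, hl⟩ := List.nodup_cons.1 hl
    obtain ⟨k, y, hk, hk', hm⟩ := h a (by simp)
    have hne : ∀ p, p ≠ a → ∀ j, Function.update mem k (Function.update (mem k) a y) j p =
        mem j p := by
      intro p hp j
      by_cases hj : j = k
      · subst hj
        rw [Function.update_self, Function.update_of_ne hp]
      · rw [Function.update_of_ne hj]
    rw [exec_cons, step_update hk]
    refine ih hl _ _ (fun p hp => ?_) fun p hp => ?_
    · have hpa : p ≠ a := fun e => ha (e ▸ hp)
      rw [Function.update_of_ne hpa]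
      simp only [hne p hpa]
      exact h p (by simp [hp])
    · by_cases hpa : p = a
      · subst hpa
        refine ⟨by rw [Function.update_self, hk'], fun j => ?_⟩
        rw [hm]
        by_cases hj : j = k
        · subst hj
          simp
        · rw [Function.update_of_ne hj, if_neg (Ne.symm hj)]
      · rw [Function.update_of_ne hpa]
        simp only [hne p hpa]
        exact h' p (by simp [hpa, hp])

variable (P)

open Classical in
/-- The value of component `q` of object `k` after `q` has left the local states `g 0, …, g (i - 1)`
one after another. -/
noncomputable def written (q : Fin n) (g : ℕ → P.Local) (k : K) : ℕ → Y
  | 0 => y₀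
  | i + 1 =>
    match P.snapshotAction q (g i) with
    | .inl (.update k' y) => if k' = k then y else written q g k i
    | _ => written q g k i

lemma written_congr {q : Fin n} {g g' : ℕ → P.Local} {k : K} {m : ℕ} (h : ∀ i < m, g i = g' i) :
    P.written q g k m = P.written q g' k m := by
  induction m with
  | zero => rfl
  | succ m ih =>
    simp only [written]
    rw [h m (by lia), ih fun i hi => h i (by lia)]

/-- The memory when, for every `q`, exactly the first `c q` local states of `q` are known. -/
noncomputable def knownMemory (f : Fin n → ℕ → P.Local) (c : Fin n → ℕ) : K → Fin n → Y :=
  -- The operation of the last known state is not counted: it is not yet known that `q` has left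
  -- this state.
  fun k q => P.written q (f q) k (c q - 1)

open Classical in
/-- The processes that satisfy `q`. -/
noncomputable def processesWith (q : Fin n → Prop) : List (Fin n) :=
  (List.finRange n).filter fun p => q p

lemma mem_processesWith {q : Fin n → Prop} {p : Fin n} : p ∈ processesWith q ↔ q p := by
  simp [processesWith]

lemma nodup_processesWith (q : Fin n → Prop) : (processesWith q).Nodup :=
  (List.nodup_finRange n).filter _

open Classical in
lemma count_processesWith (q : Fin n → Prop) (p : Fin n) :
    (processesWith q).count p = if q p then 1 else 0 := by
  split_ifs with h
  · exact List.count_eq_one_of_mem (nodup_processesWith q) (mem_processesWith.2 h)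
  · exact List.count_eq_zero_of_not_mem fun h' => h (mem_processesWith.1 h')

/-- At time `k` exactly the first `cnt k p` local states `f p 0, f p 1, …` of `p` are known. The
operation that `p` executes in state `f p i` takes effect at the time `time p i`, when `f p i` is
the last known state of `p`. -/
structure Replay (v : Fin n → V) (f : Fin n → ℕ → P.Local) (cnt : ℕ → Fin n → ℕ)
    (time : Fin n → ℕ → ℕ) : Prop where
  start : ∀ p, f p 0 = P.start p (v p)
  zero : ∀ p, cnt 0 p = 0
  mono : ∀ k p, cnt k p ≤ cnt (k + 1) p
  succ_le : ∀ k p, cnt (k + 1) p ≤ cnt k p + 1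
  next : ∀ p i k, i + 2 ≤ cnt k p → ∃ op, P.snapshotAction p (f p i) = .inl op ∧
    cnt (time p i) p = i + 1 ∧
    f p (i + 1) = P.afterOp p (f p i) op (P.knownMemory f (cnt (time p i)))

namespace Replay

variable {P} {v : Fin n → V} {f : Fin n → ℕ → P.Local} {cnt : ℕ → Fin n → ℕ}
  {time : Fin n → ℕ → ℕ} (R : P.Replay v f cnt time)

lemma cnt_le (R : P.Replay v f cnt time) {j k : ℕ} (h : j ≤ k) (p : Fin n) :
    cnt j p ≤ cnt k p :=
  monotone_nat_of_le_succ (fun k => R.mono k p) h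

/-- The last known state of `p` at time `k` is one in which `p` performs a scan that takes effect
before time `m`. -/
def Scanned (_ : P.Replay v f cnt time) (k m : ℕ) (p : Fin n) : Prop :=
  ∃ i o, cnt k p = i + 1 ∧ (∃ k', i + 2 ≤ cnt k' p) ∧
    P.snapshotAction p (f p i) = .inl (.scan o) ∧ time p i < m

/-- At time `k + 1` it becomes known that `p` has left a state in which it performs an update. -/
def Updated (_ : P.Replay v f cnt time) (k : ℕ) (p : Fin n) : Prop :=
  ∃ i o y, cnt k p = i + 1 ∧ cnt (k + 1) p = i + 2 ∧
    P.snapshotAction p (f p i) = .inl (.update o y)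

open Classical in
/-- The number of steps that `p` has taken at time `k`. -/
noncomputable def steps (k : ℕ) (p : Fin n) : ℕ :=
  if R.Scanned k k p then cnt k p else cnt k p - 1

lemma steps_eq (k : ℕ) (p : Fin n) :
    R.steps k p = cnt k p - 1 ∨ ∃ i o, cnt k p = i + 1 ∧
      P.snapshotAction p (f p i) = .inl (.scan o) := by
  unfold steps
  split_ifs with h
  · obtain ⟨i, o, hi, -, ho, -⟩ := h
    exact .inr ⟨i, o, hi, ho⟩
  · exact .inl rfl

variable {R}

lemma Scanned.cnt_pos {k m : ℕ} {p : Fin n} (h : R.Scanned k m p) : 1 ≤ cnt k p := by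
  obtain ⟨i, o, hi, -⟩ := h
  lia

lemma Scanned.mono {k m m' : ℕ} {p : Fin n} (h : R.Scanned k m p) (hm : m ≤ m') :
    R.Scanned k m' p := by
  obtain ⟨i, o, hi, hf, ho, ht⟩ := h
  exact ⟨i, o, hi, hf, ho, by lia⟩

lemma Updated.not_scanned {k m : ℕ} {p : Fin n} (h : R.Updated k p) : ¬ R.Scanned k m p := by
  obtain ⟨i, o, y, hi, -, ho⟩ := h
  rintro ⟨i', o', hi', -, ho', -⟩
  obtain rfl : i = i' := by lia
  rw [ho] at ho'
  cases ho'

variable (R)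

-- If a new state becomes known between `k` and `k + 1`, the operation of the preceding one is
-- either an update, which takes effect now, or a scan, whose time is at most `k`. A scan in the new
-- state cannot have taken effect yet, since at its time that state is already the last known one.
open Classical in
lemma steps_succ (k : ℕ) (p : Fin n) :
    R.steps (k + 1) p = if R.Scanned k (k + 1) p ∨ R.Updated k p then cnt k p else cnt k p - 1 := by
  have h1 := R.mono k p
  have h2 := R.succ_le k p
  rcases Nat.lt_or_ge (cnt k p) (cnt (k + 1) p) with h | h
  · have hc : cnt (k + 1) p = cnt k p + 1 := by lia
    have hs : ¬ R.Scanned (k + 1) (k + 1) p := by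
      rintro ⟨i, o, hi, ⟨k', hk'⟩, -, ht⟩
      obtain ⟨-, -, hw, -⟩ := R.next p i k' hk'
      have := R.cnt_le (Nat.lt_succ_iff.1 ht) p
      lia
    rw [steps, if_neg hs, hc, Nat.add_sub_cancel]
    rcases hk : cnt k p with _ | i
    · simp
    · rw [if_pos]
      obtain ⟨op, ha, hw, -⟩ := R.next p i (k + 1) (by lia)
      cases op with
      | update o y => exact .inr ⟨i, o, y, hk, by lia, ha⟩
      | scan o =>
        refine .inl ⟨i, o, hk, ⟨k + 1, by lia⟩, ha, ?_⟩
        by_contra hn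
        have := R.cnt_le (Nat.le_of_not_lt hn) p
        lia
  · have hc : cnt (k + 1) p = cnt k p := by lia
    have hu : ¬ R.Updated k p := by
      rintro ⟨i, o, y, hi, hi', -⟩
      lia
    have hs : R.Scanned (k + 1) (k + 1) p ↔ R.Scanned k (k + 1) p := by
      simp only [Scanned, hc]
    simp only [steps, hs, hu, or_false, hc]

/-- The configuration at time `k`. -/
noncomputable def config (k : ℕ) : P.Config :=
  P.snapshotConfig (fun p => f p (R.steps k p)) (P.knownMemory f (cnt k))

/-- The steps between times `k` and `k + 1`. -/
noncomputable def segment (k : ℕ) : List (Fin n) :=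
  processesWith (fun p => R.Scanned k (k + 1) p ∧ ¬ R.Scanned k k p) ++ processesWith (R.Updated k)

lemma count_segment (k : ℕ) (p : Fin n) :
    R.steps k p + (R.segment k).count p = R.steps (k + 1) p := by
  classical
  rw [segment, List.count_append, count_processesWith, count_processesWith, steps_succ, steps]
  by_cases hu : R.Updated k p
  · have h2 : 1 ≤ cnt k p := by
      obtain ⟨i, o, y, hi, -⟩ := hu
      lia
    simp only [hu.not_scanned, hu, if_false, if_true, false_and, or_true]
    lia
  · by_cases hs : R.Scanned k k p
    · simp [hs, hu, hs.mono (Nat.le_succ k)]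
    · by_cases hs' : R.Scanned k (k + 1) p
      · have := hs'.cnt_pos
        simp only [hs, hs', hu, if_true, if_false, not_false_eq_true, and_self, or_false]
        lia
      · simp [hs, hs', hu]

/-- The scans with time `k` have to return the memory known at time `k`, so they come first. The
updates that become known then turn this memory into the one for `k + 1`. -/
lemma exec_segment (k : ℕ) : P.exec (R.config k) (R.segment k) = R.config (k + 1) := by
  classical
  rw [segment, exec_append, config, exec_scans _ _ (nodup_processesWith _) _
    (fun p => if R.Scanned k (k + 1) p then f p (cnt k p) else f p (cnt k p - 1)), config]
  · refine exec_updates _ (nodup_processesWith _) _ _ _ _ (fun p hp => ?_) fun p hp => ?_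
    · have hu : R.Updated k p := by simpa [mem_processesWith] using hp
      rw [if_neg hu.not_scanned, steps_succ, if_pos (.inr hu)]
      obtain ⟨i, o, y, hi, hi', ho⟩ := hu
      obtain ⟨op, ha, -, hf⟩ := R.next p i (k + 1) (by lia)
      rw [ho] at ha
      cases ha
      rw [hi, Nat.add_sub_cancel]
      refine ⟨o, y, ho, hf, fun j => ?_⟩
      simp [knownMemory, hi, hi', written, ho]
    · have hu : ¬ R.Updated k p := by simpa [mem_processesWith] using hp
      refine ⟨?_, fun j => ?_⟩
      · rw [steps_succ]
        simp only [hu, or_false]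
        split_ifs <;> rfl
      · simp only [knownMemory]
        have h1 := R.mono k p
        have h2 := R.succ_le k p
        rcases Nat.lt_or_ge (cnt k p) (cnt (k + 1) p) with h | h
        · rcases hk : cnt k p with _ | i
          · rw [show cnt (k + 1) p - 1 = 0 - 1 by lia]
          · rw [show cnt (k + 1) p - 1 = i + 1 by lia, Nat.add_sub_cancel, written]
            obtain ⟨op, ha, -, hf⟩ := R.next p i (k + 1) (by lia)
            cases op with
            | update o y => exact absurd ⟨i, o, y, hk, by lia, ha⟩ hu
            | scan o => rw [ha]
        · rw [show cnt (k + 1) p = cnt k p by lia]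
  · intro p hp
    have hs : R.Scanned k (k + 1) p ∧ ¬ R.Scanned k k p := by simpa [mem_processesWith] using hp
    rw [if_pos hs.1, steps, if_neg hs.2]
    obtain ⟨⟨i, o, hi, ⟨k', hk'⟩, ho, ht⟩, hn⟩ := hs
    have htk : time p i = k := by
      by_contra hne
      exact hn ⟨i, o, hi, ⟨k', hk'⟩, ho, by lia⟩
    obtain ⟨op, ha, -, hf⟩ := R.next p i k' hk'
    rw [ho] at ha
    cases ha
    rw [hi, Nat.add_sub_cancel]
    exact ⟨o, ho, by rw [hf, htk]⟩
  · intro p hp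
    have hs : R.Scanned k (k + 1) p → R.Scanned k k p := by simpa [mem_processesWith] using hp
    rw [steps]
    by_cases h : R.Scanned k k p
    · rw [if_pos h, if_pos (h.mono (Nat.le_succ k))]
    · rw [if_neg h, if_neg fun h' => h (hs h')]

/-- The schedule up to time `k`. -/
noncomputable def schedule : ℕ → List (Fin n)
  | 0 => []
  | k + 1 => schedule k ++ R.segment k

lemma schedule_prefix (k : ℕ) : R.schedule k <+: R.schedule (k + 1) :=
  List.prefix_append _ _

lemma steps_zero (p : Fin n) : R.steps 0 p = 0 := by
  have h0 : ¬ R.Scanned 0 0 p := by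
    rintro ⟨i, o, hi, -, -, ht⟩
    lia
  rw [steps, if_neg h0, R.zero]

lemma count_schedule (k : ℕ) (p : Fin n) : (R.schedule k).count p = R.steps k p := by
  induction k with
  | zero => simp [schedule, steps_zero]
  | succ k ih => rw [schedule, List.count_append, ih, count_segment]

lemma exec_schedule (k : ℕ) : P.exec (P.initial v) (R.schedule k) = R.config k := by
  induction k with
  | zero =>
    have h1 : (fun p => f p (R.steps 0 p)) = fun p => P.start p (v p) := by
      funext p
      rw [steps_zero, R.start]
    have h2 : P.knownMemory f (cnt 0) = fun _ _ => y₀ := by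
      funext k p
      simp [knownMemory, R.zero, written]
    rw [config, h1, h2]
    rfl
  | succ k ih => rw [schedule, exec_append, ih, exec_segment]

lemma action_exec_schedule (k : ℕ) (p : Fin n) :
    P.action p ((P.exec (P.initial v) (R.schedule k)).locals p) =
      P.snapshotAction p (f p (R.steps k p)) := by
  rw [exec_schedule]
  rfl

end Replay

end Protocol

end AnonTask

namespace AnonTask

/-! ### Anonymous simulation of a protocol for snapshot objects

The processes agree on the successive local states of every simulated process. Agreement on a state
proceeds in levels: a process enters a level with a proposal, then posts a value proposed at this
level together with the number of entries that it sees, and commits if all proposals that it sees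
agree with its own. The next level is entered only when all entries of the level have been posted,
with the value of a post that has the least number of entries. A crashed process thus blocks at most
one simulated process. -/

/-- An event in the history of a process: `enter p c l d` proposes `d` as local state number `c` of
the simulated process `p` at level `l`. -/
inductive Record (n : ℕ) (V L : Type) : Type
  | start (v : V)
  | enter (p : Fin n) (c l : ℕ) (d : L)
  | post (m : ℕ) (d : L)
  | commit
  | adopt

/-- A history, latest event first. -/
abbrev History (n : ℕ) (V L : Type) := List (Record n V L)

namespace History

open Record

section Agreement

variable {n : ℕ} {V L : Type} (S : Finset (History n V L))

/-- `d` is proposed as state `c` of `p` at level `l`. -/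
def Proposed (p : Fin n) (c l : ℕ) (d : L) : Prop := ∃ g, enter p c l d :: g ∈ S

open Classical in
noncomputable def entries (p : Fin n) (c l : ℕ) : Finset (History n V L) :=
  S.filter fun x => ∃ d g, x = enter p c l d :: g

noncomputable def pick [Nonempty L] (p : Fin n) (c l : ℕ) : L :=
  Classical.epsilon (Proposed S p c l)

/-- `d` is agreed to be state `c` of `p`. -/
def Decided (p : Fin n) (c : ℕ) (d : L) : Prop :=
  ∃ l m e g, commit :: post m e :: enter p c l d :: g ∈ S

/-- The number of states of `p` that are agreed. -/
noncomputable def count (p : Fin n) : ℕ := sInf {c | ∀ d, ¬ Decided S p c d}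

/-- The first level without entries for the next state of `p`. -/
noncomputable def level (p : Fin n) : ℕ := sInf {l | ∀ d, ¬ Proposed S p (count S p) l d}

/-- All entries of a level have been posted. -/
def Closed (p : Fin n) (c l : ℕ) : Prop :=
  ∀ e g, enter p c l e :: g ∈ S → ∃ m d, post m d :: enter p c l e :: g ∈ S

/-- `d` is posted with the least number of entries. -/
def Posted (p : Fin n) (c l : ℕ) (d : L) : Prop :=
  ∃ m e g, post m d :: enter p c l e :: g ∈ S ∧
    ∀ m' d' e' g', post m' d' :: enter p c l e' :: g' ∈ S → m ≤ m'

/-- The level before the one to be entered for `p`, if any, is closed. -/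
def Available (p : Fin n) : Prop := ∀ l, level S p = l + 1 → Closed S p (count S p) l

/-- At least `n - t` simulated processes are available. -/
def Ready (t : ℕ) : Prop := n ≤ {p | Available S p}.ncard + t

/-- `p` is available and has the least number of agreed states. -/
def Target (p : Fin n) : Prop := Available S p ∧ ∀ q, Available S q → count S p ≤ count S q

noncomputable def agreed [Nonempty L] (p : Fin n) (c : ℕ) : L := Classical.epsilon (Decided S p c)

/-- A process with this history is about to enter a level. -/
def Idle (g : History n V L) : Prop :=
  (∀ p c l e g', g ≠ enter p c l e :: g') ∧ ∀ m d p c l e g', g ≠ post m d :: enter p c l e :: g'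

variable {S} {p : Fin n} {c l : ℕ} {d : L}

lemma Proposed.mono {S' : Finset (History n V L)} (h : Proposed S p c l d) (hS : S ⊆ S') :
    Proposed S' p c l d := by
  obtain ⟨g, hg⟩ := h
  exact ⟨g, hS hg⟩

lemma Decided.mono {S' : Finset (History n V L)} (h : Decided S p c d) (hS : S ⊆ S') :
    Decided S' p c d := by
  obtain ⟨l, m, e, g, hg⟩ := h
  exact ⟨l, m, e, g, hS hg⟩

lemma pick_spec [Nonempty L] (h : Proposed S p c l d) : Proposed S p c l (pick S p c l) :=
  Classical.epsilon_spec (p := Proposed S p c l) ⟨d, h⟩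

lemma agreed_spec [Nonempty L] (h : Decided S p c d) : Decided S p c (agreed S p c) :=
  Classical.epsilon_spec (p := Decided S p c) ⟨d, h⟩

lemma mem_entries {x : History n V L} :
    x ∈ entries S p c l ↔ x ∈ S ∧ ∃ d g, x = enter p c l d :: g := by
  simp [entries]

lemma entries_mono {S' : Finset (History n V L)} (hS : S ⊆ S') :
    entries S p c l ⊆ entries S' p c l := fun x hx => by
  rw [mem_entries] at hx ⊢
  exact ⟨hS hx.1, hx.2⟩

lemma proposed_congr {S' : Finset (History n V L)} (h : entries S p c l = entries S' p c l) :
    Proposed S p c l = Proposed S' p c l := by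
  funext d
  have h1 : ∀ g, enter p c l d :: g ∈ entries S p c l ↔ enter p c l d :: g ∈ entries S' p c l :=
    fun g => by rw [h]
  have h2 : ∀ g, enter p c l d :: g ∈ S ↔ enter p c l d :: g ∈ S' := by
    intro g
    simpa [mem_entries] using h1 g
  simp only [Proposed, h2]

variable (S p)

/-- A finite set of histories cannot contain commits for infinitely many state numbers, so the
infimum is taken over a nonempty set. -/
lemma count_spec (d : L) : ¬ Decided S p (count S p) d := by
  have hne : {c | ∀ d, ¬ Decided S p c d}.Nonempty := by
    by_contra h
    have h1 : ∀ c, ∃ d, Decided S p c d := by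
      intro c
      by_contra hc
      exact h ⟨c, by simpa using hc⟩
    choose d l m e g hg using h1
    refine Set.infinite_of_injective_forall_mem (s := (S : Set (History n V L)))
      (fun a b hab => ?_) hg S.finite_toSet
    simp only [List.cons.injEq, enter.injEq] at hab
    exact hab.2.2.1.2.1
  exact Nat.sInf_mem hne d

lemma level_spec (d : L) : ¬ Proposed S p (count S p) (level S p) d := by
  have hne : {l | ∀ d, ¬ Proposed S p (count S p) l d}.Nonempty := by
    by_contra h
    have h1 : ∀ l, ∃ d, Proposed S p (count S p) l d := by
      intro c
      by_contra hc
      exact h ⟨c, by simpa using hc⟩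
    choose d g hg using h1
    refine Set.infinite_of_injective_forall_mem (s := (S : Set (History n V L)))
      (fun a b hab => ?_) hg S.finite_toSet
    simp only [List.cons.injEq, enter.injEq] at hab
    exact hab.1.2.2.1
  exact Nat.sInf_mem hne d

variable {S p}

lemma exists_decided (h : c < count S p) : ∃ d, Decided S p c d := by
  simpa using Nat.notMem_of_lt_sInf h

lemma exists_proposed (h : l < level S p) : ∃ d, Proposed S p (count S p) l d := by
  simpa using Nat.notMem_of_lt_sInf h

lemma exists_posted (hc : Closed S p c l) (h : Proposed S p c l d) : ∃ e, Posted S p c l e := by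
  obtain ⟨g, hg⟩ := h
  obtain ⟨m, e, he⟩ := hc d g hg
  let A : Set ℕ := {m | ∃ d e g, post m d :: enter p c l e :: g ∈ S}
  have hA : A.Nonempty := ⟨m, e, d, g, he⟩
  obtain ⟨d', e', g', h'⟩ := Nat.sInf_mem hA
  exact ⟨d', sInf A, e', g', h', fun m' d'' e'' g'' h'' => Nat.sInf_le ⟨d'', e'', g'', h''⟩⟩

lemma Ready.exists_target {t : ℕ} (h : Ready S t) (htn : t < n) : ∃ p, Target S p := by
  have h1 : {p | Available S p}.Nonempty := by
    rw [← Set.ncard_pos]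
    unfold Ready at h
    lia
  obtain ⟨p, hp, hm⟩ := Set.exists_min_image _ (count S) (Set.toFinite {p | Available S p}) h1
  exact ⟨p, hp, hm⟩

end Agreement

/-! #### The code -/

section Code

variable {n : ℕ} {V W K Y : Type} {y₀ : Y} (P : Protocol (snapshotMemory n K Y y₀) V W)
  (S : Finset (History n V P.Local))

/-- Some simulated process has decided `w`. -/
def Output (w : W) : Prop := ∃ p c d, Decided S p c d ∧ P.snapshotAction p d = .inr w

variable [Nonempty V] [Nonempty P.Local] (t : ℕ)

/-- The next state of `p`, computed from the agreed states. -/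
noncomputable def fresh (p : Fin n) : P.Local :=
  match count S p with
  -- Any published input will do, since the task is colorless and all inputs lie in one simplex.
  | 0 => P.start p (Classical.epsilon fun v => [start v] ∈ S)
  | c + 1 =>
    match P.snapshotAction p (agreed S p c) with
    | .inl op => P.afterOp p (agreed S p c) op (P.knownMemory (agreed S) (count S))
    | .inr _ => agreed S p c

/-- The value with which a process enters a level for `p`. -/
noncomputable def proposal (p : Fin n) : P.Local :=
  match level S p with
  | 0 => fresh P S p
  | l + 1 => Classical.epsilon (Posted S p (count S p) l)

/-- The possible next events of a process with a given history that obtains the view `S`. -/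
inductive Move : History n V P.Local → Record n V P.Local → Prop
  | enter {g p} (hg : Idle g) (hr : Ready S t) (hp : Target S p) :
      Move g (.enter p (count S p) (level S p) (proposal P S p))
  | post {p c l e g} :
      Move (.enter p c l e :: g) (.post (entries S p c l).card (pick S p c l))
  | commit {m d p c l e g} (h : ∀ e', Proposed S p c l e' → e' = e) :
      Move (.post m d :: .enter p c l e :: g) .commit
  | adopt {m d p c l e g} (h : ∃ e', Proposed S p c l e' ∧ e' ≠ e) :
      Move (.post m d :: .enter p c l e :: g) .adopt

open Classical in
/-- The code of the simulating processes. -/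
noncomputable def simulation : SetCode V W (History n V P.Local) where
  start := fun v => [.start v]
  act := fun g S =>
    if h : ∃ w, Output P S w then .decide h.choose
    else if h : ∃ r, Move P S t g r then .advance (h.choose :: g)
    else .wait

variable {P t S} {g : History n V P.Local}

lemma act_advance {x : History n V P.Local} (h : (simulation P t).act g S = .advance x) :
    (∀ w, ¬ Output P S w) ∧ ∃ r, x = r :: g ∧ Move P S t g r := by
  simp only [simulation] at h
  split_ifs at h with h1 h2
  cases h
  exact ⟨by simpa using h1, _, rfl, h2.choose_spec⟩

lemma act_decide {w : W} (h : (simulation P t).act g S = .decide w) : Output P S w := by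
  simp only [simulation] at h
  split_ifs at h with h1 h2
  cases h
  exact h1.choose_spec

lemma act_wait (htn : t < n) (h : (simulation P t).act g S = .wait) :
    (∀ w, ¬ Output P S w) ∧ Idle g ∧ ¬ Ready S t := by
  simp only [simulation] at h
  split_ifs at h with h1 h2
  have hi : Idle g := by
    constructor
    · rintro p c l e g' rfl
      exact h2 ⟨_, .post⟩
    · rintro m d p c l e g' rfl
      by_cases hu : ∀ e', Proposed S p c l e' → e' = e
      · exact h2 ⟨_, .commit hu⟩
      · push Not at hu
        exact h2 ⟨_, .adopt hu⟩
  refine ⟨by simpa using h1, hi, fun hr => ?_⟩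
  obtain ⟨p, hp⟩ := hr.exists_target htn
  exact h2 ⟨_, .enter hi hr hp⟩

end Code

end History

end AnonTask

/-! ### Causality between histories, and safety of the agreement -/

namespace AnonTask

namespace History

open Record

section Run

variable {n t : ℕ} {V W K Y : Type} {y₀ : Y} {P : Protocol (snapshotMemory n K Y y₀) V W}
  [Nonempty V] [Nonempty P.Local] {v : Fin n → V} {F : Set (Fin n)}
  {R : SetRun (simulation P t) v F}

variable (R) in
def Reached (x : History n V P.Local) : Prop := ∃ k q, R.item k q = x

lemma reached_of_mem {S : Finset (History n V P.Local)} (hS : S ∈ R.views)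
    {x : History n V P.Local} (hx : x ∈ S) : Reached R x := R.reached S hS x hx

variable (R) in
lemma item_suffix (q : Fin n) {k k' : ℕ} (h : k ≤ k') : R.item k q <:+ R.item k' q := by
  induction h with
  | refl => exact List.suffix_rfl
  | step h ih =>
    rename_i m
    refine ih.trans ?_
    rcases R.item_succ m q with h1 | ⟨S, -, -, -, h1⟩
    · rw [h1]
    · obtain ⟨-, r, hr, -⟩ := act_advance h1
      rw [show R.item m.succ q = r :: R.item m q from hr]
      exact List.suffix_cons _ _

variable (R) in
lemma item_comparable (q : Fin n) (k k' : ℕ) :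
    R.item k q <:+ R.item k' q ∨ R.item k' q <:+ R.item k q :=
  (le_total k k').imp (item_suffix R q) (item_suffix R q)

lemma not_reached_nil : ¬ Reached R [] := by
  rintro ⟨k, q, h⟩
  have := item_suffix R q (Nat.zero_le k)
  rw [h, R.item_zero] at this
  simp [simulation] at this

/-- Causality: at the first occurrence of `r :: g`, the view that produced it contains only earlier
items and so not `r :: g` itself. As views form a chain, it is contained in every view in which `r
:: g` appears. -/
lemma produced {r : Record n V P.Local} {g : History n V P.Local} (h : Reached R (r :: g)) :
    (g = [] ∧ ∃ q, r = start (v q)) ∨ ∃ S ∈ R.views, g ∈ S ∧ r :: g ∉ S ∧ (∀ w, ¬ Output P S w) ∧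
      Move P S t g r ∧ ∀ T ∈ R.views, r :: g ∈ T → S ⊆ T := by
  classical
  have hk := Nat.find_spec h
  have hmin : ∀ k' < Nat.find h, ¬ ∃ q, R.item k' q = r :: g := fun k' hk' => Nat.find_min h hk'
  rcases hfind : Nat.find h with _ | k
  · rw [hfind] at hk
    obtain ⟨q, hq⟩ := hk
    rw [R.item_zero] at hq
    simp only [simulation, List.cons.injEq] at hq
    exact .inl ⟨hq.2.symm, q, hq.1.symm⟩
  · rw [hfind] at hk hmin
    obtain ⟨q, hq⟩ := hk
    rcases R.item_succ k q with h1 | ⟨S, hS, hg, hr, h1⟩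
    · exact absurd ⟨q, h1 ▸ hq⟩ (hmin k (by lia))
    · obtain ⟨hout, r', hr', hm⟩ := act_advance h1
      rw [hq] at hr'
      obtain ⟨rfl, hg'⟩ := List.cons.inj hr'
      rw [← hg'] at hg hm
      have hx : r :: g ∉ S := by
        intro hx
        obtain ⟨k', hk', hq'⟩ := hr _ hx
        exact hmin k' (by lia) hq'
      refine .inr ⟨S, hS, hg, hx, hout, hm, fun T hT hxT => ?_⟩
      exact (R.chain S hS T hT).resolve_right fun hTS => hx (hTS hxT)

lemma mem_of_cons_mem {S : Finset (History n V P.Local)} (hS : S ∈ R.views)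
    {r : Record n V P.Local} {g : History n V P.Local} (hx : r :: g ∈ S) (hg : g ≠ []) : g ∈ S := by
  rcases produced (reached_of_mem hS hx) with ⟨h, -⟩ | ⟨S', -, hgS', -, -, -, hsub⟩
  · exact absurd h hg
  · exact hsub S hS hx hgS'

lemma mem_of_suffix {S : Finset (History n V P.Local)} (hS : S ∈ R.views)
    {g x : History n V P.Local} (hx : x ∈ S) (hgx : g <:+ x) (hg : g ≠ []) : g ∈ S := by
  obtain ⟨a, rfl⟩ := hgx
  induction a with
  | nil => exact hx
  | cons r a ih => exact ih (mem_of_cons_mem hS hx (by simp [hg]))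

lemma enter_produced {p : Fin n} {c l : ℕ} {d : P.Local} {g : History n V P.Local}
    (h : Reached R (enter p c l d :: g)) :
    ∃ S ∈ R.views, g ∈ S ∧ (∀ w, ¬ Output P S w) ∧ Ready S t ∧ Target S p ∧ c = count S p ∧
      l = level S p ∧ d = proposal P S p ∧ ∀ T ∈ R.views, enter p c l d :: g ∈ T → S ⊆ T := by
  rcases produced h with ⟨-, q, hq⟩ | ⟨S, hS, hg, -, hout, hm, hsub⟩
  · cases hq
  · cases hm with
    | enter hi hr hp => exact ⟨S, hS, hg, hout, hr, hp, rfl, rfl, rfl, hsub⟩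

lemma post_produced {m : ℕ} {d : P.Local} {g : History n V P.Local}
    (h : Reached R (post m d :: g)) :
    ∃ p c l e g', g = enter p c l e :: g' ∧ ∃ S ∈ R.views, g ∈ S ∧ m = (entries S p c l).card ∧
      d = pick S p c l ∧ ∀ T ∈ R.views, post m d :: g ∈ T → S ⊆ T := by
  rcases produced h with ⟨-, q, hq⟩ | ⟨S, hS, hg, -, hout, hm, hsub⟩
  · cases hq
  · cases hm with
    | post => exact ⟨_, _, _, _, _, rfl, S, hS, hg, rfl, rfl, hsub⟩

lemma post_produced_of_enter {m : ℕ} {d e : P.Local} {p : Fin n} {c l : ℕ}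
    {g : History n V P.Local} (h : Reached R (post m d :: enter p c l e :: g)) :
    ∃ S ∈ R.views, enter p c l e :: g ∈ S ∧ m = (entries S p c l).card ∧
      d = pick S p c l ∧ ∀ T ∈ R.views, post m d :: enter p c l e :: g ∈ T → S ⊆ T := by
  obtain ⟨p', c', l', e', g', hg, hS⟩ := post_produced h
  cases hg
  exact hS

lemma commit_produced {m : ℕ} {d e : P.Local} {p : Fin n} {c l : ℕ} {g : History n V P.Local}
    (h : Reached R (commit :: post m d :: enter p c l e :: g)) :
    ∃ S ∈ R.views, post m d :: enter p c l e :: g ∈ S ∧ ∀ e', Proposed S p c l e' → e' = e := by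
  rcases produced h with ⟨-, q, hq⟩ | ⟨S, hS, hg, -, hout, hm, hsub⟩
  · cases hq
  · cases hm with
    | commit hu => exact ⟨S, hS, hg, hu⟩

/-- After an entry the only move is a post; hence an entry without a post in a view is the last
event, as seen in that view, of every process that made it. -/
lemma exists_post_of_cons {r : Record n V P.Local} {p : Fin n} {c l : ℕ} {e : P.Local}
    {g : History n V P.Local} (h : Reached R (r :: enter p c l e :: g)) : ∃ m d, r = post m d := by
  rcases produced h with ⟨h, -⟩ | ⟨S, hS, hg, -, hout, hm, hsub⟩
  · cases h
  · cases hm with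
    | enter hi hr hp => exact absurd rfl (hi.1 p c l e g)
    | post => exact ⟨_, _, rfl⟩

/-! #### Agreement -/

/-- The value of a post was proposed at the same level. -/
lemma proposed_of_post {S : Finset (History n V P.Local)} (hS : S ∈ R.views) {m : ℕ}
    {d e : P.Local} {p : Fin n} {c l : ℕ} {g : History n V P.Local}
    (h : post m d :: enter p c l e :: g ∈ S) : Proposed S p c l d := by
  obtain ⟨U, -, hg, -, rfl, hsub⟩ := post_produced_of_enter (reached_of_mem hS h)
  exact (pick_spec ⟨g, hg⟩).mono (hsub S hS h)

lemma posted_of_enter_succ {p : Fin n} {c l : ℕ} {d : P.Local} {g : History n V P.Local}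
    (h : Reached R (enter p c (l + 1) d :: g)) :
    ∃ S ∈ R.views, Posted S p c l d ∧ Closed S p c l ∧
      ∀ T ∈ R.views, enter p c (l + 1) d :: g ∈ T → S ⊆ T := by
  obtain ⟨S, hS, -, -, -, ⟨hav, -⟩, rfl, hl, rfl, hsub⟩ := enter_produced h
  have hc := hav l hl.symm
  obtain ⟨d, hd⟩ := exists_proposed (S := S) (p := p) (l := l) (by lia)
  refine ⟨S, hS, ?_, hc, hsub⟩
  have : proposal P S p = Classical.epsilon (Posted S p (count S p) l) := by
    rw [proposal, ← hl]
  rw [this]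
  exact Classical.epsilon_spec (p := Posted S p (count S p) l) (exists_posted hc hd)

/-- Two posts with comparable numbers of entries. -/
lemma entries_subset_of_card_le {S U : Finset (History n V P.Local)} (hS : S ∈ R.views)
    (hU : U ∈ R.views) {p : Fin n} {c l : ℕ} (h : (entries S p c l).card ≤ (entries U p c l).card) :
    entries S p c l ⊆ entries U p c l := by
  rcases R.chain S hS U hU with h' | h'
  · exact entries_mono h'
  · exact (Finset.eq_of_subset_of_card_le (entries_mono h') h).ge

/-- Compare the view `S` of the commit with the view `T` of the entry. If `T ⊆ S`, the value taken
from `T` was proposed in `S`, where only `d` is proposed. Otherwise the committer's post lies in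
`T`, so the minimal post has at most as many entries; these form a subset of what the committer saw
when posting, and its value was picked among them. -/
lemma enter_succ_of_commit {m : ℕ} {e₀ d : P.Local} {p : Fin n} {c l : ℕ}
    {g : History n V P.Local} (h : Reached R (commit :: post m e₀ :: enter p c l d :: g))
    {e : P.Local} {g' : History n V P.Local} (h' : Reached R (enter p c (l + 1) e :: g')) :
    e = d := by
  obtain ⟨S, hS, hpost, hu⟩ := commit_produced h
  obtain ⟨T, hT, ⟨m', e', g'', hmem, hmin⟩, -, -⟩ := posted_of_enter_succ h'
  refine hu e ?_
  rcases R.chain T hT S hS with hTS | hST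
  · exact (proposed_of_post hT hmem).mono hTS
  · obtain ⟨U, hU, hgU, rfl, -, hUsub⟩ := post_produced_of_enter (reached_of_mem hS hpost)
    obtain ⟨U', hU', hgU', rfl, rfl, -⟩ := post_produced_of_enter (reached_of_mem hT hmem)
    have hle := hmin _ _ _ _ (hST hpost)
    obtain ⟨a, ha⟩ := pick_spec ⟨g'', hgU'⟩
    have := entries_subset_of_card_le hU' hU hle (mem_entries.2 ⟨ha, _, _, rfl⟩)
    exact ⟨a, hUsub S hS hpost (mem_entries.1 this).1⟩

/-- A value entering a level was proposed at the preceding one, so unanimity propagates upwards. -/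
lemma enter_of_commit {m : ℕ} {e₀ d : P.Local} {p : Fin n} {c l : ℕ}
    {g : History n V P.Local} (h : Reached R (commit :: post m e₀ :: enter p c l d :: g))
    {j : ℕ} {e : P.Local} {g' : History n V P.Local}
    (h' : Reached R (enter p c (l + 1 + j) e :: g')) : e = d := by
  induction j generalizing e g' with
  | zero => exact enter_succ_of_commit h h'
  | succ j ih =>
    obtain ⟨T, hT, ⟨m', e', g'', hmem, -⟩, -, -⟩ := posted_of_enter_succ h'
    obtain ⟨a, ha⟩ := proposed_of_post hT hmem
    exact ih (reached_of_mem hT ha)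

lemma commit_unique {m m' : ℕ} {e₀ e₀' d d' : P.Local} {p : Fin n} {c l l' : ℕ}
    {g g' : History n V P.Local} (h : Reached R (commit :: post m e₀ :: enter p c l d :: g))
    (h' : Reached R (commit :: post m' e₀' :: enter p c l' d' :: g')) (hl : l ≤ l') : d = d' := by
  obtain ⟨S, hS, hpost, hu⟩ := commit_produced h
  obtain ⟨S', hS', hpost', hu'⟩ := commit_produced h'
  have h1 := mem_of_cons_mem hS hpost (by simp)
  have h2 := mem_of_cons_mem hS' hpost' (by simp)
  rcases hl.eq_or_lt with rfl | hl
  · rcases R.chain S hS S' hS' with hsub | hsub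
    · exact hu' _ ⟨_, hsub h1⟩
    · exact (hu _ ⟨_, hsub h2⟩).symm
  · obtain ⟨j, rfl⟩ := Nat.exists_eq_add_of_lt hl
    refine (enter_of_commit h (j := j) (g' := g') ?_).symm
    rw [show l + 1 + j = l + j + 1 by ring]
    exact reached_of_mem hS' h2

lemma decided_unique {S S' : Finset (History n V P.Local)} (hS : S ∈ R.views) (hS' : S' ∈ R.views)
    {p : Fin n} {c : ℕ} {d d' : P.Local} (h : Decided S p c d) (h' : Decided S' p c d') :
    d = d' := by
  obtain ⟨l, m, e, g, hg⟩ := h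
  obtain ⟨l', m', e', g', hg'⟩ := h'
  rcases le_total l l' with hl | hl
  · exact commit_unique (reached_of_mem hS hg) (reached_of_mem hS' hg') hl
  · exact (commit_unique (reached_of_mem hS' hg') (reached_of_mem hS hg) hl).symm

/-- Removing events from a history in a view leads, by causality, to a published input in the same
view; it makes the choice of an input in `fresh` meaningful. -/
lemma start_mem {S : Finset (History n V P.Local)} (hS : S ∈ R.views) {g : History n V P.Local}
    (hg : g ∈ S) : ∃ q, [start (v q)] ∈ S := by
  induction g with
  | nil => exact absurd (reached_of_mem hS hg) not_reached_nil
  | cons r g ih =>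
    rcases produced (reached_of_mem hS hg) with ⟨rfl, q, rfl⟩ | ⟨S', -, hgS', -, -, -, hsub⟩
    · exact ⟨q, hg⟩
    · exact ih (hsub S hS hg hgS')

lemma start_of_mem {S : Finset (History n V P.Local)} (hS : S ∈ R.views) {u : V}
    (hu : [start u] ∈ S) : ∃ q, u = v q := by
  rcases produced (reached_of_mem hS hu) with ⟨-, q, hq⟩ | ⟨S', hS', hnil, -⟩
  · cases hq
    exact ⟨q, rfl⟩
  · exact absurd (reached_of_mem hS' hnil) not_reached_nil

/-- Every proposal was computed from the agreed states in some view. -/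
lemma exists_fresh {p : Fin n} {c l : ℕ} {d : P.Local} {g : History n V P.Local}
    (h : Reached R (enter p c l d :: g)) :
    ∃ S ∈ R.views, count S p = c ∧ (∀ w, ¬ Output P S w) ∧ d = fresh P S p ∧
      (∃ q, [start (v q)] ∈ S) ∧ ∀ T ∈ R.views, enter p c l d :: g ∈ T → S ⊆ T := by
  induction l generalizing d g with
  | zero =>
    obtain ⟨S, hS, hg, hout, -, -, rfl, hl, rfl, hsub⟩ := enter_produced h
    refine ⟨S, hS, rfl, hout, ?_, ?_, hsub⟩
    · rw [proposal, ← hl]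
    · exact start_mem hS hg
  | succ l ih =>
    obtain ⟨T, hT, ⟨m', e', g'', hmem, -⟩, -, hsub⟩ := posted_of_enter_succ h
    obtain ⟨a, ha⟩ := proposed_of_post hT hmem
    obtain ⟨S, hS, hc, hout, hd, hq, hsub'⟩ := ih (reached_of_mem hT ha)
    exact ⟨S, hS, hc, hout, hd, hq, fun U hU hx => (hsub' T hT ha).trans (hsub U hU hx)⟩

end Run

end History

end AnonTask

/-! ### The agreed states as a genuine execution of the snapshot protocol -/

namespace AnonTask

namespace History

open Record

lemma count_mono {n : ℕ} {V L : Type} {S S' : Finset (History n V L)} (h : S ⊆ S') (p : Fin n) :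
    count S p ≤ count S' p := by
  by_contra hlt
  obtain ⟨d, hd⟩ := exists_decided (Nat.lt_of_not_le hlt)
  exact count_spec S' p d (hd.mono h)

lemma count_empty {n : ℕ} {V L : Type} (p : Fin n) : count (∅ : Finset (History n V L)) p = 0 := by
  by_contra h
  obtain ⟨d, l, m, e, g, hg⟩ := exists_decided (Nat.pos_of_ne_zero h)
  simp at hg

section Run

variable {n t : ℕ} {V W K Y : Type} {y₀ : Y} {P : Protocol (snapshotMemory n K Y y₀) V W}
  [Nonempty V] [Nonempty P.Local] {v : Fin n → V} {F : Set (Fin n)}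
  {R : SetRun (simulation P t) v F}

lemma Decided.exists_fresh {S : Finset (History n V P.Local)} (hS : S ∈ R.views) {p : Fin n} {c : ℕ}
    {d : P.Local} (h : Decided S p c d) :
    ∃ S₀ ∈ R.views, count S₀ p = c ∧ (∀ w, ¬ Output P S₀ w) ∧ d = fresh P S₀ p ∧
      (∃ q, [start (v q)] ∈ S₀) ∧ S₀ ⊆ S := by
  obtain ⟨l, m, e, g, hg⟩ := h
  have hx : enter p c l d :: g ∈ S :=
    mem_of_cons_mem hS (mem_of_cons_mem hS hg (by simp)) (by simp)
  obtain ⟨S₀, hS₀, hc, hout, hd, hq, hsub⟩ := History.exists_fresh (reached_of_mem hS hx)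
  exact ⟨S₀, hS₀, hc, hout, hd, hq, hsub S hS hx⟩

/-- State `c` is proposed only on the basis of a view in which exactly the states before `c` are
agreed, so agreed states leave no gaps. -/
lemma Decided.lt_count {S : Finset (History n V P.Local)} (hS : S ∈ R.views) {p : Fin n} {c : ℕ}
    {d : P.Local} (h : Decided S p c d) : c < count S p := by
  obtain ⟨S₀, -, hc, -, -, -, hsub⟩ := h.exists_fresh hS
  have h1 := count_mono hsub p
  rcases h1.eq_or_lt with h2 | h2
  · exact absurd (by rwa [← hc, h2] at h) (count_spec S p d)
  · lia

/-! #### The views as a sequence -/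

variable (R) in
open Classical in
/-- The largest view with at most `k` elements. -/
noncomputable def viewAt : ℕ → Finset (History n V P.Local)
  | 0 => ∅
  | k + 1 => if h : ∃ S ∈ R.views, S.card = k + 1 then h.choose else viewAt k

lemma eq_of_card_eq {S S' : Finset (History n V P.Local)} (hS : S ∈ R.views) (hS' : S' ∈ R.views)
    (h : S.card = S'.card) : S = S' := by
  rcases R.chain S hS S' hS' with hs | hs
  · exact Finset.eq_of_subset_of_card_le hs h.ge
  · exact (Finset.eq_of_subset_of_card_le hs h.le).symm

variable (R) in
lemma viewAt_mem (k : ℕ) : viewAt R k = ∅ ∨ viewAt R k ∈ R.views := by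
  induction k with
  | zero => exact .inl rfl
  | succ k ih =>
    rw [viewAt]
    split_ifs with h
    · exact .inr h.choose_spec.1
    · exact ih

variable (R) in
lemma card_viewAt_le (k : ℕ) : (viewAt R k).card ≤ k := by
  induction k with
  | zero => simp [viewAt]
  | succ k ih =>
    rw [viewAt]
    split_ifs with h
    · exact h.choose_spec.2.le
    · lia

lemma viewAt_card {S : Finset (History n V P.Local)} (hS : S ∈ R.views) :
    viewAt R S.card = S := by
  rcases hc : S.card with _ | k
  · rw [viewAt, Finset.card_eq_zero.1 hc]
  · have h : ∃ S ∈ R.views, S.card = k + 1 := ⟨S, hS, hc⟩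
    rw [viewAt, dif_pos h]
    exact eq_of_card_eq h.choose_spec.1 hS (h.choose_spec.2.trans hc.symm)

lemma subset_viewAt {S : Finset (History n V P.Local)} (hS : S ∈ R.views) {k : ℕ}
    (h : S.card ≤ k) : S ⊆ viewAt R k := by
  induction k with
  | zero => rw [Finset.card_eq_zero.1 (Nat.le_zero.1 h)]; exact Finset.empty_subset _
  | succ k ih =>
    rcases h.eq_or_lt with h | h
    · rw [← h, viewAt_card hS]
    · rw [viewAt]
      split_ifs with h'
      · refine (R.chain S hS _ h'.choose_spec.1).elim id fun hs => ?_
        have := Finset.card_le_card hs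
        have := h'.choose_spec.2
        lia
      · exact ih (by lia)

variable (R) in
lemma viewAt_mono : Monotone (viewAt R) := by
  intro j k hjk
  rcases viewAt_mem R j with h | h
  · rw [h]
    exact Finset.empty_subset _
  · exact subset_viewAt h ((card_viewAt_le R j).trans hjk)

lemma viewAt_succ_subset {S : Finset (History n V P.Local)} (hS : S ∈ R.views) {k : ℕ}
    (h : ¬ S ⊆ viewAt R k) : viewAt R (k + 1) ⊆ S := by
  have hc : k < S.card := by
    by_contra hk
    exact h (subset_viewAt hS (Nat.le_of_not_lt hk))
  rw [← viewAt_card hS]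
  exact viewAt_mono R hc

/-- If two new states of `p` appeared at once, the later one would have been computed in a view that
already has the earlier one. That view is not contained in `viewAt R k`, so it contains `viewAt R (k
+ 1)` and has too many states. -/
lemma count_viewAt_succ_le (k : ℕ) (p : Fin n) :
    count (viewAt R (k + 1)) p ≤ count (viewAt R k) p + 1 := by
  by_contra hlt
  obtain ⟨d, hd⟩ := exists_decided (Nat.lt_of_not_le hlt)
  rcases viewAt_mem R (k + 1) with h | h
  · rw [h, count_empty] at hlt
    lia
  · obtain ⟨S, hS, hc, -, -, -, hsub⟩ := hd.exists_fresh h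
    have hS' := viewAt_succ_subset hS (k := k) fun hs => by
      have := count_mono hs p
      lia
    have := count_mono hS' p
    lia

/-! #### The simulated execution -/

variable (R) in
open Classical in
/-- The agreed state number `c` of `p`. -/
noncomputable def state (p : Fin n) (c : ℕ) : P.Local :=
  if h : ∃ d, ∃ S ∈ R.views, Decided S p c d then h.choose else P.start p (v p)

lemma state_eq {S : Finset (History n V P.Local)} (hS : S ∈ R.views) {p : Fin n} {c : ℕ}
    {d : P.Local} (h : Decided S p c d) : state R p c = d := by
  have h' : ∃ d, ∃ S ∈ R.views, Decided S p c d := ⟨d, S, hS, h⟩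
  rw [state, dif_pos h']
  obtain ⟨S', hS', h''⟩ := h'.choose_spec
  exact decided_unique hS' hS h'' h

lemma agreed_eq {S : Finset (History n V P.Local)} (hS : S ∈ R.views) {p : Fin n} {c : ℕ}
    (h : c < count S p) : agreed S p c = state R p c := by
  obtain ⟨d, hd⟩ := exists_decided h
  exact (state_eq hS (agreed_spec hd)).symm

variable (R) in
lemma exists_start (p : Fin n) : ∃ q, state R p 0 = P.start p (v q) := by
  by_cases h : ∃ d, ∃ S ∈ R.views, Decided S p 0 d
  · obtain ⟨d, S, hS, hd⟩ := h
    obtain ⟨S₀, hS₀, hc, -, rfl, ⟨q, hq⟩, -⟩ := hd.exists_fresh hS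
    obtain ⟨q', hq'⟩ := start_of_mem hS₀
      (Classical.epsilon_spec (p := fun v : V => [start v] ∈ S₀) ⟨v q, hq⟩)
    refine ⟨q', ?_⟩
    rw [state_eq hS hd, fresh, hc]
    exact congrArg (P.start p) hq'
  · exact ⟨p, by rw [state, dif_neg h]⟩

-- The operation takes effect at the view `S` in which the agreed next state was first computed; its
-- cardinality serves as the time. No output is visible in `S`, so the state does have an operation,
-- and the memory used is the one known in `S`.
variable (R) in
lemma exists_time (p : Fin n) (i : ℕ) : ∃ j, ∀ k, i + 2 ≤ count (viewAt R k) p →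
    ∃ op, P.snapshotAction p (state R p i) = .inl op ∧ count (viewAt R j) p = i + 1 ∧
      state R p (i + 1) = P.afterOp p (state R p i) op
        (P.knownMemory (state R) (count (viewAt R j))) := by
  by_cases h : ∃ k, i + 2 ≤ count (viewAt R k) p
  · obtain ⟨k, hk⟩ := h
    obtain ⟨d, hd⟩ := exists_decided (Nat.lt_of_succ_le hk)
    have hV : viewAt R k ∈ R.views := by
      refine (viewAt_mem R k).resolve_left fun h => ?_
      rw [h, count_empty] at hk
      lia
    obtain ⟨S, hS, hc, hout, hfr, -, -⟩ := hd.exists_fresh hV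
    refine ⟨S.card, fun _ _ => ?_⟩
    have ha : agreed S p i = state R p i := agreed_eq hS (by lia)
    rw [viewAt_card hS, state_eq hV hd]
    rw [fresh, hc] at hfr
    simp only [ha] at hfr
    rcases hop : P.snapshotAction p (state R p i) with op | w
    · refine ⟨op, rfl, hc, ?_⟩
      simp only [hop] at hfr
      rw [hfr]
      congr 1
      funext k q
      exact P.written_congr fun j hj => agreed_eq hS (by lia)
    · obtain ⟨d', hd'⟩ := exists_decided (show i < count S p by lia)
      exact absurd ⟨p, i, d', hd', by rwa [← state_eq hS hd']⟩ (hout w)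
  · exact ⟨0, fun k hk => absurd ⟨k, hk⟩ h⟩

variable (R) in
lemma exists_replay : ∃ u time, (∀ p, ∃ q, u p = v q) ∧
    P.Replay u (state R) (fun k => count (viewAt R k)) time := by
  choose q hq using exists_start R
  choose time htime using exists_time R
  exact ⟨fun p => v (q p), time, fun p => ⟨q p, rfl⟩, hq, fun p => count_empty p,
    fun k p => count_mono (viewAt_mono R (Nat.le_succ k)) p, fun k p => count_viewAt_succ_le k p,
    fun p i k h => htime p i k h⟩

/-- A deciding state has no successor, so it is the last agreed one; as it performs no scan, the
replay has not moved past it. -/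
lemma action_of_output {u : Fin n → V} {time : Fin n → ℕ → ℕ}
    (Q : P.Replay u (state R) (fun k => count (viewAt R k)) time)
    {S : Finset (History n V P.Local)} (hS : S ∈ R.views) {w : W} (h : Output P S w) :
    ∃ p, P.action p ((P.exec (P.initial u) (Q.schedule S.card)).locals p) = .inr w := by
  obtain ⟨p, c, d, hd, hw⟩ := h
  have hlt := hd.lt_count hS
  rw [← state_eq hS hd] at hw
  have hc : count S p = c + 1 := by
    by_contra hne
    obtain ⟨op, hop, -⟩ := Q.next p c S.card (by rw [viewAt_card hS]; lia)
    rw [hw] at hop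
    cases hop
  refine ⟨p, ?_⟩
  rw [Q.action_exec_schedule]
  rcases Q.steps_eq S.card p with h | ⟨i, o, hi, ho⟩
  · rw [h, viewAt_card hS, hc, Nat.add_sub_cancel]
    exact hw
  · rw [viewAt_card hS, hc] at hi
    obtain rfl : c = i := by lia
    rw [hw] at ho
    cases ho

variable {T : ColorlessTask V W}

/-- The outputs of the simulated processes form a simplex. -/
lemma exists_face_output (hP : P.SolvesResilient t T) (hn : 0 < n)
    (s : {s : Finset V // s ∈ T.input.faces}) (hv : ∀ p, v p ∈ s.1) :
    ∃ τ ∈ (T.carrier s).faces, ∀ S ∈ R.views, ∀ w, Output P S w → w ∈ τ := by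
  obtain ⟨u, time, hu, Q⟩ := exists_replay R
  obtain ⟨τ, hτ, h⟩ := hP.exists_face_of_prefix hn s u
    (fun p => by obtain ⟨q, hq⟩ := hu p; rw [hq]; exact hv q) Q.schedule Q.schedule_prefix
  refine ⟨τ, hτ, fun S hS w hw => ?_⟩
  obtain ⟨p, hp⟩ := action_of_output Q hS hw
  exact h _ _ _ hp

end Run

end History

end AnonTask

/-! ### Liveness of the simulation -/

namespace AnonTask

namespace History

open Record

section Run

variable {n t : ℕ} {V W K Y : Type} {y₀ : Y} {P : Protocol (snapshotMemory n K Y y₀) V W}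

lemma Output.mono {S S' : Finset (History n V P.Local)} {w : W} (h : Output P S w) (hS : S ⊆ S') :
    Output P S' w := by
  obtain ⟨p, c, d, hd, hw⟩ := h
  exact ⟨p, c, d, hd.mono hS, hw⟩

variable [Nonempty V] [Nonempty P.Local] {v : Fin n → V} {F : Set (Fin n)}
  {R : SetRun (simulation P t) v F}

lemma item_suffix_of_length_le {q : Fin n} {k k' : ℕ}
    (h : (R.item k q).length ≤ (R.item k' q).length) : R.item k q <:+ R.item k' q := by
  rcases item_comparable R q k k' with h' | h'
  · exact h'
  · rw [h'.eq_of_length (h'.length_le.antisymm h)]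

lemma reached_of_suffix {g x : History n V P.Local} (hx : Reached R x) (hgx : g <:+ x)
    (hg : g ≠ []) : Reached R g := by
  obtain ⟨a, rfl⟩ := hgx
  induction a with
  | nil => exact hx
  | cons r a ih =>
    refine ih ?_
    rcases produced hx with ⟨h, -⟩ | ⟨S, hS, hgS, -⟩
    · simp [hg] at h
    · exact reached_of_mem hS hgS

/-! #### No deadlock -/

/-- A blocked simulated process is blocked by a crashed process. -/
lemma exists_blocking {k₀ : ℕ} (hconst : ∀ k, k₀ ≤ k → R.item k = R.item k₀)
    {S : Finset (History n V P.Local)} (hS : S ∈ R.views)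
    (hF : ∀ q ∉ F, R.item k₀ q ∈ S ∧ Idle (R.item k₀ q)) {p : Fin n} (hp : ¬ Available S p) :
    ∃ q ∈ F, ∃ k c l e g, R.item k q = enter p c l e :: g ∧ enter p c l e :: g ∈ S ∧
      ∀ m d, post m d :: enter p c l e :: g ∉ S := by
  simp only [Available, Closed, not_forall] at hp
  obtain ⟨l, -, e, g, hg, hpost⟩ := hp
  push Not at hpost
  obtain ⟨k, q, hq⟩ := reached_of_mem hS hg
  refine ⟨q, ?_, k, _, l, e, g, hq, hg, hpost⟩
  by_contra hqF
  obtain ⟨hmem, hidle⟩ := hF q hqF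
  have hsuf : R.item k q <:+ R.item k₀ q := by
    rcases le_total k k₀ with h | h
    · exact item_suffix R q h
    · rw [hconst k h]
  rw [hq] at hsuf
  obtain ⟨a, ha⟩ := hsuf
  rcases List.eq_nil_or_concat a with rfl | ⟨a, r, rfl⟩
  · exact hidle.1 _ _ _ _ _ ha.symm
  · have h1 : r :: enter p (count S p) l e :: g ∈ S :=
      mem_of_suffix hS hmem ⟨a, by simpa using ha⟩ (by simp)
    obtain ⟨m, d, rfl⟩ := exists_post_of_cons (reached_of_mem hS h1)
    exact hpost m d h1

/-- A process can block only at its last entry: a later entry of the same process in `S` would bring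
the post of the earlier one into `S`. This makes charging blocked simulated processes to crashed
ones injective. -/
lemma eq_of_blocking {S : Finset (History n V P.Local)} (hS : S ∈ R.views) {q p p' : Fin n}
    {k k' c c' l l' : ℕ} {e e' : P.Local} {g g' : History n V P.Local}
    (hq : R.item k q = enter p c l e :: g) (hq' : R.item k' q = enter p' c' l' e' :: g')
    (hg' : enter p' c' l' e' :: g' ∈ S)
    (hpost : ∀ m d, post m d :: enter p c l e :: g ∉ S) (hk : k ≤ k') : p = p' := by
  have h := item_suffix R q hk
  rw [hq, hq'] at h
  obtain ⟨a, ha⟩ := h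
  rcases List.eq_nil_or_concat a with rfl | ⟨a, r, rfl⟩
  · simp only [List.nil_append, List.cons.injEq, enter.injEq] at ha
    exact ha.1.1
  · have h1 : r :: enter p c l e :: g ∈ S :=
      mem_of_suffix hS hg' ⟨a, by simpa using ha⟩ (by simp)
    obtain ⟨m, d, rfl⟩ := exists_post_of_cons (reached_of_mem hS h1)
    exact absurd h1 (hpost m d)

/-- If all items are eventually constant and a live process is undecided, the largest view shows no
output, so nobody has decided and every live process is waiting there. Waiting means that more than
`t` simulated processes are unavailable, yet each of them is charged to a different process of `F`.
-/
lemma not_stuck (htn : t < n) (hF : F.ncard ≤ t) {k₀ : ℕ}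
    (hconst : ∀ k, k₀ ≤ k → R.item k = R.item k₀) (p : Fin n) (hp : p ∉ F) :
    ∃ w, R.Decides p w := by
  by_contra hund
  push Not at hund
  obtain ⟨S, hS, hmax, hwait⟩ := R.live k₀ hconst ⟨p, hp, hund⟩
  have hout := (act_wait htn (hwait p hp hund).2).1
  have hnot : ∀ q w, ¬ R.Decides q w := by
    intro q w h
    obtain ⟨k, S', hS', h'⟩ := R.decides q w h
    exact hout w ((act_decide h').mono (hmax S' hS'))
  have hidle : ∀ q ∉ F, R.item k₀ q ∈ S ∧ Idle (R.item k₀ q) := fun q hq =>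
    ⟨(hwait q hq (hnot q)).1, (act_wait htn (hwait q hq (hnot q)).2).2.1⟩
  have hready := (act_wait htn (hwait p hp hund).2).2.2
  have hex : ∀ p', ∃ q, ¬ Available S p' → q ∈ F ∧ ∃ k c l e g, R.item k q = enter p' c l e :: g ∧
      enter p' c l e :: g ∈ S ∧ ∀ m d, post m d :: enter p' c l e :: g ∉ S := by
    intro p'
    by_cases h : Available S p'
    · exact ⟨p, fun h' => absurd h h'⟩
    · obtain ⟨q, hq⟩ := exists_blocking hconst hS hidle h
      exact ⟨q, fun _ => hq⟩
  choose φ hφ using hex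
  have hcard : {p' | Available S p'}ᶜ.ncard ≤ F.ncard := by
    refine Set.ncard_le_ncard_of_injOn φ (fun a ha => (hφ a ha).1) ?_ (Set.toFinite _)
    intro a ha b hb hab
    obtain ⟨-, k, c, l, e, g, hq, hg, hpost⟩ := hφ a ha
    obtain ⟨-, k', c', l', e', g', hq', hg', hpost'⟩ := hφ b hb
    rw [hab] at hq
    rcases le_total k k' with hk | hk
    · exact eq_of_blocking hS hq hq' hg' hpost hk
    · exact (eq_of_blocking hS hq' hq hg hpost' hk).symm
  have htot := Set.ncard_add_ncard_compl {p' | Available S p'}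
  rw [Nat.card_eq_fintype_card, Fintype.card_fin] at htot
  exact hready (show n ≤ {p' | Available S p'}.ncard + t by lia)

/-! #### Every agreement terminates -/

variable (R) in
/-- Two processes leave an entry of the level with different posts. -/
def Diverges (p : Fin n) (c l : ℕ) : Prop :=
  ∃ e g r r', r ≠ r' ∧ Reached R (r :: enter p c l e :: g) ∧ Reached R (r' :: enter p c l e :: g)

/-- The minimal post in the larger view has strictly fewer entries, since equal entry sets would
give equal picks. Its entry was already visible in `S`, where the level is closed and every post has
more entries. So this same entry has been posted with two different counts, necessarily by distinct
processes. -/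
lemma diverges_of_ne {S S' : Finset (History n V P.Local)} (hS : S ∈ R.views) (hS' : S' ∈ R.views)
    {p : Fin n} {c l : ℕ} {d d' : P.Local} (hd : Posted S p c l d) (hd' : Posted S' p c l d')
    (hc : Closed S p c l) (hsub : S ⊆ S') (hne : d ≠ d') : Diverges R p c l := by
  obtain ⟨m, e, g, hg, hmin⟩ := hd
  obtain ⟨m', e', g', hg', hmin'⟩ := hd'
  have hle := hmin' _ _ _ _ (hsub hg)
  obtain ⟨U, hU, hgU, rfl, rfl, hUS⟩ := post_produced_of_enter (reached_of_mem hS hg)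
  obtain ⟨U', hU', hgU', rfl, rfl, -⟩ := post_produced_of_enter (reached_of_mem hS' hg')
  have hsub' := entries_subset_of_card_le hU' hU hle
  have hlt : (entries U' p c l).card < (entries U p c l).card := by
    refine lt_of_le_of_ne hle fun heq => hne ?_
    rw [pick, pick, proposed_congr (Finset.eq_of_subset_of_card_le hsub' heq.ge)]
  have hmem : enter p c l e' :: g' ∈ S :=
    hUS S hS hg (mem_entries.1 (hsub' (mem_entries.2 ⟨hgU', _, _, rfl⟩))).1
  obtain ⟨m₁, d₁, h₁⟩ := hc _ _ hmem
  refine ⟨e', g', _, _, ?_, reached_of_mem hS h₁, reached_of_mem hS' hg'⟩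
  intro heq
  have := hmin _ _ _ _ h₁
  cases heq
  lia

lemma diverges_of_enter {p : Fin n} {c l : ℕ} {d d' : P.Local} {g g' : History n V P.Local}
    (h : Reached R (enter p c (l + 1) d :: g)) (h' : Reached R (enter p c (l + 1) d' :: g'))
    (hne : d ≠ d') : Diverges R p c l := by
  obtain ⟨S, hS, hd, hc, -⟩ := posted_of_enter_succ h
  obtain ⟨S', hS', hd', hc', -⟩ := posted_of_enter_succ h'
  rcases R.chain S hS S' hS' with hsub | hsub
  · exact diverges_of_ne hS hS' hd hd' hc hsub hne
  · exact diverges_of_ne hS' hS hd' hd hc' hsub hne.symm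

/-- Two processes part only once. -/
lemma eq_of_part {q q' : Fin n} {r r' s s' : Record n V P.Local} {x y : History n V P.Local}
    {i i' j j' : ℕ} (h : R.item i q = r :: x) (h' : R.item i' q' = r' :: x) (hne : r ≠ r')
    (hy : R.item j q = s :: y) (hy' : R.item j' q' = s' :: y) (hlen : x.length ≤ y.length) :
    x = y := by
  have h1 : r :: x <:+ s :: y := by
    rw [← h, ← hy]
    exact item_suffix_of_length_le (by simp [h, hy, hlen])
  have h2 : r' :: x <:+ s' :: y := by
    rw [← h', ← hy']
    exact item_suffix_of_length_le (by simp [h', hy', hlen])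
  rcases hlen.eq_or_lt with heq | hlt
  · exact (List.cons.inj (h1.eq_of_length (by simp [heq]))).2
  -- If `y` were longer than `x`, then `r :: x` and `r' :: x` would both be suffixes of `y` of the
  -- same length, forcing `r = r'`.
  · have h3 := List.suffix_of_suffix_length_le h1 (List.suffix_cons s y) (by simpa using hlt)
    have h4 := List.suffix_of_suffix_length_le h2 (List.suffix_cons s' y) (by simpa using hlt)
    have h5 := (List.suffix_of_suffix_length_le h3 h4 (by simp)).eq_of_length (by simp)
    exact absurd (List.cons.inj h5).1 hne

/-- Each diverging level is assigned a pair of processes that part at it; since a pair parts only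
once, there are at most `n * n` such levels. -/
lemma finite_diverges (p : Fin n) (c : ℕ) : {l | Diverges R p c l}.Finite := by
  have h : ∀ l : {l | Diverges R p c l}, ∃ (q : Fin n × Fin n) (e : P.Local)
      (g : History n V P.Local)
      (r r' : Record n V P.Local) (i i' : ℕ), r ≠ r' ∧ R.item i q.1 = r :: enter p c l e :: g ∧
        R.item i' q.2 = r' :: enter p c l e :: g := by
    rintro ⟨l, e, g, r, r', hne, ⟨i, q, hq⟩, ⟨i', q', hq'⟩⟩
    exact ⟨(q, q'), e, g, r, r', i, i', hne, hq, hq'⟩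
  choose q e g r r' i i' hne hq hq' using h
  refine Set.finite_coe_iff.1 (Finite.of_injective q fun a b hab => ?_)
  have ha := hq b
  have ha' := hq' b
  rw [← hab] at ha ha'
  have heq : enter p c a (e a) :: g a = enter p c b (e b) :: g b := by
    rcases le_total (enter p c a (e a) :: g a).length (enter p c b (e b) :: g b).length with hl | hl
    · exact eq_of_part (hq a) (hq' a) (hne a) ha ha' hl
    · exact (eq_of_part ha ha' (hne b) (hq a) (hq' a) hl).symm
  simp only [List.cons.injEq, enter.injEq] at heq
  exact Subtype.ext heq.1.2.2.1

/-! #### Progress -/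

/-- Histories only grow; if all were bounded, their total length would reach its maximum and the
items would then be constant. -/
lemma exists_unbounded (h : ∀ k₀, ∃ k, k₀ ≤ k ∧ R.item k ≠ R.item k₀) :
    ∃ q, ∀ N, ∃ k, N < (R.item k q).length := by
  by_contra hb
  push Not at hb
  choose N hN using hb
  let len : ℕ → ℕ := fun k => ∑ q, (R.item k q).length
  have hbdd : BddAbove (Set.range len) := ⟨∑ q, N q, by
    rintro _ ⟨k, rfl⟩
    exact Finset.sum_le_sum fun q _ => hN q k⟩
  obtain ⟨k₀, hk₀⟩ := Nat.sSup_mem (Set.range_nonempty len) hbdd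
  obtain ⟨k, hk, hne⟩ := h k₀
  refine hne (funext fun q => ?_)
  have hle : ∀ q ∈ Finset.univ, (R.item k₀ q).length ≤ (R.item k q).length :=
    fun q _ => (item_suffix R q hk).length_le
  have hsum : ∑ q, (R.item k₀ q).length = ∑ q, (R.item k q).length :=
    (Finset.sum_le_sum hle).antisymm (by
      have := le_csSup hbdd ⟨k, rfl⟩
      rw [← hk₀] at this
      exact this)
  exact ((item_suffix R q hk).eq_of_length
    ((Finset.sum_eq_sum_iff_of_le hle).1 hsum q (Finset.mem_univ q))).symm

variable (R) in
/-- The history of a process that takes infinitely many steps, with the views it obtains. -/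
structure Trace (h : ℕ → History n V P.Local) (r : ℕ → Record n V P.Local)
    (S : ℕ → Finset (History n V P.Local)) : Prop where
  succ : ∀ j, h (j + 1) = r j :: h j
  view : ∀ j, S j ∈ R.views
  mem : ∀ j, h j ∈ S j
  notMem : ∀ j, h (j + 1) ∉ S j
  no_output : ∀ j w, ¬ Output P (S j) w
  move : ∀ j, Move P (S j) t (h j) (r j)

lemma exists_trace {q : Fin n} (hq : ∀ N, ∃ k, N < (R.item k q).length) :
    ∃ h r S, Trace R h r S := by
  have h1 : ∀ j, ∃ x : History n V P.Local, x.length = j + 1 ∧ ∃ k, x <:+ R.item k q := by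
    intro j
    obtain ⟨k, hk⟩ := hq j
    exact ⟨(R.item k q).drop ((R.item k q).length - (j + 1)), by rw [List.length_drop]; lia, k,
      List.drop_suffix _ _⟩
  choose h hlen k hk using h1
  have h2 : ∀ j, ∃ r, h (j + 1) = r :: h j := by
    intro j
    have hs : h j <:+ h (j + 1) :=
      List.suffix_of_suffix_length_le ((hk j).trans (item_suffix R q (le_max_left _ _)))
        ((hk (j + 1)).trans (item_suffix R q (le_max_right _ _))) (by simp [hlen])
    obtain ⟨a, ha⟩ := hs
    have hal : a.length = 1 := by
      have := congrArg List.length ha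
      rw [List.length_append, hlen, hlen] at this
      lia
    obtain ⟨r, rfl⟩ := List.length_eq_one_iff.1 hal
    exact ⟨r, ha.symm⟩
  choose r hr using h2
  have hne : ∀ j, h j ≠ [] := fun j e => by
    have := hlen j
    simp [e] at this
  have h3 : ∀ j, ∃ S ∈ R.views, h j ∈ S ∧ r j :: h j ∉ S ∧ (∀ w, ¬ Output P S w) ∧
      Move P S t (h j) (r j) := by
    intro j
    have hreach : Reached R (r j :: h j) := by
      rw [← hr]
      exact reached_of_suffix ⟨_, q, rfl⟩ (hk (j + 1)) (hne _)
    rcases produced hreach with ⟨h', -⟩ | ⟨S, hS, hg, hx, hout, hm, -⟩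
    · exact absurd h' (hne j)
    · exact ⟨S, hS, hg, hx, hout, hm⟩
  choose S hS hg hx hout hm using h3
  exact ⟨h, r, S, hr, hS, hg, fun j => by rw [hr]; exact hx j, hout, hm⟩

namespace Trace

variable {h : ℕ → History n V P.Local} {r : ℕ → Record n V P.Local}
  {S : ℕ → Finset (History n V P.Local)}

lemma view_mono (Q : Trace R h r S) : Monotone S := by
  refine monotone_nat_of_le_succ fun j => ?_
  exact (R.chain _ (Q.view j) _ (Q.view (j + 1))).resolve_right fun hs =>
    Q.notMem j (hs (Q.mem (j + 1)))

lemma mem_of_le (Q : Trace R h r S) {i j : ℕ} (hij : i ≤ j) : h i ∈ S j :=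
  Q.view_mono hij (Q.mem i)

lemma injective (Q : Trace R h r S) : Function.Injective h := by
  have : StrictMono fun j => (h j).length := strictMono_nat_of_lt_succ fun j => by simp [Q.succ j]
  intro i j hij
  exact this.injective (congrArg List.length hij)

/-- A view containing an output cannot lie below any view of the trace, so it would contain them all
and with them infinitely many histories. -/
lemma not_output (Q : Trace R h r S) {U : Finset (History n V P.Local)} (hU : U ∈ R.views) (w : W) :
    ¬ Output P U w := by
  intro hw
  have hall : ∀ j, h j ∈ U := by
    intro j
    rcases R.chain U hU (S j) (Q.view j) with hs | hs
    · exact absurd (hw.mono hs) (Q.no_output j w)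
    · exact hs (Q.mem j)
  exact Set.infinite_of_injective_forall_mem Q.injective (s := (U : Set (History n V P.Local))) hall
    U.finite_toSet

lemma exists_idle (Q : Trace R h r S) (j : ℕ) : ∃ i, j ≤ i ∧ Idle (h i) := by
  have h1 : ∀ i m d p c l e g, h i = post m d :: enter p c l e :: g → Idle (h (i + 1)) := by
    intro i m d p c l e g hi
    have hm := Q.move i
    rw [Q.succ]
    generalize r i = r' at hm
    rw [hi] at hm ⊢
    cases hm with
    | enter hg _ _ => exact absurd rfl (hg.2 m d p c l e g)
    | commit _ => exact ⟨by simp, by simp⟩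
    | adopt _ => exact ⟨by simp, by simp⟩
  by_cases hi : Idle (h j)
  · exact ⟨j, le_rfl, hi⟩
  · rw [Idle, not_and_or] at hi
    rcases hi with hi | hi
    · push Not at hi
      obtain ⟨p, c, l, e, g, hg⟩ := hi
      have hm := Q.move j
      have hs := Q.succ j
      generalize r j = r' at hm hs
      rw [hg] at hm hs
      cases hm with
      | enter hg _ _ => exact absurd rfl (hg.1 p c l e g)
      | post => exact ⟨j + 2, by lia, h1 _ _ _ _ _ _ _ _ hs⟩
    · push Not at hi
      obtain ⟨m, d, p, c, l, e, g, hg⟩ := hi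
      exact ⟨j + 1, by lia, h1 _ _ _ _ _ _ _ _ hg⟩

/-- What a process does from an idle history. -/
lemma round (Q : Trace R h r S) {j : ℕ} (hj : Idle (h j)) :
    ∃ p d, Ready (S j) t ∧ Target (S j) p ∧
      h (j + 1) = enter p (count (S j) p) (level (S j) p) d :: h j ∧
      ((∃ m e, h (j + 3) = commit :: post m e :: h (j + 1)) ∨
        ∃ e, e ≠ d ∧ Proposed (S (j + 2)) p (count (S j) p) (level (S j) p) e) := by
  have hm := Q.move j
  have hs := Q.succ j
  have hm1 := Q.move (j + 1)
  have hs1 := Q.succ (j + 1)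
  have hm2 := Q.move (j + 2)
  have hs2 := Q.succ (j + 2)
  generalize h j = x at *
  generalize h (j + 1) = x1 at *
  generalize r j = y at *
  cases hm with
  | post => exact absurd rfl (hj.1 _ _ _ _ _)
  | commit _ => exact absurd rfl (hj.2 _ _ _ _ _ _ _)
  | adopt _ => exact absurd rfl (hj.2 _ _ _ _ _ _ _)
  | @enter g p hg hr hp =>
    refine ⟨p, _, hr, hp, hs, ?_⟩
    subst hs
    rw [show j + 1 + 1 = j + 2 from rfl] at hs1
    generalize r (j + 1) = y1 at *
    cases hm1 with
    | enter hg _ _ => exact absurd rfl (hg.1 _ _ _ _ _)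
    | post =>
      rw [show j + 2 + 1 = j + 3 from rfl] at hs2
      generalize r (j + 2) = y2 at *
      rw [hs1] at hm2 hs2
      cases hm2 with
      | enter hg _ _ => exact absurd rfl (hg.2 _ _ _ _ _ _ _)
      | commit _ => exact .inl ⟨_, _, hs2⟩
      | adopt hd =>
        obtain ⟨e, he, hne⟩ := hd
        exact .inr ⟨e, hne, he⟩

/-- If more than `t` simulated processes stop making progress, then only finitely many states are
ever agreed on, with finitely many levels each. -/
lemma ncard_bounded_le (Q : Trace R h r S) :
    {p | ∃ N, ∀ k, count (viewAt R k) p ≤ N}.ncard ≤ t := by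
  by_contra hB
  set B := {p | ∃ N, ∀ k, count (viewAt R k) p ≤ N} with hBdef
  have hN : ∃ N, ∀ p ∈ B, ∀ k, count (viewAt R k) p ≤ N := by
    have h1 : ∀ p, ∃ N, p ∈ B → ∀ k, count (viewAt R k) p ≤ N := by
      intro p
      by_cases hp : p ∈ B
      · obtain ⟨N, hN⟩ := hp
        exact ⟨N, fun _ => hN⟩
      · exact ⟨0, fun h => absurd h hp⟩
    choose N hN using h1
    exact ⟨Finset.univ.sup N, fun p hp k =>
      (hN p hp k).trans (Finset.le_sup (Finset.mem_univ p))⟩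
  obtain ⟨N, hN⟩ := hN
  have hround : ∀ j : {j | Idle (h j)}, ∃ (p : Fin n) (c : Fin (N + 1)) (l : ℕ) (d : P.Local),
      c.1 = count (S j) p ∧ l = level (S j) p ∧ h (j + 1) = enter p c l d :: h j ∧
      ((∃ m e, h (j + 3) = commit :: post m e :: h (j + 1)) ∨
        ∃ e, e ≠ d ∧ Proposed (S (j + 2)) p c l e) := by
    intro j
    obtain ⟨p, d, hr, hp, he, hend⟩ := Q.round j.2
    have hc : count (S j) p ≤ N := by
      -- At most `t` processes are unavailable while `B` has more than `t` elements. The target is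
      -- the least advanced available process, so its count stays below the bound for `B`.
      obtain ⟨p', hp', hpB⟩ : ∃ p', Available (S j) p' ∧ p' ∈ B := by
        by_contra hdis
        have hsub : B ⊆ {p | Available (S j) p}ᶜ := fun p' hp' ha => hdis ⟨p', ha, hp'⟩
        have h1 := Set.ncard_le_ncard hsub (Set.toFinite _)
        have htot := Set.ncard_add_ncard_compl {p' | Available (S j) p'}
        rw [Nat.card_eq_fintype_card, Fintype.card_fin] at htot
        unfold Ready at hr
        lia
      have h2 := hN p' hpB (S j).card
      rw [viewAt_card (Q.view j)] at h2
      exact (hp.2 p' hp').trans h2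
    exact ⟨p, ⟨count (S j) p, by lia⟩, _, d, rfl, rfl, he, hend⟩
  choose p c l d hc hl he hend using hround
  have hinf : Infinite {j | Idle (h j)} := by
    refine Set.infinite_coe_iff.2 (Set.infinite_of_not_bddAbove ?_)
    rintro ⟨b, hb⟩
    obtain ⟨i, hi, hidle⟩ := Q.exists_idle (b + 1)
    have := hb hidle
    lia
  -- Infinitely many rounds concern finitely many pairs of a simulated process and a state number,
  -- so one pair recurs forever.
  obtain ⟨⟨p₀, c₀⟩, hfib⟩ := Finite.exists_infinite_fiber fun j => (p j, c j)
  set A := (fun j => (p j, c j)) ⁻¹' {(p₀, c₀)} with hA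
  have hp₀ : ∀ j ∈ A, p j = p₀ ∧ c j = c₀ := by
    intro j hj
    simpa [hA] using hj
  have hlater : ∀ j ∈ A, ∃ j' ∈ A, j.1 + 3 ≤ j'.1 := by
    intro j _
    by_contra hno
    push Not at hno
    have hsub : A ⊆ Subtype.val ⁻¹' (Set.Iio (j.1 + 3)) := fun j' hj' => hno j' hj'
    exact Set.infinite_coe_iff.1 hfib
      (((Set.finite_Iio _).preimage Subtype.val_injective.injOn).subset hsub)
  -- A round enters a level without entries in its view, whereas the entries of all earlier rounds
  -- are visible.
  have hinj : ∀ j ∈ A, ∀ j' ∈ A, j.1 < j'.1 → l j ≠ l j' := by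
    intro j hj j' hj' hlt heq
    have hmem : h (j + 1) ∈ S j' := Q.mem_of_le (Nat.succ_le_of_lt hlt)
    rw [he, heq, (hp₀ j hj).1, (hp₀ j hj).2, ← (hp₀ j' hj').1, ← (hp₀ j' hj').2, hc, hl] at hmem
    exact level_spec _ _ _ ⟨_, hmem⟩
  -- A commit would make the state agreed, so a later round could not concern it again. Hence the
  -- round meets a different proposal, and above level `0` this forces a divergence at the level
  -- below.
  have hdiv : ∀ j ∈ A, l j ∈ insert 0 (Nat.succ '' {l | Diverges R p₀ c₀ l}) := by
    intro j hj
    obtain ⟨hpj, hcj⟩ := hp₀ j hj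
    rcases hend j with ⟨m, e, hcom⟩ | ⟨e, hne, g, hg⟩
    · obtain ⟨j', hj', hle⟩ := hlater j hj
      have hmem : h (j + 3) ∈ S j' := Q.mem_of_le hle
      rw [hcom, he, hpj, hcj, ← (hp₀ j' hj').1, ← (hp₀ j' hj').2, hc j'] at hmem
      exact absurd ⟨_, _, _, _, hmem⟩ (count_spec _ _ _)
    · rcases hlj : l j with _ | l'
      · exact Set.mem_insert _ _
      · refine Set.mem_insert_of_mem _ ⟨l', ?_, rfl⟩
        have h1 : Reached R (h (j + 1)) := reached_of_mem (Q.view (j + 1)) (Q.mem _)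
        rw [he, hlj, hpj, hcj] at h1
        rw [hlj, hpj, hcj] at hg
        exact diverges_of_enter (reached_of_mem (Q.view (j + 2)) hg) h1 hne
  refine Set.infinite_coe_iff.1 hfib (Set.Finite.of_injOn (f := l) hdiv ?_
    (((finite_diverges p₀ c₀).image _).insert 0))
  intro j hj j' hj' heq
  rcases lt_trichotomy j.1 j'.1 with hlt | heq' | hlt
  · exact absurd heq (hinj j hj j' hj' hlt)
  · exact Subtype.ext heq'
  · exact absurd heq.symm (hinj j' hj' j hj hlt)

/-- At most `t` simulated processes stagnate, so the replayed execution is subject to resilience and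
some simulated process decides. As its count is unbounded, the deciding state is agreed in some
view, which `not_output` forbids. -/
lemma false {T : ColorlessTask V W} (Q : Trace R h r S) (hP : P.SolvesResilient t T) (htn : t < n)
    (s : {s : Finset V // s ∈ T.input.faces}) (hv : ∀ p, v p ∈ s.1) : False := by
  obtain ⟨u, time, hu, X⟩ := exists_replay R
  have hB := Q.ncard_bounded_le
  set B := {p | ∃ N, ∀ k, count (viewAt R k) p ≤ N} with hBdef
  obtain ⟨p, hp⟩ : ∃ p, p ∉ B := by
    by_contra hall
    push Not at hall
    rw [Set.eq_univ_of_forall hall, Set.ncard_univ, Nat.card_eq_fintype_card,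
      Fintype.card_fin] at hB
    lia
  have hgrow : ∀ p ∉ B, ∀ N, ∃ k, N < count (viewAt R k) p := by
    intro p hp N
    simpa [hBdef] using fun hN => hp ⟨N, hN⟩
  obtain ⟨k, w, hw⟩ := hP.eventually_decides s u
    (fun p => by obtain ⟨q, hq⟩ := hu p; rw [hq]; exact hv q) X.schedule X.schedule_prefix B hB
    (fun p hp N => by
      obtain ⟨k, hk⟩ := hgrow p hp (N + 1)
      refine ⟨k, ?_⟩
      rw [X.count_schedule]
      unfold Protocol.Replay.steps
      split_ifs <;> lia) hp
  rw [X.action_exec_schedule] at hw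
  obtain ⟨k', hk'⟩ := hgrow p hp (X.steps k p)
  obtain ⟨d, hd⟩ := exists_decided hk'
  have hV : viewAt R k' ∈ R.views := by
    refine (viewAt_mem R k').resolve_left fun h => ?_
    rw [h, count_empty] at hk'
    lia
  exact Q.not_output hV w ⟨p, _, d, hd, by rwa [← state_eq hV hd]⟩

end Trace

theorem simulation_solves {T : ColorlessTask V W} (hP : P.SolvesResilient t T) (htn : t < n) :
    (simulation P t).Solves n t T := by
  intro s v hv F hF R
  refine ⟨?_, ?_⟩
  · by_cases h : ∃ k₀, ∀ k, k₀ ≤ k → R.item k = R.item k₀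
    · obtain ⟨k₀, hk₀⟩ := h
      exact fun p hp => not_stuck htn hF hk₀ p hp
    · push Not at h
      obtain ⟨q, hq⟩ := exists_unbounded h
      obtain ⟨h, r, S, Q⟩ := exists_trace hq
      exact (Q.false hP htn s hv).elim
  · obtain ⟨τ, hτ, hout⟩ := exists_face_output (R := R) hP (by lia) s hv
    refine ⟨τ, hτ, fun p w hw => ?_⟩
    obtain ⟨k, S, hS, hact⟩ := R.decides p w hw
    exact hout S hS w (act_decide hact)

end Run

end History

lemma SnapshotSolvable.exists_setCode {n t : ℕ} {V W : Type} {T : ColorlessTask V W} (htn : t < n)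
    (h : SnapshotSolvable n t T) :
    ∃ (X : Type) (C : SetCode V W X), (∀ x S, C.act x S ≠ .advance x) ∧ C.Solves n t T := by
  obtain ⟨K, Y, y₀, P, hP⟩ := h
  rcases isEmpty_or_nonempty V with hV | hV
  -- Without input values there are no input assignments, and any code will do.
  · exact ⟨Unit, ⟨fun _ => (), fun _ _ => .wait⟩, fun _ _ => nofun,
      fun _ v => isEmptyElim (v ⟨0, by lia⟩)⟩
  · have : Nonempty P.Local := ⟨P.start ⟨0, by lia⟩ hV.some⟩
    refine ⟨_, History.simulation P t, fun x S hx => ?_, History.simulation_solves hP htn⟩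
    obtain ⟨-, r, hr, -⟩ := History.act_advance hx
    exact List.cons_ne_self r x hr.symm

end AnonTask

theorem mainTheorem1 (n t : ℕ) (ht : 1 ≤ t) (htn : t < n) (V W : Type) [Finite V] [Finite W]
    (T : AnonTask.ColorlessTask V W) :
    (AnonTask.AnonymousWeakSetSolvable n t T ↔ AnonTask.SnapshotSolvable n t T) ∧
    (AnonTask.AnonymousWeakSetSolvable n t T ∨ (∃ m, AnonTask.AnonymousRegisterSolvable n t m T) →
      AnonTask.AnonymousRegisterSolvable n t n T) := by
  refine ⟨⟨fun h => h.snapshotSolvable htn, fun h => ?_⟩, fun h => ?_⟩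
  · obtain ⟨X, C, hne, hC⟩ := h.exists_setCode htn
    exact hC.anonymousWeakSetSolvable htn hne
  · have hw : AnonTask.AnonymousWeakSetSolvable n t T := by
      rcases h with h | ⟨m, h⟩
      · exact h
      · exact h.anonymousWeakSetSolvable htn
    obtain ⟨X, C, hne, hC⟩ := (hw.snapshotSolvable htn).exists_setCode htn
    exact hC.anonymousRegisterSolvable htn hne
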